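/- Let $n\ge 1$ and let $\mathcal H:\mathbb S^n\to\mathbb R$ be a $C^1$ function on the unit sphere $\mathbb S^n\subset\mathbb R^{n+1}$. Let $v_1,\dots,v_n\in\mathbb R^{n+1}$ be linearly independent unit vectors, let $\Pi_i=v_i^{\perp}$, and let $T_i:\mathbb S^n\to\mathbb S^n$ be the geodesic reflection obtained by restricting to $\mathbb S^n$ the Euclidean reflection in the hyperplane $\Pi_i$. Assume that $\mathcal H\circ T_i=\mathcal H$ for $i=1,\dots,n$. Let $2\le k\le\infty$ and let $\Sigma\subset\mathbb R^{n+1}$ be a compact connected embedded hypersurface (without boundary) of class $C^k$ with prescribed mean curvature $\mathcal H$; that is, $\Sigma=\psi(M)$ for a $C^k$ embedding $\psi:M\to\mathbb R^{n+1}$ of a compact connected $n$-manifold $M$ of class $C^k$, oriented by a Gauss map $\eta:M\to\mathbb S^n$ (a $C^1$ unit normal field), and $H_\Sigma=\mathcal H\circ\eta$, where $nH_\Sigma$ is the trace of the shape operator $-d\eta$ (so the unit sphere with its inner normal has $H=1$). Then: 1. $\Sigma$ (that is, $M$) is $C^k$-diffeomorphic to $\mathbb S^n$. 2. For each $i=1,\dots,n$,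 $\Sigma$ is a symmetric bi-graph with respect to some hyperplane $\hat\Pi_i=\{x:\langle x,v_i\rangle=c_i\}$ parallel to $\Pi_i$. That is, $\Sigma$ is invariant under the reflection in $\hat\Pi_i$, and there are a nonempty connected relatively open set $\Omega_i\subset\hat\Pi_i$ and a continuous function $u_i:\overline{\Omega_i}\to[0,\infty)$ that is positive and of class $C^k$ on $\Omega_i$ and zero on $\partial\Omega_i$, such that $\Sigma\cap\{x:\langle x,v_i\rangle\ge c_i\}=\{y+u_i(y)v_i: y\in\overline{\Omega_i}\}$. -/

import Mathlib

open Set Metric Manifold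
open scoped ContDiff RealInnerProductSpace InnerProductSpace

/-- The geodesic reflection of the unit sphere determined by `v ≠ 0`: the restriction to the sphere
of the Euclidean reflection whose fixed hyperplane is `v^⊥`. -/
noncomputable def geodesicReflection {E : Type*} [NormedAddCommGroup E] [InnerProductSpace ℝ E]
    (v : E) (x : sphere (0 : E) 1) : sphere (0 : E) 1 :=
  ⟨(ℝ ∙ v)ᗮ.reflection (x : E), by simp⟩

section Hypersurface

variable {n : ℕ} {M : Type*} [TopologicalSpace M] [ChartedSpace (EuclideanSpace ℝ (Fin n)) M]

/-- `ψ` is a `C^k` embedding of the `n`-manifold `M` into `ℝ^{n+1}`: a `C^k` map with injective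
differentials (an immersion) that is a homeomorphism onto its image. Here `mvfderiv (𝓡 n) ψ p` is the differential
`dψ_p : T_pM → ℝ^{n+1}`. -/
structure IsEmbeddedHypersurface (k : ℕ∞) (ψ : M → EuclideanSpace ℝ (Fin (n + 1))) : Prop where
  contMDiff : ContMDiff (𝓡 n) 𝓘(ℝ, EuclideanSpace ℝ (Fin (n + 1))) k ψ
  injective_mvfderiv : ∀ p : M, Function.Injective (mvfderiv (𝓡 n) ψ p)
  isEmbedding : Topology.IsEmbedding ψ

/-- `η` is a Gauss map (a unit normal field of class `C^1`, i.e. an orientation) of the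
hypersurface `ψ`: at each `p`, the unit vector `η p` is orthogonal to the image of `dψ_p`. -/
structure IsGaussMap (ψ : M → EuclideanSpace ℝ (Fin (n + 1)))
    (η : M → sphere (0 : EuclideanSpace ℝ (Fin (n + 1))) 1) : Prop where
  contMDiff : ContMDiff (𝓡 n) 𝓘(ℝ, EuclideanSpace ℝ (Fin (n + 1))) 1
    (fun q => (η q : EuclideanSpace ℝ (Fin (n + 1))))
  orthogonal : ∀ (p : M) (w : TangentSpace (𝓡 n) p),
    inner ℝ (η p : EuclideanSpace ℝ (Fin (n + 1))) (mvfderiv (𝓡 n) ψ p w) = 0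

/-- `A` is the shape operator `-dη` at `p`, where `T_pM` is identified with its image in `ℝ^{n+1}`
by `dψ_p`: that is, `dψ_p (A w) = - dη_p w` for every `w` in `T_pM`. -/
def IsShapeOperatorAt (ψ : M → EuclideanSpace ℝ (Fin (n + 1)))
    (η : M → sphere (0 : EuclideanSpace ℝ (Fin (n + 1))) 1) (p : M)
    (A : TangentSpace (𝓡 n) p →ₗ[ℝ] TangentSpace (𝓡 n) p) : Prop :=
  ∀ w : TangentSpace (𝓡 n) p,
    mvfderiv (𝓡 n) ψ p (A w) =
      -mvfderiv (𝓡 n) (fun q => (η q : EuclideanSpace ℝ (Fin (n + 1)))) p w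

/-- The mean curvature at `p` equals `h`: the trace of the shape operator is `n * h`.
With this normalization the unit sphere with its inner normal has mean curvature `1`. -/
def HasMeanCurvatureAt (ψ : M → EuclideanSpace ℝ (Fin (n + 1)))
    (η : M → sphere (0 : EuclideanSpace ℝ (Fin (n + 1))) 1) (p : M) (h : ℝ) : Prop :=
  ∃ A : TangentSpace (𝓡 n) p →ₗ[ℝ] TangentSpace (𝓡 n) p,
    IsShapeOperatorAt ψ η p A ∧ LinearMap.trace ℝ (TangentSpace (𝓡 n) p) A = n * h

/-- `ψ`, oriented by `η`, is an embedded hypersurface of class `C^k` with prescribed mean curvature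
`ℋ`: its mean curvature function is `ℋ ∘ η`. -/
structure IsEmbeddedHHypersurface (k : ℕ∞)
    (ℋ : sphere (0 : EuclideanSpace ℝ (Fin (n + 1))) 1 → ℝ)
    (ψ : M → EuclideanSpace ℝ (Fin (n + 1)))
    (η : M → sphere (0 : EuclideanSpace ℝ (Fin (n + 1))) 1) : Prop where
  isEmbeddedHypersurface : IsEmbeddedHypersurface k ψ
  isGaussMap : IsGaussMap ψ η
  hasMeanCurvatureAt : ∀ p : M, HasMeanCurvatureAt ψ η p (ℋ (η p))

end Hypersurface

/-- `S` is a symmetric bi-graph of class `C^k` with respect to the hyperplane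
`Π = {x | ⟪v, x⟫ = c}`, where `v` is a unit vector: `S` is invariant under the reflection in `Π`,
and the part of `S` in the closed half-space `{x | c ≤ ⟪v, x⟫}` is the graph, over the closure of a
domain `Ω` of `Π`, of a continuous function `u` that is positive and `C^k` on `Ω` and vanishes on
the boundary of `Ω`. The points of `Π` are written `c • v + w` with `w` in `v^⊥`. -/
structure IsSymmetricBigraph {E : Type*} [NormedAddCommGroup E] [InnerProductSpace ℝ E]
    (k : ℕ∞) (S : Set E) (v : E) (c : ℝ) : Prop where
  symm : ∀ x ∈ S, x + (2 * (c - inner ℝ v x)) • v ∈ S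
  graph : ∃ (Ω : Set (ℝ ∙ v)ᗮ) (u : (ℝ ∙ v)ᗮ → ℝ),
    IsOpen Ω ∧ IsConnected Ω ∧
    ContDiffOn ℝ k u Ω ∧ ContinuousOn u (closure Ω) ∧
    (∀ w ∈ Ω, 0 < u w) ∧ (∀ w ∈ frontier Ω, u w = 0) ∧
    S ∩ {x : E | c ≤ inner ℝ v x} =
      (fun w : (ℝ ∙ v)ᗮ => c • v + (w : E) + u w • v) '' closure Ω

/-!
The proof is Alexandrov's method of moving planes in each of the directions `v i`, followed by a
flow argument that uses all the symmetries at once.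

Near each of its points the hypersurface is the zero set of a function `s` whose gradient is normal
to it, and the prescribed mean curvature becomes a quasilinear elliptic equation for `s`
(`IsEmbeddedHHypersurface.exists_isGraphFunction`). The difference of two solutions satisfies a
linear elliptic inequality, to which the Hopf lemma and the strong maximum principle apply
(`IsEllipticSupersolution.hopf`, `IsEllipticSupersolution.eq_zero`). Hence two domains with the same
prescribed mean curvature, one inside the other, that touch at a boundary point coincide near that
point.

The hypersurface is the boundary of a compact set `K`, by the Jordan–Brouwer theorem
(`IsClosedHypersurface.exists_bounded_side`): the side on which a point lies relative to its nearest
points of the hypersurface gives a map from the whole space to the circle that winds once across the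
hypersurface, and a lift of this map to the line vanishes exactly on the hypersurface. Since `ℋ` is
invariant under the reflection in `v iᗮ`, the reflection of `K` in any parallel plane has the same
prescribed mean curvature as `K`. Moving such planes down from above `K` as long as the vertical
segments from points of `K` to their reflections stay in `K`, one reaches a lowest plane, and the
descent can only stop there because it is a plane of symmetry (`IsMovingPlaneDomain.exists_isSymmetryHeight`). Above that
plane the outer normal points upwards, so the boundary is a bi-graph over the slice of the interior
of `K` by the plane (`IsSymmetryHeight.isSymmetricBigraph`); the slice is connected because its
closure is the projection of the connected boundary.

The `n` planes of symmetry meet in a line, with direction `e`. The intersection of `K` with this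
axis is a segment with centre `p`. On the boundary, `⟪v i, x - p⟫` and the component of the outer
normal along `v i` have the same sign, so for large `C` the linear field
`x ↦ C • ∑ i, ⟪v i, x - p⟫ v i + ⟪e, x - p⟫ e` crosses the boundary outwards
(`exists_transverse_field`). It also crosses the unit sphere around `p` outwards, and its flow lines
identify the two hypersurfaces (`IsEmbeddedHypersurface.nonempty_diffeomorph_sphere`).
-/

open Filter Topology

set_option linter.unusedSectionVars false

/-! ### The Hopf lemma and the strong maximum principle -/

section MaximumPrinciple

variable {E : Type*} [NormedAddCommGroup E] [InnerProductSpace ℝ E] [FiniteDimensional ℝ E]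
  [CompleteSpace E]

/-- The Hessian of `f` at `z`, as the derivative of the gradient. -/
noncomputable def hessian (f : E → ℝ) (z : E) : E →L[ℝ] E := fderiv ℝ (gradient f) z

/-- The trace of `X` over the orthogonal complement of `p ≠ 0`. For `p = ∇f` and `X` the Hessian
of `f`, it is `‖∇f‖` times the divergence of the unit normal field `∇f / ‖∇f‖`. -/
noncomputable def tangentialTrace (p : E) (X : E →L[ℝ] E) : ℝ :=
  LinearMap.trace ℝ E X.toLinearMap - ⟪p, X p⟫_ℝ / ‖p‖ ^ 2

lemma contDiffAt_gradient {f : E → ℝ} {z : E} {k m : WithTop ℕ∞} (hf : ContDiffAt ℝ k f z)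
    (hm : m + 1 ≤ k) : ContDiffAt ℝ m (gradient f) z :=
  ((InnerProductSpace.toDual ℝ E).symm.contDiff.contDiffAt).comp z (hf.fderiv_right hm)

lemma ContDiffAt.hasFDerivAt_gradient_hessian {f : E → ℝ} {z : E} (hf : ContDiffAt ℝ 2 f z) :
    HasFDerivAt (gradient f) (hessian f z) z :=
  ((contDiffAt_gradient hf (m := 1) (by norm_num)).differentiableAt (by norm_num)).hasFDerivAt

lemma ContDiffAt.eventually_hasGradientAt {f : E → ℝ} {z : E} (hf : ContDiffAt ℝ 2 f z) :
    ∀ᶠ x in 𝓝 z, HasGradientAt f (gradient f x) x := by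
  filter_upwards [hf.eventually (by simp)] with x hx
  exact (hx.differentiableAt (by norm_num)).hasGradientAt

lemma gradient_sub {f g : E → ℝ} {z : E} (hf : DifferentiableAt ℝ f z)
    (hg : DifferentiableAt ℝ g z) :
    gradient (fun x => f x - g x) z = gradient f z - gradient g z := by
  have : HasGradientAt (fun x => f x - g x) (gradient f z - gradient g z) z := by
    rw [hasGradientAt_iff_hasFDerivAt, map_sub]
    exact hf.hasGradientAt.hasFDerivAt.sub hg.hasGradientAt.hasFDerivAt
  exact this.gradient

lemma hessian_sub {f g : E → ℝ} {z : E} (hf : ContDiffAt ℝ 2 f z) (hg : ContDiffAt ℝ 2 g z) :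
    hessian (fun x => f x - g x) z = hessian f z - hessian g z := by
  have : gradient (fun x => f x - g x) =ᶠ[𝓝 z] fun x => gradient f x - gradient g x := by
    filter_upwards [hf.eventually (by simp), hg.eventually (by simp)] with x hx hx'
    exact gradient_sub (hx.differentiableAt (by norm_num)) (hx'.differentiableAt (by norm_num))
  exact ((hf.hasFDerivAt_gradient_hessian.sub
    hg.hasFDerivAt_gradient_hessian).congr_of_eventuallyEq this).fderiv

/-- The necessary second-order condition at a local minimum. -/
lemma IsLocalMin.inner_hessian_nonneg {f : E → ℝ} {z : E} (h : IsLocalMin f z)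
    (hf : ContDiffAt ℝ 2 f z) (w : E) : 0 ≤ ⟪w, hessian f z w⟫_ℝ := by
  by_contra! hneg
  let l : ℝ → E := fun t => z + t • w
  have hl : ∀ t, HasDerivAt l w t := fun t => by
    simpa [l] using ((hasDerivAt_id t).smul_const w).const_add z
  have hl0 : l 0 = z := by simp [l]
  have hlt : Tendsto l (𝓝 0) (𝓝 z) := by
    simpa [hl0] using (hl 0).continuousAt.tendsto
  have hd : deriv (f ∘ l) =ᶠ[𝓝 0] fun t => ⟪gradient f (l t), w⟫_ℝ := by
    filter_upwards [hlt.eventually hf.eventually_hasGradientAt] with t ht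
    have := (ht.hasFDerivAt.comp_hasDerivAt t (hl t)).deriv
    simpa using this
  have hdd : deriv (deriv (f ∘ l)) 0 = ⟪w, hessian f z w⟫_ℝ := by
    rw [hd.deriv_eq]
    have h1 : HasDerivAt (fun t => gradient f (l t)) (hessian f z w) 0 := by
      have := hf.hasFDerivAt_gradient_hessian
      rw [← hl0] at this
      have := this.comp_hasDerivAt (0 : ℝ) (hl 0)
      rwa [hl0] at this
    have h2 := (h1.inner ℝ (hasDerivAt_const (0 : ℝ) w)).deriv
    rw [h2]; simp [real_inner_comm]
  have hmin : IsLocalMin (f ∘ l) 0 := by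
    have := hlt.eventually h
    filter_upwards [this] with t ht
    simpa [hl0] using ht
  have hd0 : deriv (f ∘ l) 0 = 0 := hmin.deriv_eq_zero
  have hcont : ContinuousAt (f ∘ l) 0 :=
    ContinuousAt.comp (by rw [hl0]; exact hf.continuousAt) (hl 0).continuousAt
  have hmax := isLocalMax_of_deriv_deriv_neg (by rw [hdd]; exact hneg) hd0 hcont
  have hconst : f ∘ l =ᶠ[𝓝 0] fun _ => (f ∘ l) 0 := by
    filter_upwards [hmin, hmax] with t h1 h2
    exact le_antisymm h2 h1
  have : deriv (deriv (f ∘ l)) 0 = 0 := by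
    rw [hconst.deriv.deriv_eq]; simp
  linarith

lemma inner_le_trace_of_nonneg {X : E →L[ℝ] E} (hX : ∀ w, 0 ≤ ⟪w, X w⟫_ℝ) {u : E}
    (hu : ‖u‖ = 1) : ⟪u, X u⟫_ℝ ≤ LinearMap.trace ℝ E X.toLinearMap := by
  have ho : Orthonormal ℝ ((↑) : ({u} : Set E) → E) := by
    classical
    rw [orthonormal_subtype_iff_ite]
    intro a ha b hb
    rw [mem_singleton_iff] at ha hb
    subst ha hb
    simp [hu]
  obtain ⟨S, b, hS, hb⟩ := ho.exists_orthonormalBasis_extension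
  rw [LinearMap.trace_eq_sum_inner _ b]
  have hmem : u ∈ S := by simpa using hS
  have := Finset.single_le_sum (f := fun i => ⟪b i, X (b i)⟫_ℝ) (fun i _ => hX (b i))
    (Finset.mem_univ (⟨u, hmem⟩ : S))
  simpa [hb] using this

lemma tangentialTrace_nonneg {X : E →L[ℝ] E} (hX : ∀ w, 0 ≤ ⟪w, X w⟫_ℝ) {p : E} (hp : p ≠ 0) :
    0 ≤ tangentialTrace p X := by
  have h := inner_le_trace_of_nonneg hX (norm_smul_inv_norm (𝕜 := ℝ) hp)
  have hp' : ‖p‖ ≠ 0 := norm_ne_zero_iff.2 hp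
  have : ⟪p, X p⟫_ℝ / ‖p‖ ^ 2 = ⟪(‖p‖⁻¹ : ℝ) • p, X ((‖p‖⁻¹ : ℝ) • p)⟫_ℝ := by
    simp [inner_smul_left, inner_smul_right]
    field_simp
  unfold tangentialTrace
  rw [this]
  simpa using h

lemma tangentialTrace_sub (p : E) (X Y : E →L[ℝ] E) :
    tangentialTrace p (X - Y) = tangentialTrace p X - tangentialTrace p Y := by
  simp [tangentialTrace, inner_sub_right]; ring

lemma tangentialTrace_smul (p : E) (a : ℝ) (X : E →L[ℝ] E) :
    tangentialTrace p (a • X) = a * tangentialTrace p X := by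
  simp [tangentialTrace, inner_smul_right]; ring

/-- The radial barrier `exp (-α ‖z - c‖²)`. -/
noncomputable def gaussianBarrier (α : ℝ) (c z : E) : ℝ := Real.exp (-α * ‖z - c‖ ^ 2)

lemma contDiff_gaussianBarrier (α : ℝ) (c : E) {k : WithTop ℕ∞} :
    ContDiff ℝ k (gaussianBarrier α c) :=
  (contDiff_const.mul ((contDiff_id.sub contDiff_const).norm_sq ℝ)).exp

lemma gradient_gaussianBarrier (α : ℝ) (c z : E) :
    gradient (gaussianBarrier α c) z = (-2 * α * gaussianBarrier α c z) • (z - c) := by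
  have h1 : HasFDerivAt (fun z : E => ‖z - c‖ ^ 2) (2 • innerSL ℝ (z - c)) z := by
    simpa using ((hasFDerivAt_id z).sub_const c).norm_sq
  have h2 := (h1.const_mul (-α)).exp
  have h3 : HasGradientAt (gaussianBarrier α c) ((-2 * α * gaussianBarrier α c z) • (z - c)) z := by
    rw [hasGradientAt_iff_hasFDerivAt]
    refine h2.congr_fderiv ?_
    ext w
    simp [gaussianBarrier]
    ring
  exact h3.gradient

lemma hessian_gaussianBarrier_apply (α : ℝ) (c z w : E) :
    hessian (gaussianBarrier α c) z w = gaussianBarrier α c z •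
      ((4 * α ^ 2 * ⟪z - c, w⟫_ℝ) • (z - c) - (2 * α) • w) := by
  have h0 : gradient (gaussianBarrier α c) =
      fun z => (-2 * α * gaussianBarrier α c z) • (z - c) :=
    funext (gradient_gaussianBarrier α c)
  have hd : HasFDerivAt (gaussianBarrier α c)
      (InnerProductSpace.toDual ℝ E (gradient (gaussianBarrier α c) z)) z :=
    (((contDiff_gaussianBarrier α c (k := 1)).contDiffAt.differentiableAt
      (by norm_num)).hasGradientAt).hasFDerivAt
  have h1 := (hd.const_mul (-2 * α)).smul ((hasFDerivAt_id z).sub_const c)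
  rw [hessian, h0]
  refine (congrArg (fun L : E →L[ℝ] E => L w) h1.fderiv).trans ?_
  rw [gradient_gaussianBarrier]
  simp [smul_smul, inner_sub_left]
  module

lemma trace_hessian_gaussianBarrier (α : ℝ) (c z : E) :
    LinearMap.trace ℝ E (hessian (gaussianBarrier α c) z).toLinearMap =
      gaussianBarrier α c z * (4 * α ^ 2 * ‖z - c‖ ^ 2 - 2 * α * Module.finrank ℝ E) := by
  have h : (hessian (gaussianBarrier α c) z).toLinearMap = gaussianBarrier α c z •
      ((4 * α ^ 2) • ((innerSL ℝ (z - c)).toLinearMap.smulRight (z - c)) -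
        (2 * α) • LinearMap.id) := by
    ext w
    simp [hessian_gaussianBarrier_apply, smul_smul, inner_sub_left]
  rw [h]
  simp [LinearMap.trace_smulRight, -map_sub, LinearMap.trace_id,
    map_sub (LinearMap.trace ℝ E)]

/-- A vector `p` close to the unit vector `N₀` spans nearly the same line. -/
lemma inner_sq_div_le {N₀ p : E} (hN : ‖N₀‖ = 1) (hp : ‖p - N₀‖ ≤ 1 / 20) (y : E) :
    ⟪y, p⟫_ℝ ^ 2 / ‖p‖ ^ 2 ≤ ⟪y, N₀⟫_ℝ ^ 2 + ‖y‖ ^ 2 / 2 := by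
  have h1 : 19 / 20 ≤ ‖p‖ := by
    have := norm_sub_norm_le N₀ p
    rw [norm_sub_rev] at this; linarith
  have h2 : |⟪y, p⟫_ℝ - ⟪y, N₀⟫_ℝ| ≤ ‖y‖ / 20 := by
    rw [← inner_sub_right]
    calc _ ≤ ‖y‖ * ‖p - N₀‖ := abs_real_inner_le_norm _ _
      _ ≤ _ := by nlinarith [norm_nonneg y]
  have h3 : |⟪y, N₀⟫_ℝ| ≤ ‖y‖ := by
    simpa [hN] using abs_real_inner_le_norm y N₀
  rw [div_le_iff₀ (by positivity)]
  set a := ⟪y, p⟫_ℝ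
  set b := ⟪y, N₀⟫_ℝ
  set m := ‖y‖
  have hm : 0 ≤ m := norm_nonneg y
  have h4 : a ^ 2 ≤ (|b| + m / 20) ^ 2 := by
    rw [← sq_abs a]
    have : |a| ≤ |b| + m / 20 := by
      have := abs_sub_abs_le_abs_sub a b; linarith
    gcongr
  have h5 : (19 / 20 : ℝ) ^ 2 ≤ ‖p‖ ^ 2 := by gcongr
  have h6 : (b ^ 2 + m ^ 2 / 2) * (19 / 20 : ℝ) ^ 2 ≤ (b ^ 2 + m ^ 2 / 2) * ‖p‖ ^ 2 := by gcongr
  rw [← sq_abs b] at *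
  have hb := abs_nonneg b
  nlinarith [mul_nonneg hb hm, mul_nonneg hb (sub_nonneg.2 h3), mul_nonneg hm (sub_nonneg.2 h3)]

/-- For large `α`, the barrier is a subsolution away from its centre. The term in the direction
`N₀` compensates for the degeneracy of `tangentialTrace p` in the direction `p`. -/
lemma tangentialTrace_gaussianBarrier_ge {N₀ p : E} (hN : ‖N₀‖ = 1) (hp : ‖p - N₀‖ ≤ 1 / 20)
    {α : ℝ} (c z : E) :
    gaussianBarrier α c z * (2 * α ^ 2 * ‖z - c‖ ^ 2 - 2 * α * Module.finrank ℝ E) ≤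
      tangentialTrace p (hessian (gaussianBarrier α c) z) +
        ⟪N₀, hessian (gaussianBarrier α c) z N₀⟫_ℝ := by
  have hp0 : p ≠ 0 := by
    rintro rfl
    norm_num [hN] at hp
  have hp' : ‖p‖ ≠ 0 := norm_ne_zero_iff.2 hp0
  have key := inner_sq_div_le hN hp (z - c)
  have hb : 0 < gaussianBarrier α c z := Real.exp_pos _
  rw [tangentialTrace, trace_hessian_gaussianBarrier, hessian_gaussianBarrier_apply,
    hessian_gaussianBarrier_apply]
  generalize gaussianBarrier α c z = b at *
  have e1 : ⟪p, b • ((4 * α ^ 2 * ⟪z - c, p⟫_ℝ) • (z - c) - (2 * α) • p)⟫_ℝ / ‖p‖ ^ 2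
      = b * (4 * α ^ 2 * (⟪z - c, p⟫_ℝ ^ 2 / ‖p‖ ^ 2) - 2 * α) := by
    rw [inner_smul_right, inner_sub_right, inner_smul_right, inner_smul_right,
      real_inner_comm, real_inner_self_eq_norm_sq]
    field_simp
  have e2 : ⟪N₀, b • ((4 * α ^ 2 * ⟪z - c, N₀⟫_ℝ) • (z - c) - (2 * α) • N₀)⟫_ℝ
      = b * (4 * α ^ 2 * ⟪z - c, N₀⟫_ℝ ^ 2 - 2 * α) := by
    rw [inner_smul_right, inner_sub_right, inner_smul_right, inner_smul_right,
      real_inner_comm, real_inner_self_eq_norm_sq, hN]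
    ring
  rw [e1, e2]
  have : 0 ≤ b * (4 * α ^ 2) := by positivity
  nlinarith [mul_le_mul_of_nonneg_left key this]

/-- `d` satisfies on `U` the differential inequality `L d ≤ C ‖∇d‖`, where
`L d = tr (D²d) - D²d(p, p) / ‖p‖² + D²d(N₀, N₀)` is a second-order operator which is uniformly
elliptic because the vector field `p` stays close to the unit vector `N₀`. -/
structure IsEllipticSupersolution (N₀ : E) (p : E → E) (C : ℝ) (d : E → ℝ) (U : Set E) :
    Prop where
  norm_eq_one : ‖N₀‖ = 1
  contDiffAt : ∀ z ∈ U, ContDiffAt ℝ 2 d z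
  norm_sub_le : ∀ z ∈ U, ‖p z - N₀‖ ≤ 1 / 20
  le : ∀ z ∈ U, tangentialTrace (p z) (hessian d z) + ⟪N₀, hessian d z N₀⟫_ℝ ≤ C * ‖gradient d z‖

lemma IsEllipticSupersolution.mono {N₀ : E} {p : E → E} {C : ℝ} {d : E → ℝ} {U V : Set E}
    (h : IsEllipticSupersolution N₀ p C d U) (hV : V ⊆ U) :
    IsEllipticSupersolution N₀ p C d V :=
  ⟨h.1, fun z hz => h.2 z (hV hz), fun z hz => h.3 z (hV hz), fun z hz => h.4 z (hV hz)⟩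

/-- The Hopf boundary point lemma: a nonnegative supersolution that vanishes at a boundary point
of a ball, but not inside, has a nonzero inner radial derivative there. -/
theorem IsEllipticSupersolution.hopf {N₀ : E} {p : E → E} {C : ℝ} {d : E → ℝ} {U : Set E}
    (h : IsEllipticSupersolution N₀ p C d U) {c x₀ : E} {R : ℝ} (hR : 0 < R)
    (hU : closedBall c R ⊆ U) (hpos : ∀ z ∈ ball c R, 0 < d z) (hx₀ : ‖x₀ - c‖ = R)
    (hd : d x₀ = 0) : 0 < fderiv ℝ d x₀ (c - x₀) := by
  obtain ⟨C', hC', hCC'⟩ : ∃ C' : ℝ, 0 ≤ C' ∧ C ≤ C' := ⟨max C 0, le_max_right _ _, le_max_left _ _⟩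
  set m : ℝ := (Module.finrank ℝ E : ℝ) with hm
  have hm0 : 0 ≤ m := by positivity
  -- this choice of `α` makes the Gaussian barrier a strict subsolution for `R / 2 < ‖z - c‖ ≤ R`
  set α : ℝ := 4 * (m + C' * R + 1) / R ^ 2 with hα
  have hα0 : 0 < α := by positivity
  have hαR : α * R ^ 2 = 4 * (m + C' * R + 1) := by rw [hα]; field_simp
  set b := gaussianBarrier α c with hb
  set b₀ : ℝ := Real.exp (-α * R ^ 2) with hb₀
  have hdc : ContinuousOn d (closedBall c R) := fun z hz =>
    (h.contDiffAt z (hU hz)).continuousAt.continuousWithinAt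
  have hb1 : ∀ z, b z ≤ 1 := fun z => by
    rw [hb, gaussianBarrier, Real.exp_le_one_iff]
    have : 0 ≤ α * ‖z - c‖ ^ 2 := by positivity
    linarith
  -- a positive lower bound for `d` on the inner ball
  obtain ⟨ε, hε, hεd⟩ : ∃ ε > 0, ∀ z ∈ closedBall c (R / 2), ε ≤ d z := by
    have hsub : closedBall c (R / 2) ⊆ ball c R := closedBall_subset_ball (by linarith)
    obtain ⟨z, hz, hzmin⟩ := (isCompact_closedBall c (R / 2)).exists_isMinOn
      ⟨c, mem_closedBall_self (by linarith)⟩ (hdc.mono (hsub.trans ball_subset_closedBall))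
    exact ⟨d z, hpos z (hsub hz), fun y hy => hzmin hy⟩
  have hd0 : ∀ z ∈ closedBall c R, 0 ≤ d z := by
    rw [← closure_ball c hR.ne'] at hdc ⊢
    exact fun z hz => ContinuousWithinAt.closure_le hz continuousWithinAt_const
      ((hdc z hz).mono subset_closure) fun y hy => (hpos y hy).le
  let G : E → ℝ := fun z => d z - ε * (b z - b₀)
  have hGc : ContinuousOn G (closedBall c R) := hdc.sub
    (((contDiff_gaussianBarrier α c (k := 0)).continuous.sub
      continuous_const).const_smul ε).continuousOn
  -- the minimum of `G` over the closed ball is nonnegative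
  have hG0 : ∀ z ∈ closedBall c R, 0 ≤ G z := by
    obtain ⟨z, hz, hzmin⟩ := (isCompact_closedBall c R).exists_isMinOn
      ⟨c, mem_closedBall_self hR.le⟩ hGc
    suffices 0 ≤ G z from fun y hy => this.trans (hzmin hy)
    by_contra! hneg
    have hz1 : ‖z - c‖ ≤ R := by simpa [dist_eq_norm] using hz
    have hz2 : R / 2 < ‖z - c‖ := by
      by_contra! hle
      have h1 := hεd z (by simpa [dist_eq_norm] using hle)
      have h2 : ε * (b z - b₀) ≤ ε * 1 := by
        have := hb1 z
        have : 0 < b₀ := Real.exp_pos _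
        gcongr; linarith
      simp only [G] at hneg; linarith
    have hz3 : ‖z - c‖ < R := by
      refine lt_of_le_of_ne hz1 fun heq => ?_
      have : b z = b₀ := by rw [hb, gaussianBarrier, heq]
      simp only [G, this] at hneg
      linarith [hd0 z hz]
    -- at an interior minimum of `G` in the annulus, the first and second order conditions turn the
    -- inequality satisfied by `d` into one that the barrier violates
    have hmin : IsLocalMin G z :=
      hzmin.isLocalMin (mem_of_superset (isOpen_ball.mem_nhds (by simpa [dist_eq_norm] using hz3))
        ball_subset_closedBall)
    have hdz := h.contDiffAt z (hU hz)
    let B : E → ℝ := fun z => ε * (b z - b₀)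
    have hbz : ContDiffAt ℝ 2 b z := (contDiff_gaussianBarrier α c).contDiffAt
    have hBz : ContDiffAt ℝ 2 B z := contDiffAt_const.mul (hbz.sub contDiffAt_const)
    have hgB' : ∀ x, gradient B x = ε • gradient b x := fun x => by
      have h1 := ((contDiff_gaussianBarrier α c (k := 1)).contDiffAt.differentiableAt
        (by norm_num) : DifferentiableAt ℝ b x).hasGradientAt.hasFDerivAt
      have h2 : HasGradientAt B (ε • gradient b x) x := by
        rw [hasGradientAt_iff_hasFDerivAt, map_smul]
        exact (h1.sub_const b₀).const_mul ε
      exact h2.gradient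
    have hHB : hessian B z = ε • hessian b z := by
      rw [hessian, show gradient B = fun x => ε • gradient b x from funext hgB']
      exact (hbz.hasFDerivAt_gradient_hessian.const_smul ε).fderiv
    have hgrad : gradient d z = ε • gradient b z := by
      have h1 : gradient G z = 0 := by
        have := hmin.fderiv_eq_zero
        simp [gradient, this]
      have h2 := gradient_sub (hdz.differentiableAt (by norm_num))
        (hBz.differentiableAt (by norm_num))
      rw [h1, hgB'] at h2
      exact (sub_eq_zero.1 h2.symm)
    have hhess : ∀ w, 0 ≤ ⟪w, (hessian d z - ε • hessian b z) w⟫_ℝ := by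
      intro w
      have := hmin.inner_hessian_nonneg (hdz.sub hBz) w
      rwa [hessian_sub hdz hBz, hHB] at this
    have hp0 : p z ≠ 0 := by
      intro h0
      have := h.norm_sub_le z (hU hz)
      rw [h0, zero_sub, norm_neg, h.norm_eq_one] at this
      norm_num at this
    have k1 := tangentialTrace_nonneg hhess hp0
    have k2 := hhess N₀
    rw [tangentialTrace_sub, tangentialTrace_smul] at k1
    rw [sub_apply, inner_sub_right, smul_apply, inner_smul_right] at k2
    have k3 := h.le z (hU hz)
    have k4 := tangentialTrace_gaussianBarrier_ge h.norm_eq_one (h.norm_sub_le z (hU hz))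
      (α := α) c z
    rw [hgrad, norm_smul, hb, gradient_gaussianBarrier, norm_smul, Real.norm_of_nonneg hε.le,
      norm_mul, norm_mul, Real.norm_of_nonneg hα0.le,
      Real.norm_of_nonneg (show 0 ≤ gaussianBarrier α c z from (Real.exp_pos _).le)] at k3
    rw [← hb] at k3 k4
    have hbp : 0 < b z := Real.exp_pos _
    rw [← hm] at k4
    norm_num at k3
    set r := ‖z - c‖
    have k5 : ε * (b z * (2 * α ^ 2 * r ^ 2 - 2 * α * m)) ≤ C' * (ε * (2 * α * b z * r)) := by
      calc _ ≤ ε * _ := mul_le_mul_of_nonneg_left k4 hε.le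
        _ ≤ C * (ε * (2 * α * b z * r)) := by linarith
        _ ≤ _ := by gcongr
    have k6 : α * r ^ 2 - m ≤ C' * r := by
      have : 0 < ε * b z * (2 * α) := by positivity
      refine le_of_mul_le_mul_left ?_ this
      linarith
    have k7 : α * (R / 2) ^ 2 < α * r ^ 2 := by gcongr
    have k8 : C' * r ≤ C' * R := by gcongr
    linarith
  -- compare derivatives at the boundary point
  have hx₀mem : x₀ ∈ closedBall c R := by simp [dist_eq_norm, hx₀]
  have hbx : b x₀ = b₀ := by rw [hb, gaussianBarrier, hx₀]
  have hGx : G x₀ = 0 := by simp [G, hd, hbx]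
  have hdiffd : HasFDerivAt d (fderiv ℝ d x₀) x₀ :=
    ((h.contDiffAt x₀ (hU hx₀mem)).differentiableAt (by norm_num)).hasFDerivAt
  have hdiffb := ((contDiff_gaussianBarrier α c (k := 1)).contDiffAt.differentiableAt
        (by norm_num) : DifferentiableAt ℝ b x₀).hasGradientAt.hasFDerivAt
  have hdiffG := hdiffd.sub ((hdiffb.sub_const b₀).const_mul ε)
  have hmin : IsLocalMinOn G (closedBall c R) x₀ := by
    refine IsMinOn.localize fun z hz => ?_
    simpa [hGx] using hG0 z hz
  have hcone : c - x₀ ∈ posTangentConeAt (closedBall c R) x₀ := by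
    refine mem_posTangentConeAt_of_segment_subset ?_
    exact (convex_closedBall c R).segment_subset hx₀mem (by simp [hR.le])
  have h1 := hmin.hasFDerivWithinAt_nonneg hdiffG.hasFDerivWithinAt hcone
  have h2 : ⟪gradient b x₀, c - x₀⟫_ℝ = 2 * α * b₀ * R ^ 2 := by
    rw [hb, gradient_gaussianBarrier, ← hb, hbx, inner_smul_left, ← neg_sub x₀ c, inner_neg_right,
      real_inner_self_eq_norm_sq, hx₀]
    simp
  simp only [sub_apply, smul_apply, InnerProductSpace.toDual_apply_apply, smul_eq_mul] at h1
  rw [← hb, h2] at h1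
  have : 0 < ε * (2 * α * b₀ * R ^ 2) := by
    have : 0 < b₀ := Real.exp_pos _
    positivity
  linarith

/-- The strong maximum principle: a nonnegative supersolution on a convex open set that vanishes
somewhere vanishes identically. -/
theorem IsEllipticSupersolution.eq_zero {N₀ : E} {p : E → E} {C : ℝ} {d : E → ℝ} {U : Set E}
    (h : IsEllipticSupersolution N₀ p C d U) (hUo : IsOpen U) (hUc : Convex ℝ U)
    (hd : ∀ z ∈ U, 0 ≤ d z) {x₀ : E} (hx₀ : x₀ ∈ U) (hdx₀ : d x₀ = 0) :
    ∀ z ∈ U, d z = 0 := by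
  -- the zero set is relatively closed; it is shown to be open by the Hopf lemma
  have hcont : ContinuousOn d U := fun z hz => (h.contDiffAt z hz).continuousAt.continuousWithinAt
  by_contra! hex
  obtain ⟨z₁, hz₁, hdz₁⟩ := hex
  have hpre : IsPreconnected U := hUc.isPreconnected
  have hVo : IsOpen (U ∩ d ⁻¹' {0}ᶜ) := hcont.isOpen_inter_preimage hUo isOpen_compl_singleton
  -- a zero that is a limit of points where `d` is positive
  obtain ⟨y, ⟨hyU, hyc⟩, hyd⟩ : ∃ y ∈ U ∩ closure (U ∩ d ⁻¹' {0}ᶜ), d y = 0 := by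
    by_contra! hcon
    have hZo : IsOpen (U ∩ (closure (U ∩ d ⁻¹' {0}ᶜ))ᶜ) := hUo.inter isClosed_closure.isOpen_compl
    obtain ⟨w, -, hw1, hw2⟩ := hpre _ _ hVo hZo (fun w hw => by
      by_cases hwc : w ∈ closure (U ∩ d ⁻¹' {0}ᶜ)
      · exact Or.inl ⟨hw, hcon w ⟨hw, hwc⟩⟩
      · exact Or.inr ⟨hw, hwc⟩) ⟨z₁, hz₁, hz₁, hdz₁⟩
      ⟨x₀, hx₀, hx₀, fun hc => hcon x₀ ⟨hx₀, hc⟩ hdx₀⟩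
    exact hw2.2 (subset_closure hw1)
  obtain ⟨r, hr, hrU⟩ := Metric.isOpen_iff.1 hUo y hyU
  obtain ⟨c, ⟨hcU, hcd⟩, hcy⟩ := Metric.mem_closure_iff.1 hyc (r / 2) (by linarith)
  -- the largest ball around `c` on which `d` is positive
  have hcomp : IsCompact (closedBall c (r / 2) ∩ d ⁻¹' {0}) := by
    have hsub : closedBall c (r / 2) ⊆ U := fun w hw => hrU (by
      rw [mem_ball]; rw [mem_closedBall] at hw
      have := dist_triangle w c y
      rw [dist_comm c y] at this; linarith)
    exact (isCompact_closedBall c _).of_isClosed_subset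
      ((hcont.mono hsub).preimage_isClosed_of_isClosed isClosed_closedBall isClosed_singleton)
      inter_subset_left
  obtain ⟨x, ⟨hx, hxd⟩, hxmin⟩ := hcomp.exists_isMinOn
    ⟨y, mem_closedBall.2 hcy.le, hyd⟩ (f := fun w => dist w c) (by fun_prop)
  rw [mem_preimage, mem_singleton_iff] at hxd
  have hRpos : 0 < dist x c := dist_pos.2 fun hxc => hcd (by rw [← hxc]; exact hxd)
  have hRle : dist x c ≤ r / 2 := mem_closedBall.1 hx
  have hsub : closedBall c (dist x c) ⊆ U := fun w hw => hrU (by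
      rw [mem_ball]; rw [mem_closedBall] at hw
      have := dist_triangle w c y
      rw [dist_comm c y] at this; linarith)
  have hhopf := h.hopf hRpos hsub (fun w hw => by
    refine lt_of_le_of_ne (hd w (hsub (ball_subset_closedBall hw))) fun hw0 => ?_
    rw [mem_ball] at hw
    have : dist x c ≤ dist w c := hxmin ⟨mem_closedBall.2 (by linarith), hw0.symm⟩
    linarith) (dist_eq_norm x c).symm hxd
  have hxU : x ∈ U := hsub (by simp)
  -- at the interior zero `x` the derivative of `d ≥ 0` vanishes, which contradicts the Hopf lemma
  have hmin : IsLocalMin d x := by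
    filter_upwards [hUo.mem_nhds hxU] with w hw
    rw [hxd]; exact hd w hw
  rw [hmin.fderiv_eq_zero] at hhopf
  simp at hhopf

end MaximumPrinciple

/-! ### Local graphs of prescribed mean curvature -/

section LocalGraphs

variable {E : Type*} [NormedAddCommGroup E] [InnerProductSpace ℝ E] [FiniteDimensional ℝ E]
  [CompleteSpace E]

/-- `s` is a `C^k` function near `x₀` of the form `⟪N₀, z⟫ - φ z`, where `φ` is invariant under
translations in the direction `N₀` and has a critical point at `x₀`. Its zero set is thus a graph
over the hyperplane `N₀^⊥`, tangent to it at `x₀`. -/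
structure IsGraph (k : WithTop ℕ∞) (N₀ x₀ : E) (r : ℝ) (s : E → ℝ) : Prop where
  norm_eq_one : ‖N₀‖ = 1
  pos : 0 < r
  contDiffOn : ContDiffOn ℝ k s (ball x₀ r)
  zero : s x₀ = 0
  translate : ∀ z ∈ ball x₀ r, ∀ τ : ℝ, z + τ • N₀ ∈ ball x₀ r → s (z + τ • N₀) = s z + τ
  gradient_eq : gradient s x₀ = N₀

/-- A function as in `IsGraph` whose level sets have the mean curvature prescribed by `h`, a
function of the gradient. -/
structure IsGraphFunction (k : WithTop ℕ∞) (h : E → ℝ) (N₀ x₀ : E) (r : ℝ) (s : E → ℝ) : Prop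
    extends IsGraph k N₀ x₀ r s where
  pde : ∀ z ∈ ball x₀ r, tangentialTrace (gradient s z) (hessian s z) = h (gradient s z)

variable {k : WithTop ℕ∞} {h : E → ℝ} {N₀ x₀ : E} {r : ℝ} {s s₁ s₂ : E → ℝ}

lemma gradient_hessian_add_eq {s : E → ℝ} {z w : E} {τ : ℝ}
    (h : ∀ᶠ y in 𝓝 z, s (y + w) = s y + τ) :
    gradient s (z + w) = gradient s z ∧ hessian s (z + w) = hessian s z := by
  have key : ∀ y, (∀ᶠ y' in 𝓝 y, s (y' + w) = s y' + τ) → gradient s (y + w) = gradient s y := by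
    intro y hy
    have h0 : (fun y => s (y + w)) =ᶠ[𝓝 y] fun y => s y + τ := hy
    have h1 := h0.fderiv_eq (𝕜 := ℝ)
    rw [fderiv_comp_add_right, fderiv_add_const] at h1
    simp [gradient, h1]
  refine ⟨key z h, ?_⟩
  have h2 : (fun y => gradient s (y + w)) =ᶠ[𝓝 z] gradient s := by
    filter_upwards [eventually_eventually_nhds.2 h] with y hy using key y hy
  have h3 := h2.fderiv_eq (𝕜 := ℝ)
  rwa [fderiv_comp_add_right] at h3

namespace IsGraph

lemma contDiffAt (hs : IsGraph k N₀ x₀ r s) {z : E} (hz : z ∈ ball x₀ r) :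
    ContDiffAt ℝ k s z :=
  hs.contDiffOn.contDiffAt (isOpen_ball.mem_nhds hz)

lemma mono (hs : IsGraph k N₀ x₀ r s) {r' : ℝ} (hr' : 0 < r') (hle : r' ≤ r) :
    IsGraph k N₀ x₀ r' s :=
  have hsub : ball x₀ r' ⊆ ball x₀ r := ball_subset_ball hle
  ⟨hs.1, hr', hs.3.mono hsub, hs.4, fun z hz τ hτ => hs.5 z (hsub hz) τ (hsub hτ), hs.6⟩

lemma mem_self (hs : IsGraph k N₀ x₀ r s) : x₀ ∈ ball x₀ r := mem_ball_self hs.pos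

lemma eventually_translate (hs : IsGraph k N₀ x₀ r s) {z : E} (hz : z ∈ ball x₀ r)
    {τ : ℝ} (hτ : z + τ • N₀ ∈ ball x₀ r) :
    ∀ᶠ y in 𝓝 z, s (y + τ • N₀) = s y + τ := by
  have h1 : ∀ᶠ y in 𝓝 z, y + τ • N₀ ∈ ball x₀ r :=
    (continuous_add_const (τ • N₀)).continuousAt.eventually (isOpen_ball.mem_nhds hτ)
  filter_upwards [h1, isOpen_ball.mem_nhds hz] with y hy hy'
  exact hs.translate y hy' τ hy

lemma gradient_hessian_translate (hs : IsGraph k N₀ x₀ r s) {z : E} (hz : z ∈ ball x₀ r)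
    {τ : ℝ} (hτ : z + τ • N₀ ∈ ball x₀ r) :
    gradient s (z + τ • N₀) = gradient s z ∧ hessian s (z + τ • N₀) = hessian s z :=
  gradient_hessian_add_eq (hs.eventually_translate hz hτ)

lemma inner_gradient (hs : IsGraph k N₀ x₀ r s) (hk : 1 ≤ k) {z : E}
    (hz : z ∈ ball x₀ r) : ⟪gradient s z, N₀⟫_ℝ = 1 := by
  have hd := ((hs.contDiffAt hz).differentiableAt
    (zero_lt_one.trans_le hk).ne').hasGradientAt.hasFDerivAt
  have hl : HasDerivAt (fun τ : ℝ => z + τ • N₀) N₀ 0 := by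
    simpa using ((hasDerivAt_id (0 : ℝ)).smul_const N₀).const_add z
  have h1 : HasDerivAt (fun τ : ℝ => s (z + τ • N₀)) ⟪gradient s z, N₀⟫_ℝ 0 := by
    have h2 : HasFDerivAt s (InnerProductSpace.toDual ℝ E (gradient s z)) (z + (0 : ℝ) • N₀) := by
      simpa using hd
    exact h2.comp_hasDerivAt (0 : ℝ) hl
  have h2 : (fun τ : ℝ => s (z + τ • N₀)) =ᶠ[𝓝 0] fun τ => s z + τ := by
    have h3 : ∀ᶠ τ : ℝ in 𝓝 0, z + τ • N₀ ∈ ball x₀ r :=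
      hl.continuousAt.eventually (isOpen_ball.mem_nhds (by simpa using hz))
    filter_upwards [h3] with τ hτ using hs.translate z hz τ hτ
  exact h1.unique (((hasDerivAt_id (0 : ℝ)).const_add (s z)).congr_of_eventuallyEq h2)

lemma hessian_apply (hs : IsGraph k N₀ x₀ r s) (hk : 2 ≤ k) {z : E}
    (hz : z ∈ ball x₀ r) : hessian s z N₀ = 0 := by
  have hd := ((hs.contDiffAt hz).of_le hk).hasFDerivAt_gradient_hessian
  have hl : HasDerivAt (fun τ : ℝ => z + τ • N₀) N₀ 0 := by
    simpa using ((hasDerivAt_id (0 : ℝ)).smul_const N₀).const_add z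
  have h1 : HasDerivAt (fun τ : ℝ => gradient s (z + τ • N₀)) (hessian s z N₀) 0 := by
    have h2 : HasFDerivAt (gradient s) (hessian s z) (z + (0 : ℝ) • N₀) := by
      simpa using hd
    exact h2.comp_hasDerivAt (0 : ℝ) hl
  have h2 : (fun τ : ℝ => gradient s (z + τ • N₀)) =ᶠ[𝓝 0] fun τ => gradient s z := by
    have h3 : ∀ᶠ τ : ℝ in 𝓝 0, z + τ • N₀ ∈ ball x₀ r :=
      hl.continuousAt.eventually (isOpen_ball.mem_nhds (by simpa using hz))
    filter_upwards [h3] with τ hτ using (hs.gradient_hessian_translate hz hτ).1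
  exact h1.unique ((hasDerivAt_const (0 : ℝ) _).congr_of_eventuallyEq h2)

lemma gradient_ne_zero (hs : IsGraph k N₀ x₀ r s) (hk : 1 ≤ k) {z : E}
    (hz : z ∈ ball x₀ r) : gradient s z ≠ 0 := by
  intro h0
  have := hs.inner_gradient hk hz
  simp [h0] at this

end IsGraph

/-- The trace over the complement of `p` depends smoothly on `p ≠ 0` and on the operator. -/
lemma contDiffAt_tangentialTrace {m : WithTop ℕ∞} {q : E × (E →L[ℝ] E)} (hq : q.1 ≠ 0) :
    ContDiffAt ℝ m (fun q : E × (E →L[ℝ] E) => tangentialTrace q.1 q.2) q := by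
  let T : (E →L[ℝ] E) →L[ℝ] ℝ :=
    ((LinearMap.trace ℝ E).comp (ContinuousLinearMap.coeLM ℝ)).toContinuousLinearMap
  have h1 : ContDiffAt ℝ m (fun q : E × (E →L[ℝ] E) => T q.2) q :=
    (T.contDiff.comp contDiff_snd).contDiffAt
  have h2 : ContDiffAt ℝ m (fun q : E × (E →L[ℝ] E) => ⟪q.1, q.2 q.1⟫_ℝ) q :=
    (contDiff_fst.inner ℝ (contDiff_snd.clm_apply contDiff_fst)).contDiffAt
  have h3 : ContDiffAt ℝ m (fun q : E × (E →L[ℝ] E) => ‖q.1‖ ^ 2) q :=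
    (contDiff_fst.norm_sq ℝ).contDiffAt
  exact h1.sub (h2.div h3 (by simpa using hq))

lemma IsGraphFunction.mono (hs : IsGraphFunction k h N₀ x₀ r s) {r' : ℝ} (hr' : 0 < r')
    (hle : r' ≤ r) : IsGraphFunction k h N₀ x₀ r' s :=
  ⟨hs.toIsGraph.mono hr' hle, fun z hz => hs.pde z (ball_subset_ball hle hz)⟩

/-- The difference of two graph functions with the same axis and the same prescribed mean curvature
is a supersolution of an elliptic inequality: the zero-order terms cancel because the
equation only involves the gradient and the Hessian. -/
lemma IsGraphFunction.exists_isEllipticSupersolution_sub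
    {r₁ r₂ : ℝ} (h₁ : IsGraphFunction k h N₀ x₀ r₁ s₁)
    (h₂ : IsGraphFunction k h N₀ x₀ r₂ s₂) (hk : 2 ≤ k) (hh : ContDiffAt ℝ 1 h N₀) :
    ∃ ρ > 0, ∃ C, IsEllipticSupersolution N₀ (gradient s₂) C (fun z => s₁ z - s₂ z)
      (ball x₀ ρ) := by
  have hN0 : N₀ ≠ 0 := fun h0 => by simpa [h0] using h₁.norm_eq_one
  have c₁ := (h₁.contDiffAt h₁.mem_self).of_le hk
  have c₂ := (h₂.contDiffAt h₂.mem_self).of_le hk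
  have g₁ : Tendsto (gradient s₁) (𝓝 x₀) (𝓝 N₀) := by
    have := (contDiffAt_gradient c₁ (m := 1) (by norm_num)).continuousAt.tendsto
    rwa [h₁.gradient_eq] at this
  have g₂ : Tendsto (gradient s₂) (𝓝 x₀) (𝓝 N₀) := by
    have := (contDiffAt_gradient c₂ (m := 1) (by norm_num)).continuousAt.tendsto
    rwa [h₂.gradient_eq] at this
  have H₁ : Tendsto (hessian s₁) (𝓝 x₀) (𝓝 (hessian s₁ x₀)) :=
    ((contDiffAt_gradient c₁ (m := 1) (by norm_num)).fderiv_right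
      (m := 0) (by norm_num)).continuousAt.tendsto
  let F : E × (E →L[ℝ] E) → ℝ := fun q => tangentialTrace q.1 q.2 - h q.1
  have hF : ContDiffAt ℝ 1 F (N₀, hessian s₁ x₀) :=
    (contDiffAt_tangentialTrace hN0).sub (ContDiffAt.comp (N₀, hessian s₁ x₀) hh contDiffAt_fst)
  obtain ⟨L, V, hV, hL⟩ := hF.exists_lipschitzOnWith
  have e₁ : ∀ᶠ z in 𝓝 x₀, (gradient s₁ z, hessian s₁ z) ∈ V := (g₁.prodMk_nhds H₁).eventually hV
  have e₂ : ∀ᶠ z in 𝓝 x₀, (gradient s₂ z, hessian s₁ z) ∈ V := (g₂.prodMk_nhds H₁).eventually hV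
  have e₃ : ∀ᶠ z in 𝓝 x₀, gradient s₂ z ∈ closedBall N₀ (1 / 20) :=
    g₂.eventually (closedBall_mem_nhds _ (by norm_num))
  have e₄ : ∀ᶠ z in 𝓝 x₀, z ∈ ball x₀ r₁ := ball_mem_nhds x₀ h₁.pos
  have e₅ : ∀ᶠ z in 𝓝 x₀, z ∈ ball x₀ r₂ := ball_mem_nhds x₀ h₂.pos
  obtain ⟨ρ, hρ, hball⟩ := Metric.eventually_nhds_iff_ball.1
    (e₁.and (e₂.and (e₃.and (e₄.and e₅))))
  refine ⟨ρ, hρ, L, h₁.norm_eq_one, fun z hz => ?_, fun z hz => ?_, fun z hz => ?_⟩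
  · obtain ⟨-, -, -, hz₁, hz₂⟩ := hball z hz
    exact ((h₁.contDiffAt hz₁).of_le hk).sub ((h₂.contDiffAt hz₂).of_le hk)
  · simpa [dist_eq_norm] using (hball z hz).2.2.1
  · obtain ⟨hv₁, hv₂, -, hz₁, hz₂⟩ := hball z hz
    have d₁ := (h₁.contDiffAt hz₁).of_le hk
    have d₂ := (h₂.contDiffAt hz₂).of_le hk
    rw [hessian_sub d₁ d₂, gradient_sub (d₁.differentiableAt (by norm_num))
      (d₂.differentiableAt (by norm_num)), tangentialTrace_sub, h₂.pde z hz₂, sub_apply,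
      h₁.hessian_apply hk hz₁, h₂.hessian_apply hk hz₂]
    have h3 := hL.dist_le_mul _ hv₂ _ hv₁
    have h4 : F (gradient s₁ z, hessian s₁ z) = 0 := by simp [F, h₁.pde z hz₁]
    rw [h4, dist_zero_right, Prod.dist_eq, dist_self, max_eq_left dist_nonneg, dist_comm,
      dist_eq_norm] at h3
    have h5 : tangentialTrace (gradient s₂ z) (hessian s₁ z) - h (gradient s₂ z) ≤
        L * ‖gradient s₁ z - gradient s₂ z‖ := (le_abs_self _).trans h3
    simpa using h5

lemma IsGraphFunction.gradient_sub_eq_zero {r₁ r₂ : ℝ} (h₁ : IsGraphFunction k h N₀ x₀ r₁ s₁)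
    (h₂ : IsGraphFunction k h N₀ x₀ r₂ s₂) (hk : 2 ≤ k) :
    gradient (fun z => s₁ z - s₂ z) x₀ = 0 := by
  have c₁ := (h₁.contDiffAt h₁.mem_self).of_le hk
  have c₂ := (h₂.contDiffAt h₂.mem_self).of_le hk
  rw [gradient_sub (c₁.differentiableAt (by norm_num)) (c₂.differentiableAt (by norm_num)),
    h₁.gradient_eq, h₂.gradient_eq, sub_self]

/-! ### Invariance under isometries -/

section Isometry

variable (A : E ≃ₗᵢ[ℝ] E) (b : E)

lemma gradient_comp_isometry {f : E → ℝ} {z : E} (hf : DifferentiableAt ℝ f (A z + b)) :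
    gradient (fun y => f (A y + b)) z = A.symm (gradient f (A z + b)) := by
  have h1 : HasFDerivAt (fun y => A y + b) (A.toContinuousLinearEquiv : E →L[ℝ] E) z :=
    A.toContinuousLinearEquiv.hasFDerivAt.add_const b
  have h2 : HasGradientAt (fun y => f (A y + b)) (A.symm (gradient f (A z + b))) z := by
    rw [hasGradientAt_iff_hasFDerivAt]
    refine (hf.hasGradientAt.hasFDerivAt.comp z h1).congr_fderiv ?_
    ext w
    simp only [ContinuousLinearMap.comp_apply, InnerProductSpace.toDual_apply_apply]
    rw [← A.inner_map_map (A.symm _), A.apply_symm_apply]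
    rfl
  exact h2.gradient

lemma hessian_comp_isometry_apply {f : E → ℝ} {z : E} (hf : ContDiffAt ℝ 2 f (A z + b)) (w : E) :
    hessian (fun y => f (A y + b)) z w = A.symm (hessian f (A z + b) (A w)) := by
  have h1 : HasFDerivAt (fun y => A y + b) (A.toContinuousLinearEquiv : E →L[ℝ] E) z :=
    A.toContinuousLinearEquiv.hasFDerivAt.add_const b
  have h2 : gradient (fun y => f (A y + b)) =ᶠ[𝓝 z] fun y => A.symm (gradient f (A y + b)) := by
    have h3 := h1.continuousAt.eventually (hf.eventually (by simp))
    filter_upwards [h3] with y hy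
    exact gradient_comp_isometry A b (hy.differentiableAt (by norm_num))
  have h4 := (A.symm.toContinuousLinearEquiv.hasFDerivAt.comp z
    (hf.hasFDerivAt_gradient_hessian.comp z h1)).congr_of_eventuallyEq h2
  rw [hessian, h4.fderiv]
  rfl

lemma tangentialTrace_conj (p : E) {X Y : E →L[ℝ] E} (hXY : ∀ w, Y w = A.symm (X (A w))) :
    tangentialTrace (A.symm p) Y = tangentialTrace p X := by
  have h1 : Y.toLinearMap = A.symm.toLinearEquiv.toLinearMap ∘ₗ X.toLinearMap ∘ₗ
      A.toLinearEquiv.toLinearMap := by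
    ext w; simp [hXY]
  have h2 : LinearMap.trace ℝ E Y.toLinearMap = LinearMap.trace ℝ E X.toLinearMap := by
    rw [h1, LinearMap.trace_comp_comm', LinearMap.comp_assoc]
    congr 1
    ext w; simp
  rw [tangentialTrace, tangentialTrace, h2, hXY, A.apply_symm_apply, A.symm.inner_map_map,
    A.symm.norm_map]

lemma IsGraphFunction.comp_isometry (hs : IsGraphFunction k h N₀ x₀ r s) (hk : 2 ≤ k)
    (hinv : ∀ p, h (A.symm p) = h p) {y₀ : E} (hy₀ : A y₀ + b = x₀) :
    IsGraphFunction k h (A.symm N₀) y₀ r (fun z => s (A z + b)) := by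
  have hmaps : ∀ z, z ∈ ball y₀ r ↔ A z + b ∈ ball x₀ r := fun z => by
    rw [mem_ball, mem_ball, ← hy₀, dist_add_right, A.dist_map]
  have hc : ∀ z ∈ ball y₀ r, ContDiffAt ℝ 2 s (A z + b) := fun z hz =>
    (hs.contDiffAt ((hmaps z).1 hz)).of_le hk
  have hg : ∀ z ∈ ball y₀ r, gradient (fun y => s (A y + b)) z = A.symm (gradient s (A z + b)) :=
    fun z hz => gradient_comp_isometry A b ((hc z hz).differentiableAt (by norm_num))
  refine ⟨⟨by rw [A.symm.norm_map, hs.norm_eq_one], hs.pos, ?_, by rw [hy₀, hs.zero], ?_, ?_⟩, ?_⟩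
  · exact hs.contDiffOn.comp (A.contDiff.add contDiff_const).contDiffOn fun z hz => (hmaps z).1 hz
  · intro z hz τ hτ
    have h1 : A (z + τ • A.symm N₀) + b = (A z + b) + τ • N₀ := by
      simp only [map_add, map_smul, A.apply_symm_apply]; abel
    rw [hmaps, h1] at hτ
    rw [h1, hs.translate _ ((hmaps z).1 hz) τ hτ]
  · rw [hg _ (mem_ball_self hs.pos), hy₀, hs.gradient_eq]
  · intro z hz
    rw [hg z hz, hinv, tangentialTrace_conj A _ (hessian_comp_isometry_apply A b (hc z hz)),
      hs.pde _ ((hmaps z).1 hz)]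

end Isometry

end LocalGraphs

/-! ### Touching domains of prescribed mean curvature -/

section Domains

variable {E : Type*} [NormedAddCommGroup E] [InnerProductSpace ℝ E] [FiniteDimensional ℝ E]
  [CompleteSpace E]

/-- Near `x₀`, the set `K` is the sublevel set `{s ≤ 0}` of a graph function `s` whose axis is the
outer unit normal `N x₀`. -/
structure IsLocalDefining (k : WithTop ℕ∞) (h : E → ℝ) (K : Set E) (N : E → E) (x₀ : E) (r : ℝ)
    (s : E → ℝ) : Prop extends IsGraphFunction k h (N x₀) x₀ r s where
  mem_iff : ∀ z ∈ ball x₀ r, z ∈ K ↔ s z ≤ 0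

/-- `K` is a compact domain whose boundary is a hypersurface of class `C^k` with outer
unit normal `N` and with mean curvature prescribed by `h`. -/
structure IsPrescribedDomain (k : WithTop ℕ∞) (h : E → ℝ) (K : Set E) (N : E → E) : Prop where
  isCompact : IsCompact K
  nonempty : K.Nonempty
  exists_isLocalDefining : ∀ x ∈ frontier K, ∃ r s, IsLocalDefining k h K N x r s

variable {k : WithTop ℕ∞} {h : E → ℝ} {K K₁ K₂ : Set E} {N N₁ N₂ : E → E} {x₀ : E} {r r₁ r₂ : ℝ}
  {s s₁ s₂ : E → ℝ}

namespace IsLocalDefining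

lemma mem_interior (hs : IsLocalDefining k h K N x₀ r s) {z : E} (hz : z ∈ ball x₀ r)
    (hsz : s z < 0) : z ∈ interior K := by
  have h1 := (hs.contDiffAt hz).continuousAt.eventually (Iio_mem_nhds hsz)
  rw [mem_interior_iff_mem_nhds]
  filter_upwards [h1, isOpen_ball.mem_nhds hz] with y hy hy'
  exact (hs.mem_iff y hy').2 (le_of_lt hy)

lemma mem_interior_iff (hs : IsLocalDefining k h K N x₀ r s) {z : E} (hz : z ∈ ball x₀ r) :
    z ∈ interior K ↔ s z < 0 := by
  refine ⟨fun hi => ?_, hs.mem_interior hz⟩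
  have hl : ContinuousAt (fun τ : ℝ => z + τ • N x₀) 0 := by fun_prop
  have h1 : ∀ᶠ τ : ℝ in 𝓝 0, z + τ • N x₀ ∈ interior K ∩ ball x₀ r :=
    hl.eventually ((isOpen_interior.inter isOpen_ball).mem_nhds (by simpa using ⟨hi, hz⟩))
  obtain ⟨τ, ⟨hτ1, hτ2⟩, hτ0⟩ := ((h1.filter_mono nhdsWithin_le_nhds).and
    (self_mem_nhdsWithin : Ioi (0 : ℝ) ∈ 𝓝[>] 0)).exists
  have h2 := (hs.mem_iff _ hτ2).1 (interior_subset hτ1)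
  rw [hs.translate z hz τ hτ2] at h2
  have : 0 < τ := hτ0
  linarith

lemma mem_frontier_iff (hs : IsLocalDefining k h K N x₀ r s) (hK : IsClosed K) {z : E}
    (hz : z ∈ ball x₀ r) : z ∈ frontier K ↔ s z = 0 := by
  rw [hK.frontier_eq, Set.mem_sdiff, hs.mem_interior_iff hz, hs.mem_iff z hz]
  exact ⟨fun h => le_antisymm h.1 (not_lt.1 h.2), fun h => ⟨h.le, h.not_lt⟩⟩

lemma hasDerivAt_line (hs : IsLocalDefining k h K N x₀ r s) (hk : 1 ≤ k) (w : E) :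
    HasDerivAt (fun ε : ℝ => s (x₀ + ε • w)) ⟪N x₀, w⟫_ℝ 0 := by
  have hd := ((hs.contDiffAt hs.mem_self).differentiableAt
    (zero_lt_one.trans_le hk).ne').hasGradientAt.hasFDerivAt
  rw [hs.gradient_eq] at hd
  have hl : HasDerivAt (fun τ : ℝ => x₀ + τ • w) w 0 := by
    simpa using ((hasDerivAt_id (0 : ℝ)).smul_const w).const_add x₀
  have h2 : HasFDerivAt s (InnerProductSpace.toDual ℝ E (N x₀)) (x₀ + (0 : ℝ) • w) := by
    simpa using hd
  exact h2.comp_hasDerivAt (0 : ℝ) hl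

lemma eventually_line_mem_ball (hr : 0 < r) (w : E) :
    ∀ᶠ ε : ℝ in 𝓝 0, x₀ + ε • w ∈ ball x₀ r := by
  have hl : ContinuousAt (fun τ : ℝ => x₀ + τ • w) 0 := by fun_prop
  exact hl.eventually (isOpen_ball.mem_nhds (by simpa using hr))

lemma eventually_notMem (hs : IsLocalDefining k h K N x₀ r s) (hk : 1 ≤ k) {w : E}
    (hw : 0 < ⟪N x₀, w⟫_ℝ) : ∀ᶠ ε : ℝ in 𝓝[>] 0, x₀ + ε • w ∉ K := by
  have h1 := (hs.hasDerivAt_line hk w)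
  have h2 := eventually_nhdsWithin_sign_eq_of_deriv_pos (h1.deriv.symm ▸ hw) (by simp [hs.zero])
  filter_upwards [h2.filter_mono (nhdsWithin_le_nhds (s := Ioi 0)),
    (eventually_line_mem_ball hs.pos w).filter_mono nhdsWithin_le_nhds, self_mem_nhdsWithin]
    with ε h3 h4 h5
  rw [hs.mem_iff _ h4, not_le, ← sign_eq_one_iff, h3]
  simpa [sign_eq_one_iff] using h5

lemma eventually_mem_interior (hs : IsLocalDefining k h K N x₀ r s) (hk : 1 ≤ k) {w : E}
    (hw : ⟪N x₀, w⟫_ℝ < 0) : ∀ᶠ ε : ℝ in 𝓝[>] 0, x₀ + ε • w ∈ interior K := by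
  have h1 := (hs.hasDerivAt_line hk w)
  have h2 := eventually_nhdsWithin_sign_eq_of_deriv_neg (h1.deriv.symm ▸ hw) (by simp [hs.zero])
  filter_upwards [h2.filter_mono (nhdsWithin_le_nhds (s := Ioi 0)),
    (eventually_line_mem_ball hs.pos w).filter_mono nhdsWithin_le_nhds, self_mem_nhdsWithin]
    with ε h3 h4 h5
  rw [hs.mem_interior_iff h4, ← sign_eq_neg_one_iff, h3]
  have : (0 : ℝ) < ε := h5
  simpa [sign_eq_neg_one_iff] using this

/-- In a direction transverse to the boundary, `s` is strictly increasing near `x₀`. -/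
lemma exists_strictMono (hs : IsLocalDefining k h K N x₀ r s) (hk : 1 ≤ k) {v : E}
    (hv : 0 < ⟪N x₀, v⟫_ℝ) :
    ∃ ρ > 0, ρ ≤ r ∧ ∀ z ∈ ball x₀ ρ, ∀ σ > (0 : ℝ), z + σ • v ∈ ball x₀ ρ →
      s z < s (z + σ • v) := by
  have hc : Tendsto (fun z => ⟪gradient s z, v⟫_ℝ) (𝓝 x₀) (𝓝 ⟪N x₀, v⟫_ℝ) := by
    have := (contDiffAt_gradient ((hs.contDiffAt hs.mem_self).of_le hk)
      (m := 0) (by norm_num)).continuousAt.tendsto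
    rw [hs.gradient_eq] at this
    exact this.inner tendsto_const_nhds
  obtain ⟨ρ, hρ, hball⟩ := Metric.eventually_nhds_iff_ball.1 (hc.eventually (Ioi_mem_nhds hv))
  refine ⟨min ρ r, lt_min hρ hs.pos, min_le_right _ _, fun z hz σ hσ hzσ => ?_⟩
  have hseg : ∀ τ ∈ Icc (0 : ℝ) σ, z + τ • v ∈ ball x₀ (min ρ r) := by
    intro τ hτ
    have h1 : z + τ • v ∈ segment ℝ z (z + σ • v) := by
      rw [segment_eq_image']
      refine ⟨τ / σ, ⟨by have := hτ.1; positivity, (div_le_one hσ).2 hτ.2⟩, ?_⟩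
      simp only [add_sub_cancel_left, smul_smul]
      rw [div_mul_cancel₀ _ hσ.ne']
    exact (convex_ball x₀ _).segment_subset hz hzσ h1
  have hder : ∀ τ ∈ Icc (0 : ℝ) σ, HasDerivAt (fun τ : ℝ => s (z + τ • v))
      ⟪gradient s (z + τ • v), v⟫_ℝ τ := by
    intro τ hτ
    have hd := ((hs.contDiffAt (ball_subset_ball (min_le_right _ _) (hseg τ hτ))).differentiableAt
      (zero_lt_one.trans_le hk).ne').hasGradientAt.hasFDerivAt
    have hl : HasDerivAt (fun τ : ℝ => z + τ • v) v τ := by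
      simpa using ((hasDerivAt_id τ).smul_const v).const_add z
    exact hd.comp_hasDerivAt τ hl
  have hmono := strictMonoOn_of_deriv_pos (convex_Icc 0 σ)
    (fun τ hτ => (hder τ hτ).continuousAt.continuousWithinAt) (fun τ hτ => by
      rw [interior_Icc] at hτ
      have hτ' := Ioo_subset_Icc_self hτ
      rw [(hder τ hτ').deriv]
      exact hball _ (ball_subset_ball (min_le_left _ _) (hseg τ hτ')))
  simpa using hmono (left_mem_Icc.2 hσ.le) (right_mem_Icc.2 hσ.le) hσ

/-- Two domains touching from inside at a boundary point have the same outer normal. -/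
lemma normal_eq (h₁ : IsLocalDefining k h K₁ N₁ x₀ r₁ s₁) (h₂ : IsLocalDefining k h K₂ N₂ x₀ r₂ s₂)
    (hk : 1 ≤ k) (hsub : ∀ᶠ z in 𝓝 x₀, z ∈ K₁ → z ∈ K₂) : N₁ x₀ = N₂ x₀ := by
  by_contra hne
  have n₁ := h₁.norm_eq_one
  have n₂ := h₂.norm_eq_one
  have h12 : ⟪N₁ x₀, N₂ x₀⟫_ℝ < 1 := (inner_lt_one_iff_real_of_norm_eq_one n₁ n₂).2 hne
  have e₁ : ⟪N₁ x₀, N₂ x₀ - N₁ x₀⟫_ℝ < 0 := by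
    rw [inner_sub_right, real_inner_self_eq_norm_sq, n₁]; linarith
  have e₂ : 0 < ⟪N₂ x₀, N₂ x₀ - N₁ x₀⟫_ℝ := by
    rw [inner_sub_right, real_inner_self_eq_norm_sq, n₂, real_inner_comm]; linarith
  have hl : Tendsto (fun τ : ℝ => x₀ + τ • (N₂ x₀ - N₁ x₀)) (𝓝[>] 0) (𝓝 x₀) := by
    have : ContinuousAt (fun τ : ℝ => x₀ + τ • (N₂ x₀ - N₁ x₀)) 0 := by fun_prop
    simpa using this.tendsto.mono_left (nhdsWithin_le_nhds (s := Ioi 0))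
  obtain ⟨ε, h3, h4, h5⟩ := ((h₁.eventually_mem_interior hk e₁).and
    ((h₂.eventually_notMem hk e₂).and (hl.eventually hsub))).exists
  exact h4 (h5 (interior_subset h3))

/-- Two domains with a common normal at `x₀`, the first lying inside the second in a region `W`
that is invariant under translations along the normal: the difference of the defining functions is a
nonnegative supersolution. -/
lemma exists_supersolution (h₁ : IsLocalDefining k h K₁ N₁ x₀ r₁ s₁)
    (h₂ : IsLocalDefining k h K₂ N₂ x₀ r₂ s₂) (hk : 2 ≤ k) (hh : ContDiffAt ℝ 1 h (N₁ x₀))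
    (hN : N₁ x₀ = N₂ x₀) {W : Set E} (hW : ∀ z ∈ W, ∀ τ : ℝ, z + τ • N₁ x₀ ∈ W) {r₃ : ℝ}
    (hr₃ : 0 < r₃) (hsub : ∀ z ∈ ball x₀ r₃, z ∈ W → z ∈ K₁ → z ∈ K₂) :
    ∃ ρ > 0, ρ ≤ r₁ ∧ ρ ≤ r₂ ∧ (∃ C, IsEllipticSupersolution (N₁ x₀) (gradient s₂) C
      (fun z => s₁ z - s₂ z) (ball x₀ ρ)) ∧ ∀ z ∈ ball x₀ ρ ∩ W, 0 ≤ s₁ z - s₂ z := by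
  have g₂ := h₂.toIsGraphFunction
  rw [← hN] at g₂
  obtain ⟨ρ, hρ, C, hC⟩ := h₁.toIsGraphFunction.exists_isEllipticSupersolution_sub g₂ hk hh
  set R := min r₁ (min r₂ r₃) with hR
  have hR0 : 0 < R := lt_min h₁.pos (lt_min h₂.pos hr₃)
  have hc : Tendsto (fun z => z + (-s₁ z) • N₁ x₀) (𝓝 x₀) (𝓝 x₀) := by
    have h3 := (h₁.contDiffAt h₁.mem_self).continuousAt
    have : ContinuousAt (fun z => z + (-s₁ z) • N₁ x₀) x₀ := by fun_prop
    simpa [ContinuousAt, h₁.zero] using this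
  obtain ⟨δ, hδ, hball⟩ := Metric.eventually_nhds_iff_ball.1
    (hc.eventually (ball_mem_nhds x₀ hR0))
  refine ⟨min ρ (min δ R), lt_min hρ (lt_min hδ hR0), ?_, ?_, ⟨C, hC.mono
    (ball_subset_ball (min_le_left _ _))⟩, ?_⟩
  · exact (min_le_right _ _).trans ((min_le_right _ _).trans (min_le_left _ _))
  · exact (min_le_right _ _).trans ((min_le_right _ _).trans
      ((min_le_right _ _).trans (min_le_left _ _)))
  · rintro z ⟨hz, hzW⟩
    have hzδ : z ∈ ball x₀ δ := ball_subset_ball ((min_le_right _ _).trans (min_le_left _ _)) hz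
    have hzR : z ∈ ball x₀ R := ball_subset_ball ((min_le_right _ _).trans (min_le_right _ _)) hz
    have hz' : z + (-s₁ z) • N₁ x₀ ∈ ball x₀ R := hball z hzδ
    have i₁ : ball x₀ R ⊆ ball x₀ r₁ := ball_subset_ball (min_le_left _ _)
    have i₂ : ball x₀ R ⊆ ball x₀ r₂ :=
      ball_subset_ball ((min_le_right _ _).trans (min_le_left _ _))
    have i₃ : ball x₀ R ⊆ ball x₀ r₃ :=
      ball_subset_ball ((min_le_right _ _).trans (min_le_right _ _))
    have t₁ := h₁.translate z (i₁ hzR) _ (i₁ hz')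
    have t₂ := g₂.translate z (i₂ hzR) _ (i₂ hz')
    have m₁ : z + (-s₁ z) • N₁ x₀ ∈ K₁ := (h₁.mem_iff _ (i₁ hz')).2 (by rw [t₁]; simp)
    have m₂ := (h₂.mem_iff _ (i₂ hz')).1 (hsub _ (i₃ hz') (hW z hzW _) m₁)
    rw [t₂] at m₂
    linarith

/-- Touching at an interior point: two domains with the same prescribed mean curvature,
one inside the other, that touch at a boundary point coincide nearby. -/
lemma eventually_mem_iff_of_subset (h₁ : IsLocalDefining k h K₁ N₁ x₀ r₁ s₁)
    (h₂ : IsLocalDefining k h K₂ N₂ x₀ r₂ s₂) (hk : 2 ≤ k) (hh : ContDiffAt ℝ 1 h (N₁ x₀))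
    (hsub : ∀ᶠ z in 𝓝 x₀, z ∈ K₁ → z ∈ K₂) : ∀ᶠ z in 𝓝 x₀, z ∈ K₁ ↔ z ∈ K₂ := by
  have hN := h₁.normal_eq h₂ (one_le_two.trans hk) hsub
  obtain ⟨r₃, hr₃, hball⟩ := Metric.eventually_nhds_iff_ball.1 hsub
  obtain ⟨ρ, hρ, hρ₁, hρ₂, ⟨C, hC⟩, hnn⟩ := h₁.exists_supersolution h₂ hk hh hN (W := univ)
    (fun _ _ _ => mem_univ _) hr₃ (fun z hz _ => hball z hz)
  have h0 := hC.eq_zero isOpen_ball (convex_ball _ _) (fun z hz => hnn z ⟨hz, mem_univ _⟩)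
    (mem_ball_self hρ) (by simp [h₁.zero, h₂.zero])
  filter_upwards [ball_mem_nhds x₀ hρ] with z hz
  rw [h₁.mem_iff z (ball_subset_ball hρ₁ hz), h₂.mem_iff z (ball_subset_ball hρ₂ hz),
    sub_eq_zero.1 (h0 z hz)]

/-- Touching at a boundary point: the same conclusion on one side of a hyperplane
orthogonal to the boundary of both domains, when the inclusion is known on that side only. -/
lemma eventually_mem_iff_of_subset_halfspace (h₁ : IsLocalDefining k h K₁ N₁ x₀ r₁ s₁)
    (h₂ : IsLocalDefining k h K₂ N₂ x₀ r₂ s₂) (hk : 2 ≤ k) (hh : ContDiffAt ℝ 1 h (N₁ x₀))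
    (hN : N₁ x₀ = N₂ x₀) {v : E} (hv : ‖v‖ = 1) (hvN : ⟪v, N₁ x₀⟫_ℝ = 0)
    (hsub : ∀ᶠ z in 𝓝 x₀, ⟪v, z⟫_ℝ < ⟪v, x₀⟫_ℝ → z ∈ K₁ → z ∈ K₂) :
    ∀ᶠ z in 𝓝 x₀, ⟪v, z⟫_ℝ < ⟪v, x₀⟫_ℝ → (z ∈ K₁ ↔ z ∈ K₂) := by
  obtain ⟨r₃, hr₃, hball⟩ := Metric.eventually_nhds_iff_ball.1 hsub
  set W : Set E := {z | ⟪v, z⟫_ℝ < ⟪v, x₀⟫_ℝ} with hWdef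
  have hWo : IsOpen W := isOpen_lt (by fun_prop) continuous_const
  have hWc : Convex ℝ W := convex_halfSpace_lt (innerSL ℝ v).toLinearMap.isLinear _
  obtain ⟨ρ, hρ, hρ₁, hρ₂, ⟨C, hC⟩, hnn⟩ := h₁.exists_supersolution h₂ hk hh hN (W := W)
    (fun z hz τ => by
      simp only [hWdef, mem_ofPred_eq, inner_add_right, inner_smul_right, hvN] at hz ⊢
      simpa using hz) hr₃ (fun z hz hzW => hball z hz hzW)
  by_cases hex : ∃ y ∈ ball x₀ ρ ∩ W, s₁ y - s₂ y = 0
  · obtain ⟨y, hy, hy0⟩ := hex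
    have h0 := (hC.mono inter_subset_left).eq_zero (isOpen_ball.inter hWo)
      ((convex_ball _ _).inter hWc) hnn hy hy0
    filter_upwards [ball_mem_nhds x₀ hρ] with z hz hzW
    rw [h₁.mem_iff z (ball_subset_ball hρ₁ hz), h₂.mem_iff z (ball_subset_ball hρ₂ hz),
      sub_eq_zero.1 (h0 z ⟨hz, hzW⟩)]
  · -- otherwise the Hopf lemma contradicts the equality of the gradients at `x₀`
    exfalso
    have hcx : dist (x₀ - (ρ / 3) • v) x₀ = ρ / 3 := by
      simp [norm_smul, hv, abs_of_pos hρ]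
    have hhopf := hC.hopf (c := x₀ - (ρ / 3) • v) (x₀ := x₀) (R := ρ / 3) (by positivity)
      (fun z hz => by
        rw [mem_closedBall] at hz
        rw [mem_ball]
        have := dist_triangle z (x₀ - (ρ / 3) • v) x₀
        linarith)
      (fun z hz => by
        have hzb : z ∈ ball x₀ ρ := by
          rw [mem_ball] at hz ⊢
          have := dist_triangle z (x₀ - (ρ / 3) • v) x₀
          linarith
        have hzW : z ∈ W := by
          rw [mem_ball, dist_eq_norm] at hz
          have h1 : ⟪v, z - (x₀ - (ρ / 3) • v)⟫_ℝ ≤ ‖z - (x₀ - (ρ / 3) • v)‖ := by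
            simpa [hv] using real_inner_le_norm v (z - (x₀ - (ρ / 3) • v))
          rw [inner_sub_right, inner_sub_right, inner_smul_right, real_inner_self_eq_norm_sq,
            hv] at h1
          simp only [hWdef, mem_ofPred_eq]
          linarith
        exact lt_of_le_of_ne (hnn z ⟨hzb, hzW⟩) fun h0 => hex ⟨z, ⟨hzb, hzW⟩, h0.symm⟩)
      (by simp [norm_smul, hv, abs_of_pos hρ]) (by simp [h₁.zero, h₂.zero])
    have g₂ := h₂.toIsGraphFunction
    rw [← hN] at g₂
    have h0 := h₁.toIsGraphFunction.gradient_sub_eq_zero g₂ hk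
    have h0' : fderiv ℝ (fun z => s₁ z - s₂ z) x₀ = 0 := by
      simpa [gradient] using h0
    rw [h0'] at hhopf
    simp at hhopf

end IsLocalDefining

end Domains

/-! ### The method of moving planes -/

section MovingPlanes

variable {E : Type*} [NormedAddCommGroup E] [InnerProductSpace ℝ E] [FiniteDimensional ℝ E]
  [CompleteSpace E]

/-- The reflection in the hyperplane `{x | ⟪v, x⟫ = t}`, for a unit vector `v`. -/
def hyperplaneReflection (v : E) (t : ℝ) (x : E) : E := x + (2 * (t - ⟪v, x⟫_ℝ)) • v

section Reflection

variable {v : E} (hv : ‖v‖ = 1) (t : ℝ) (x : E)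
include hv

lemma reflection_orthogonal_singleton_apply :
    (ℝ ∙ v)ᗮ.reflection x = x - (2 * ⟪v, x⟫_ℝ) • v := by
  rw [Submodule.reflection_orthogonal_apply, Submodule.reflection_singleton_apply, hv]
  simp [two_smul, two_mul, add_smul]

lemma hyperplaneReflection_eq :
    hyperplaneReflection v t x = (ℝ ∙ v)ᗮ.reflection x + (2 * t) • v := by
  rw [reflection_orthogonal_singleton_apply hv, hyperplaneReflection]
  module

lemma inner_hyperplaneReflection :
    ⟪v, hyperplaneReflection v t x⟫_ℝ = 2 * t - ⟪v, x⟫_ℝ := by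
  rw [hyperplaneReflection, inner_add_right, inner_smul_right, real_inner_self_eq_norm_sq, hv]
  ring

lemma hyperplaneReflection_involutive : Function.Involutive (hyperplaneReflection v t) := by
  intro x
  conv_lhs => rw [hyperplaneReflection]
  rw [inner_hyperplaneReflection hv, hyperplaneReflection]
  module

lemma dist_hyperplaneReflection (y : E) :
    dist (hyperplaneReflection v t x) (hyperplaneReflection v t y) = dist x y := by
  rw [hyperplaneReflection_eq hv, hyperplaneReflection_eq hv, dist_add_right,
    LinearIsometryEquiv.dist_map]

end Reflection

lemma continuous_hyperplaneReflection (v : E) (t : ℝ) : Continuous (hyperplaneReflection v t) := by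
  unfold hyperplaneReflection
  fun_prop

lemma hyperplaneReflection_eq_self {v : E} {t : ℝ} {x : E} (h : ⟪v, x⟫_ℝ = t) :
    hyperplaneReflection v t x = x := by
  simp [hyperplaneReflection, h]

/-- The reflection in `{x | ⟪v, x⟫ = t}`, as a homeomorphism. -/
def hyperplaneReflectionHomeomorph {v : E} (hv : ‖v‖ = 1) (t : ℝ) : E ≃ₜ E where
  toFun := hyperplaneReflection v t
  invFun := hyperplaneReflection v t
  left_inv := hyperplaneReflection_involutive hv t
  right_inv := hyperplaneReflection_involutive hv t
  continuous_toFun := continuous_hyperplaneReflection v t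
  continuous_invFun := continuous_hyperplaneReflection v t

section Preimage

variable {K : Set E} {v : E} (hv : ‖v‖ = 1) (t : ℝ) (x : E)
include hv

lemma mem_frontier_preimage_hyperplaneReflection :
    x ∈ frontier (hyperplaneReflection v t ⁻¹' K) ↔ hyperplaneReflection v t x ∈ frontier K := by
  have := (hyperplaneReflectionHomeomorph hv t).preimage_frontier K
  exact (Set.ext_iff.1 this x).symm

end Preimage

variable {k : WithTop ℕ∞} {h : E → ℝ} {K : Set E} {N : E → E} {v : E} {t : ℝ}

/-- The reflection of a domain is locally defined by the reflected functions. -/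
lemma IsLocalDefining.preimage_hyperplaneReflection {x₀ : E} {r : ℝ} {s : E → ℝ}
    (hs : IsLocalDefining k h K N x₀ r s) (hk : 2 ≤ k) (hv : ‖v‖ = 1)
    (hinv : ∀ p, h ((ℝ ∙ v)ᗮ.reflection p) = h p) {y₀ : E}
    (hy₀ : hyperplaneReflection v t y₀ = x₀) :
    IsLocalDefining k h (hyperplaneReflection v t ⁻¹' K)
      (fun z => (ℝ ∙ v)ᗮ.reflection (N (hyperplaneReflection v t z))) y₀ r
      (fun z => s (hyperplaneReflection v t z)) := by
  set A : E ≃ₗᵢ[ℝ] E := (ℝ ∙ v)ᗮ.reflection with hA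
  have hAs : A.symm = A := Submodule.reflection_symm
  have hfun : ∀ z, hyperplaneReflection v t z = A z + (2 * t) • v :=
    fun z => hyperplaneReflection_eq hv t z
  refine ⟨?_, fun z hz => hs.mem_iff _ ?_⟩
  · have := hs.toIsGraphFunction.comp_isometry A ((2 * t) • v) hk (by rw [hAs]; exact hinv)
      (y₀ := y₀) (by rw [← hfun, hy₀])
    rw [hAs] at this
    simpa only [hfun, hy₀, ← hy₀] using this
  · rw [mem_ball] at hz ⊢
    rwa [← hy₀, dist_hyperplaneReflection hv]

/-- The plane at height `t` is admissible for `K` if, for each point of `K` above it, the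
segment from this point down to its reflection lies in `K`. -/
def IsAdmissibleHeight (K : Set E) (v : E) (t : ℝ) : Prop :=
  ∀ x ∈ K, t ≤ ⟪v, x⟫_ℝ → ∀ σ ∈ Icc 0 (2 * (⟪v, x⟫_ℝ - t)), x - σ • v ∈ K

/-- The points near which `K` agrees with its reflection. -/
def symmetryLocus (K : Set E) (v : E) (t : ℝ) : Set E :=
  {x | ∀ᶠ z in 𝓝 x, z ∈ K ↔ hyperplaneReflection v t z ∈ K}

lemma isOpen_symmetryLocus : IsOpen (symmetryLocus K v t) :=
  isOpen_iff_mem_nhds.2 fun _ hx => eventually_eventually_nhds.2 hx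

lemma hyperplaneReflection_mem_symmetryLocus (hv : ‖v‖ = 1) {x : E}
    (hx : x ∈ symmetryLocus K v t) : hyperplaneReflection v t x ∈ symmetryLocus K v t := by
  have h1 : Tendsto (hyperplaneReflection v t) (𝓝 (hyperplaneReflection v t x)) (𝓝 x) := by
    have := (continuous_hyperplaneReflection v t).tendsto (hyperplaneReflection v t x)
    rwa [hyperplaneReflection_involutive hv t x] at this
  filter_upwards [h1.eventually hx] with z hz
  rw [hz, hyperplaneReflection_involutive hv t z]

lemma mem_frontier_of_mem_symmetryLocus (hv : ‖v‖ = 1) {x : E}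
    (hx : x ∈ symmetryLocus K v t) (hxK : x ∈ frontier K) :
    hyperplaneReflection v t x ∈ frontier K := by
  rw [← mem_frontier_preimage_hyperplaneReflection hv]
  rw [frontier, Set.mem_sdiff, mem_closure_iff_frequently, mem_interior_iff_mem_nhds] at hxK ⊢
  refine ⟨(hxK.1.and_eventually hx).mono fun z hz => hz.2.1 hz.1, fun hn => hxK.2 ?_⟩
  filter_upwards [hn, hx] with z h1 h2 using h2.2 h1

namespace IsAdmissibleHeight

lemma mono (ht : IsAdmissibleHeight K v t) {t' : ℝ} (h : t ≤ t') : IsAdmissibleHeight K v t' :=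
  fun x hx hxt σ hσ => ht x hx (h.trans hxt) σ ⟨hσ.1, hσ.2.trans (by linarith)⟩

lemma hyperplaneReflection_mem (ht : IsAdmissibleHeight K v t) {x : E} (hx : x ∈ K)
    (hxt : t ≤ ⟪v, x⟫_ℝ) : hyperplaneReflection v t x ∈ K := by
  have := ht x hx hxt (2 * (⟪v, x⟫_ℝ - t)) ⟨by linarith, le_rfl⟩
  convert this using 1
  rw [hyperplaneReflection]; module

/-- Below an admissible plane, the reflected domain lies inside the domain. -/
lemma mem_of_hyperplaneReflection_mem (ht : IsAdmissibleHeight K v t) (hv : ‖v‖ = 1) {z : E}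
    (hz : hyperplaneReflection v t z ∈ K) (hzt : ⟪v, z⟫_ℝ ≤ t) : z ∈ K := by
  have := ht.hyperplaneReflection_mem hz (by rw [inner_hyperplaneReflection hv]; linarith)
  rwa [hyperplaneReflection_involutive hv t z] at this

end IsAdmissibleHeight

/-- The data of the moving plane argument: the domain, a direction of symmetry of the
prescribed mean curvature, and the connectedness of the boundary. -/
structure IsMovingPlaneDomain (k : WithTop ℕ∞) (h : E → ℝ) (K : Set E) (N : E → E) (v : E) :
    Prop extends IsPrescribedDomain k h K N where
  two_le : 2 ≤ k
  contDiffAt : ∀ p : E, ‖p‖ = 1 → ContDiffAt ℝ 1 h p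
  isPreconnected : IsPreconnected (frontier K)
  norm_eq_one : ‖v‖ = 1
  reflection : ∀ p, h ((ℝ ∙ v)ᗮ.reflection p) = h p

namespace IsMovingPlaneDomain

variable (hK : IsMovingPlaneDomain k h K N v)
include hK

lemma isClosed : IsClosed K := hK.isCompact.isClosed

lemma one_le : 1 ≤ k := one_le_two.trans hK.two_le

lemma exists_reflected {t : ℝ} {x : E} (hx : hyperplaneReflection v t x ∈ frontier K) :
    ∃ r s, IsLocalDefining k h (hyperplaneReflection v t ⁻¹' K)
      (fun z => (ℝ ∙ v)ᗮ.reflection (N (hyperplaneReflection v t z))) x r s := by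
  obtain ⟨r, s, hs⟩ := hK.exists_isLocalDefining _ hx
  exact ⟨r, _, hs.preimage_hyperplaneReflection hK.two_le hK.norm_eq_one hK.reflection rfl⟩

/-- Interior touching of the reflected domain. -/
lemma mem_symmetryLocus_of_lt (ht : IsAdmissibleHeight K v t) {x : E} (hx : x ∈ frontier K)
    (hx' : hyperplaneReflection v t x ∈ frontier K) (hxt : ⟪v, x⟫_ℝ < t) :
    x ∈ symmetryLocus K v t := by
  obtain ⟨r₁, s₁, h₁⟩ := hK.exists_reflected hx'
  obtain ⟨r₂, s₂, h₂⟩ := hK.exists_isLocalDefining x hx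
  have hsub : ∀ᶠ z in 𝓝 x, z ∈ hyperplaneReflection v t ⁻¹' K → z ∈ K := by
    have : ∀ᶠ z in 𝓝 x, ⟪v, z⟫_ℝ < t :=
      (continuous_const.inner continuous_id).continuousAt.eventually (Iio_mem_nhds hxt)
    filter_upwards [this] with z hz hzK
    exact ht.mem_of_hyperplaneReflection_mem hK.norm_eq_one hzK hz.le
  filter_upwards [h₁.eventually_mem_iff_of_subset h₂ hK.two_le
    (hK.contDiffAt _ h₁.norm_eq_one) hsub] with z hz using hz.symm

/-- Touching of the reflected domain at a point of the plane where the plane is orthogonal to the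
boundary. -/
lemma mem_symmetryLocus_of_inner_eq_zero (ht : IsAdmissibleHeight K v t) {x : E}
    (hx : x ∈ frontier K) (hxt : ⟪v, x⟫_ℝ = t) (hN : ⟪v, N x⟫_ℝ = 0) :
    x ∈ symmetryLocus K v t := by
  have hv := hK.norm_eq_one
  have hR : hyperplaneReflection v t x = x := hyperplaneReflection_eq_self hxt
  obtain ⟨r₁, s₁, h₁⟩ := hK.exists_reflected (t := t) (x := x) (by rwa [hR])
  obtain ⟨r₂, s₂, h₂⟩ := hK.exists_isLocalDefining x hx
  have hNN : (ℝ ∙ v)ᗮ.reflection (N (hyperplaneReflection v t x)) = N x := by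
    rw [hR, reflection_orthogonal_singleton_apply hv, hN]; simp
  have hsub : ∀ᶠ z in 𝓝 x, ⟪v, z⟫_ℝ < ⟪v, x⟫_ℝ → z ∈ hyperplaneReflection v t ⁻¹' K → z ∈ K :=
    Eventually.of_forall fun z hz hzK =>
      ht.mem_of_hyperplaneReflection_mem hv hzK (hxt ▸ hz.le)
  have h3 := h₁.eventually_mem_iff_of_subset_halfspace h₂ hK.two_le
    (hK.contDiffAt _ h₁.norm_eq_one) hNN hv (by rw [hNN]; exact hN) hsub
  have h4 : Tendsto (hyperplaneReflection v t) (𝓝 x) (𝓝 x) := by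
    simpa [hR] using (continuous_hyperplaneReflection v t).tendsto x
  filter_upwards [h3, h4.eventually h3] with z hz1 hz2
  rcases lt_trichotomy ⟪v, z⟫_ℝ t with hlt | heq | hgt
  · exact (hz1 (hxt ▸ hlt)).symm
  · rw [hyperplaneReflection_eq_self heq]
  · have := hz2 (by rw [inner_hyperplaneReflection hv]; linarith)
    rwa [mem_preimage, hyperplaneReflection_involutive hv t z] at this

/-- At a point of the plane which is a limit of symmetric boundary points, the boundary is
orthogonal to the plane: otherwise it would be a graph in the direction `v`. -/
lemma inner_eq_zero_of_mem_closure {x : E} (hx : x ∈ frontier K) (hxt : ⟪v, x⟫_ℝ = t)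
    (hxc : x ∈ closure (frontier K ∩ symmetryLocus K v t)) : ⟪v, N x⟫_ℝ = 0 := by
  have hv := hK.norm_eq_one
  by_contra hne
  -- after replacing `v` by `-v`, the function `s` is increasing along `w = ± v`
  obtain ⟨ε, hε, hpos⟩ : ∃ ε : ℝ, ε ^ 2 = 1 ∧ 0 < ⟪N x, ε • v⟫_ℝ := by
    rcases lt_or_gt_of_ne hne with hlt | hgt
    · exact ⟨-1, by norm_num, by rw [inner_smul_right, real_inner_comm]; linarith⟩
    · exact ⟨1, by norm_num, by rw [inner_smul_right, real_inner_comm]; linarith⟩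
  obtain ⟨r, s, hs⟩ := hK.exists_isLocalDefining x hx
  obtain ⟨ρ, hρ, hρr, hmono⟩ := hs.exists_strictMono hK.one_le hpos
  have hball : ball x ρ ⊆ ball x r := ball_subset_ball hρr
  have hR : hyperplaneReflection v t x = x := hyperplaneReflection_eq_self hxt
  have hRball : ∀ z ∈ ball x ρ, hyperplaneReflection v t z ∈ ball x ρ := fun z hz => by
    rw [mem_ball] at hz ⊢
    conv_lhs => rw [← hR]
    rwa [dist_hyperplaneReflection hv]
  have hne_line : ∀ z ∈ ball x ρ, ∀ a : ℝ, a ≠ 0 → z + a • v ∈ ball x ρ →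
      (0 < ε * a → s z < s (z + a • v)) ∧ (ε * a < 0 → s (z + a • v) < s z) := by
    intro z hz a ha hza
    have e1 : a • v = (ε * a) • (ε • v) := by
      rw [smul_smul]; congr 1; linear_combination (-a) * hε
    refine ⟨fun h0 => ?_, fun h0 => ?_⟩
    · rw [e1] at hza ⊢
      exact hmono z hz _ h0 hza
    · have h1 := hmono (z + a • v) hza (-(ε * a)) (by linarith)
      have h2 : z + a • v + -(ε * a) • ε • v = z := by
        rw [neg_smul, ← e1]; abel
      rw [h2] at h1
      exact h1 hz
  obtain ⟨q, ⟨hqF, hqS⟩, hqx⟩ := Metric.mem_closure_iff.1 hxc ρ hρ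
  rw [dist_comm] at hqx
  have hqb : q ∈ ball x ρ := hqx
  have hsq := (hs.mem_frontier_iff hK.isClosed (hball hqb)).1 hqF
  have hqF' := mem_frontier_of_mem_symmetryLocus hv hqS hqF
  have hsq' := (hs.mem_frontier_iff hK.isClosed (hball (hRball q hqb))).1 hqF'
  have hε0 : ε ≠ 0 := fun h0 => by simp [h0] at hε
  by_cases hqt : ⟪v, q⟫_ℝ = t
  · -- a symmetric neighbourhood of a point of the plane
    have hl : ContinuousAt (fun a : ℝ => q + a • (ε • v)) 0 := by fun_prop
    have h1 : ∀ᶠ a : ℝ in 𝓝 0, (q + a • (ε • v) ∈ K ↔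
        hyperplaneReflection v t (q + a • (ε • v)) ∈ K) :=
      hl.eventually (by simpa using! hqS)
    have h2 : ∀ᶠ a : ℝ in 𝓝 0, q + a • (ε • v) ∈ ball x ρ :=
      hl.eventually (by simpa using! isOpen_ball.mem_nhds hqb)
    obtain ⟨a, ⟨ha1, ha2⟩, ha0⟩ := (((h1.and h2).filter_mono nhdsWithin_le_nhds).and
      (self_mem_nhdsWithin : Ioi (0 : ℝ) ∈ 𝓝[>] 0)).exists
    have ha0 : 0 < a := ha0
    have e2 : hyperplaneReflection v t (q + a • (ε • v)) = q + (-(a * ε)) • v := by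
      rw [hyperplaneReflection, inner_add_right, hqt, smul_smul, inner_smul_right,
        real_inner_self_eq_norm_sq, hv]
      module
    have hb' := hRball _ ha2
    rw [hs.mem_iff _ (hball ha2), hs.mem_iff _ (hball hb'), e2] at ha1
    rw [e2] at hb'
    rw [smul_smul] at ha1 ha2
    have h3 := (hne_line q hqb (a * ε) (mul_ne_zero ha0.ne' hε0) ha2).1 (by nlinarith)
    have h4 := (hne_line q hqb (-(a * ε)) (neg_ne_zero.2 (mul_ne_zero ha0.ne' hε0)) hb').2
      (by nlinarith)
    rw [hsq] at h3 h4
    exact absurd (ha1.2 h4.le) (not_le.2 h3)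
  · have hne0 : 2 * (t - ⟪v, q⟫_ℝ) ≠ 0 := by
      intro h0; apply hqt; linarith
    have hb := hne_line q hqb _ hne0 (hRball q hqb)
    rw [← hyperplaneReflection, hsq, hsq'] at hb
    rcases lt_or_gt_of_ne (mul_ne_zero hε0 hne0) with h0 | h0
    · exact lt_irrefl _ (hb.2 h0)
    · exact lt_irrefl _ (hb.1 h0)

/-- The propagation step: if the domain is symmetric near one boundary point, it is
symmetric. -/
lemma mem_iff_of_symmetryLocus_nonempty (ht : IsAdmissibleHeight K v t)
    (hne : (frontier K ∩ symmetryLocus K v t).Nonempty) (x : E) :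
    x ∈ K ↔ hyperplaneReflection v t x ∈ K := by
  have hv := hK.norm_eq_one
  -- the boundary points near which `K` is symmetric form a closed set by the touching principles,
  -- hence all of the connected boundary
  have hcl : closure (frontier K ∩ symmetryLocus K v t) ⊆ frontier K ∩ symmetryLocus K v t := by
    intro y hy
    have hyF : y ∈ frontier K := closure_minimal inter_subset_left isClosed_frontier hy
    have hyF' : hyperplaneReflection v t y ∈ frontier K := by
      have h1 : frontier K ∩ symmetryLocus K v t ⊆ hyperplaneReflection v t ⁻¹' frontier K :=
        fun z hz => mem_frontier_of_mem_symmetryLocus hv hz.2 hz.1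
      exact closure_minimal h1
        (isClosed_frontier.preimage (continuous_hyperplaneReflection v t)) hy
    refine ⟨hyF, ?_⟩
    rcases lt_trichotomy ⟪v, y⟫_ℝ t with hlt | heq | hgt
    · exact hK.mem_symmetryLocus_of_lt ht hyF hyF' hlt
    · exact hK.mem_symmetryLocus_of_inner_eq_zero ht hyF heq
        (hK.inner_eq_zero_of_mem_closure hyF heq hy)
    · have h1 := hK.mem_symmetryLocus_of_lt ht hyF'
        (by rwa [hyperplaneReflection_involutive hv t y])
        (by rw [inner_hyperplaneReflection hv]; linarith)
      have h2 := hyperplaneReflection_mem_symmetryLocus hv h1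
      rwa [hyperplaneReflection_involutive hv t y] at h2
  have hall : frontier K ⊆ symmetryLocus K v t := by
    by_contra hnot
    obtain ⟨y, hyF, hyS⟩ := not_subset.1 hnot
    obtain ⟨z, -, hz1, hz2⟩ := isPreconnected_closed_iff.1 hK.isPreconnected
      (frontier K ∩ symmetryLocus K v t) (frontier K ∩ (symmetryLocus K v t)ᶜ)
      (isClosed_of_closure_subset hcl)
      (isClosed_frontier.inter isOpen_symmetryLocus.isClosed_compl)
      (fun z hz => (em (z ∈ symmetryLocus K v t)).imp (fun h => ⟨hz, h⟩) (fun h => ⟨hz, h⟩))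
      (hne.mono fun z hz => ⟨hz.1, hz⟩) ⟨y, hyF, hyF, hyS⟩
    exact hz2.2 hz1.2
  -- the set of points of `K` whose reflection is not in `K` is open and closed
  have hempty : ∀ y, y ∈ K → hyperplaneReflection v t y ∈ K := by
    set B : Set E := {y | y ∈ K ∧ hyperplaneReflection v t y ∉ K} with hB
    have hcont := continuous_hyperplaneReflection v t
    have hfr : ∀ y, y ∈ frontier K ∨ hyperplaneReflection v t y ∈ frontier K →
        y ∈ symmetryLocus K v t := by
      rintro y (hy | hy)
      · exact hall hy
      · have := hyperplaneReflection_mem_symmetryLocus hv (hall hy)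
        rwa [hyperplaneReflection_involutive hv t y] at this
    have hBo : IsOpen B := by
      rw [isOpen_iff_mem_nhds]
      rintro y ⟨hy1, hy2⟩
      have hyi : y ∈ interior K := by
        by_contra hni
        have : y ∈ symmetryLocus K v t := hfr y (Or.inl ⟨subset_closure hy1, hni⟩)
        exact hy2 (this.self_of_nhds.1 hy1)
      filter_upwards [mem_interior_iff_mem_nhds.1 hyi,
        hcont.continuousAt.eventually (hK.isClosed.isOpen_compl.mem_nhds hy2)] with z h1 h2
        using ⟨h1, h2⟩
    have hBc : IsClosed B := by
      refine isClosed_of_closure_subset fun y hy => ?_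
      refine ⟨closure_minimal (fun z hz => hz.1) hK.isClosed hy, fun hyR => ?_⟩
      have hfreq := mem_closure_iff_frequently.1 hy
      by_cases hyi : hyperplaneReflection v t y ∈ interior K
      · have := hcont.continuousAt.eventually (isOpen_interior.mem_nhds hyi)
        obtain ⟨z, hz1, hz2⟩ := (hfreq.and_eventually this).exists
        exact hz1.2 (interior_subset hz2)
      · obtain ⟨z, hz1, hz2⟩ := (hfreq.and_eventually
          (hfr y (Or.inr ⟨subset_closure hyR, hyi⟩))).exists
        exact hz1.2 (hz2.1 hz1.1)
    intro y hy
    by_contra hyR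
    have huniv : B = univ := (isClopen_iff.1 ⟨hBc, hBo⟩).resolve_left
      (nonempty_iff_ne_empty.1 ⟨y, hy, hyR⟩)
    have : hyperplaneReflection v t y ∈ B := by rw [huniv]; trivial
    exact hyR this.1
  exact ⟨hempty x, fun hx => by
    have := hempty _ hx
    rwa [hyperplaneReflection_involutive hv t x] at this⟩

/-- Above an admissible plane which is not a plane of symmetry, a point and its
reflection cannot both lie on the boundary. -/
lemma hyperplaneReflection_mem_interior (ht : IsAdmissibleHeight K v t)
    (hns : ¬ ∀ x, x ∈ K ↔ hyperplaneReflection v t x ∈ K) {x : E} (hx : x ∈ K)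
    (hxt : t < ⟪v, x⟫_ℝ) : hyperplaneReflection v t x ∈ interior K := by
  have hv := hK.norm_eq_one
  by_contra hni
  have hR : hyperplaneReflection v t x ∈ frontier K :=
    ⟨subset_closure (ht.hyperplaneReflection_mem hx hxt.le), hni⟩
  by_cases hxi : x ∈ interior K
  · have h1 : ∀ᶠ z in 𝓝 x, t < ⟪v, z⟫_ℝ :=
      (continuous_const.inner continuous_id).continuousAt.eventually (Ioi_mem_nhds hxt)
    have h2 : ∀ᶠ z in 𝓝 x, z ∈ K := mem_interior_iff_mem_nhds.1 hxi
    have h3 : Tendsto (hyperplaneReflection v t) (𝓝 (hyperplaneReflection v t x)) (𝓝 x) := by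
      have := (continuous_hyperplaneReflection v t).tendsto (hyperplaneReflection v t x)
      rwa [hyperplaneReflection_involutive hv t x] at this
    refine hni (mem_interior_iff_mem_nhds.2 ?_)
    filter_upwards [h3.eventually (h1.and h2)] with z hz
    have := ht.hyperplaneReflection_mem hz.2 hz.1.le
    rwa [hyperplaneReflection_involutive hv t z] at this
  · have hxF : x ∈ frontier K := ⟨subset_closure hx, hxi⟩
    refine hns (hK.mem_iff_of_symmetryLocus_nonempty ht ⟨_, hR,
      hK.mem_symmetryLocus_of_lt ht hR ?_ ?_⟩)
    · rwa [hyperplaneReflection_involutive hv t x]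
    · rw [inner_hyperplaneReflection hv]; linarith

/-- On an admissible plane which is not a plane of symmetry, the boundary is a graph in the
direction `v`. -/
lemma inner_normal_pos (ht : IsAdmissibleHeight K v t)
    (hns : ¬ ∀ x, x ∈ K ↔ hyperplaneReflection v t x ∈ K) {x : E} (hx : x ∈ frontier K)
    (hxt : ⟪v, x⟫_ℝ = t) : 0 < ⟪v, N x⟫_ℝ := by
  have hv := hK.norm_eq_one
  obtain ⟨r, s, hs⟩ := hK.exists_isLocalDefining x hx
  rcases lt_trichotomy ⟪v, N x⟫_ℝ 0 with hlt | heq | hgt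
  · exfalso
    have h1 : ⟪N x, v⟫_ℝ < 0 := by rwa [real_inner_comm]
    have h2 : 0 < ⟪N x, -v⟫_ℝ := by rw [inner_neg_right]; linarith
    obtain ⟨ε, ⟨h3, h4⟩, h5⟩ := (((hs.eventually_mem_interior hK.one_le h1).and
      (hs.eventually_notMem hK.one_le h2)).and self_mem_nhdsWithin).exists
    have h5 : 0 < ε := h5
    have h6 := ht.hyperplaneReflection_mem (interior_subset h3) (by
      rw [inner_add_right, inner_smul_right, real_inner_self_eq_norm_sq, hv, hxt]; linarith)
    refine h4 ?_
    convert h6 using 1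
    rw [hyperplaneReflection, inner_add_right, inner_smul_right, real_inner_self_eq_norm_sq, hv,
      hxt]
    module
  · exact absurd (hK.mem_iff_of_symmetryLocus_nonempty ht
      ⟨x, hx, hK.mem_symmetryLocus_of_inner_eq_zero ht hx hxt heq⟩) hns
  · exact hgt

/-- No plane strictly above an admissible plane is a plane of symmetry. -/
lemma not_symmetric_of_lt (ht : IsAdmissibleHeight K v t) {t' : ℝ} (htt' : t < t') :
    ¬ ∀ x, x ∈ K ↔ hyperplaneReflection v t' x ∈ K := by
  intro hsym
  have hv := hK.norm_eq_one
  obtain ⟨x, hx, hmax⟩ := hK.isCompact.exists_isMaxOn hK.nonempty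
    (f := fun x => ⟪v, x⟫_ℝ) (by fun_prop)
  have h1 : 2 * t' - ⟪v, x⟫_ℝ ≤ ⟪v, x⟫_ℝ := by
    rw [← inner_hyperplaneReflection hv]
    exact hmax ((hsym x).1 hx)
  have h2 := ht.hyperplaneReflection_mem hx (by linarith)
  have h3 : 2 * t' - (2 * t - ⟪v, x⟫_ℝ) ≤ ⟪v, x⟫_ℝ := by
    rw [← inner_hyperplaneReflection hv t x, ← inner_hyperplaneReflection hv]
    exact hmax ((hsym _).1 h2)
  linarith

/-- The plane can be moved slightly below an admissible plane which is not a plane of symmetry. -/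
lemma exists_lt_isAdmissibleHeight (ht : IsAdmissibleHeight K v t)
    (hns : ¬ ∀ x, x ∈ K ↔ hyperplaneReflection v t x ∈ K) :
    ∃ t' < t, IsAdmissibleHeight K v t' := by
  have hv := hK.norm_eq_one
  have hvv : ⟪v, v⟫_ℝ = 1 := by rw [real_inner_self_eq_norm_sq, hv]; norm_num
  -- at all heights at least `t`, the outer normal points strictly upwards
  have hpos : ∀ x ∈ frontier K, t ≤ ⟪v, x⟫_ℝ → 0 < ⟪N x, v⟫_ℝ := by
    intro x hx hxt
    rw [real_inner_comm]
    rcases hxt.eq_or_lt with heq | hlt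
    · exact hK.inner_normal_pos ht hns hx heq.symm
    · exact hK.inner_normal_pos (ht.mono hxt) (hK.not_symmetric_of_lt ht hlt) hx rfl
  by_contra! hcon
  -- a sequence of segments that leave `K`
  have hex : ∀ n : ℕ, ∃ q : E × ℝ, q.1 ∈ K ∧ t - 1 / ((n : ℝ) + 1) ≤ ⟪v, q.1⟫_ℝ ∧ 0 ≤ q.2 ∧
      q.2 ≤ 2 * (⟪v, q.1⟫_ℝ - (t - 1 / ((n : ℝ) + 1))) ∧ q.1 - q.2 • v ∉ K := by
    intro n
    have h1 := hcon (t - 1 / ((n : ℝ) + 1)) (by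
      have : (0 : ℝ) < 1 / ((n : ℝ) + 1) := by positivity
      linarith)
    unfold IsAdmissibleHeight at h1
    push Not at h1
    obtain ⟨x, hx, hxt, σ, hσ, hn⟩ := h1
    exact ⟨(x, σ), hx, hxt, hσ.1, hσ.2, hn⟩
  choose q hq1 hq2 hq3 hq4 hq5 using hex
  obtain ⟨b, hb⟩ := hK.isCompact.bddAbove_image (f := fun x => ⟪v, x⟫_ℝ) (by fun_prop)
  have hqc : ∀ n, q n ∈ K ×ˢ Icc (0 : ℝ) (2 * (b - (t - 1))) := by
    intro n
    refine ⟨hq1 n, hq3 n, (hq4 n).trans ?_⟩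
    have h1 : ⟪v, (q n).1⟫_ℝ ≤ b := hb ⟨_, hq1 n, rfl⟩
    have h2 : 1 / ((n : ℝ) + 1) ≤ 1 := by
      rw [div_le_one (by positivity)]
      have : (0 : ℝ) ≤ n := n.cast_nonneg
      linarith
    linarith
  obtain ⟨⟨x, σ⟩, ⟨hx, hσ⟩, φ, hφ, hlim⟩ := (hK.isCompact.prod isCompact_Icc).tendsto_subseq hqc
  have l1 : Tendsto (fun n => (q (φ n)).1) atTop (𝓝 x) :=
    (continuous_fst.tendsto (x, σ)).comp hlim
  have l2 : Tendsto (fun n => (q (φ n)).2) atTop (𝓝 σ) :=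
    (continuous_snd.tendsto (x, σ)).comp hlim
  have l3 : Tendsto (fun n => ⟪v, (q (φ n)).1⟫_ℝ) atTop (𝓝 ⟪v, x⟫_ℝ) :=
    tendsto_const_nhds.inner l1
  have l4 : Tendsto (fun n => t - 1 / ((φ n : ℝ) + 1)) atTop (𝓝 t) := by
    have := (tendsto_one_div_add_atTop_nhds_zero_nat (𝕜 := ℝ)).comp hφ.tendsto_atTop
    simpa [Function.comp_def] using this.const_sub t
  have l5 : Tendsto (fun n => (q (φ n)).1 - (q (φ n)).2 • v) atTop (𝓝 (x - σ • v)) :=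
    l1.sub (l2.smul_const v)
  have hxt : t ≤ ⟪v, x⟫_ℝ := le_of_tendsto_of_tendsto' l4 l3 fun n => hq2 _
  have hσ2 : σ ≤ 2 * (⟪v, x⟫_ℝ - t) :=
    le_of_tendsto_of_tendsto' l2 ((l3.sub l4).const_mul 2) fun n => hq4 _
  -- the endpoint of the limit segment lies on the boundary
  have hyK : x - σ • v ∈ K := ht x hx hxt σ ⟨hσ.1, hσ2⟩
  have hyi : x - σ • v ∉ interior K := fun hi => by
    obtain ⟨n, hn⟩ := (l5.eventually (mem_interior_iff_mem_nhds.1 hi)).exists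
    exact hq5 _ hn
  have hyF : x - σ • v ∈ frontier K := ⟨subset_closure hyK, hyi⟩
  have hyv : ⟪v, x - σ • v⟫_ℝ = ⟪v, x⟫_ℝ - σ := by
    rw [inner_sub_right, inner_smul_right, hvv, mul_one]
  rcases hσ.1.eq_or_lt with h0 | h0
  · -- degenerate segments: near the limit point `K` is a subgraph
    subst h0
    rw [zero_smul, sub_zero] at hyF l5
    obtain ⟨r, s, hs⟩ := hK.exists_isLocalDefining x hyF
    obtain ⟨ρ, hρ, hρr, hmono⟩ := hs.exists_strictMono hK.one_le (hpos x hyF hxt)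
    obtain ⟨n, hn1, hn2⟩ := ((l1.eventually (ball_mem_nhds x hρ)).and
      (l5.eventually (ball_mem_nhds x hρ))).exists
    have k1 := (hs.mem_iff _ (ball_subset_ball hρr hn1)).1 (hq1 _)
    have k2 : ¬ _ := fun h => hq5 (φ n) ((hs.mem_iff _ (ball_subset_ball hρr hn2)).2 h)
    rcases (hq3 (φ n)).eq_or_lt with h1 | h1
    · rw [← h1, zero_smul, sub_zero] at k2
      exact k2 k1
    · have := hmono _ hn2 _ h1 (by simpa using hn1)
      rw [sub_add_cancel] at this
      exact k2 (this.le.trans k1)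
  -- an endpoint at height at least `t` contradicts the sign of the normal there, and one below `t`
  -- is the reflection of a point of `K` above the plane, hence interior
  · rcases le_or_gt t ⟪v, x - σ • v⟫_ℝ with hle | hlt
    · obtain ⟨r, s, hs⟩ := hK.exists_isLocalDefining _ hyF
      obtain ⟨ε, h1, h2⟩ := ((hs.eventually_notMem hK.one_le (hpos _ hyF hle)).and
        (Ioo_mem_nhdsGT h0)).exists
      refine h1 ?_
      have := ht x hx hxt (σ - ε) ⟨by linarith [h2.2], by linarith [h2.1]⟩
      convert this using 1
      module
    · have hRt : ⟪v, hyperplaneReflection v t (x - σ • v)⟫_ℝ = 2 * t - (⟪v, x⟫_ℝ - σ) := by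
        rw [inner_hyperplaneReflection hv, hyv]
      have h1 : hyperplaneReflection v t (x - σ • v) ∈ K := by
        have := ht x hx hxt (⟪v, x⟫_ℝ - ⟪v, hyperplaneReflection v t (x - σ • v)⟫_ℝ)
          ⟨by rw [hRt]; linarith, by rw [hRt]; linarith⟩
        convert this using 1
        rw [hRt, hyperplaneReflection, hyv]
        module
      have h2 := hK.hyperplaneReflection_mem_interior ht hns h1 (by rw [hRt]; linarith)
      rw [hyperplaneReflection_involutive hv t] at h2
      exact hyi h2

/-- The Alexandrov reflection theorem: there is a lowest admissible plane, and it is a plane of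
symmetry. -/
theorem exists_isAdmissibleHeight_symmetric : ∃ c : ℝ, IsAdmissibleHeight K v c ∧
    ∀ x, x ∈ K ↔ hyperplaneReflection v c x ∈ K := by
  have hv := hK.norm_eq_one
  obtain ⟨b, hb⟩ := hK.isCompact.bddAbove_image (f := fun x => ⟪v, x⟫_ℝ) (by fun_prop)
  obtain ⟨a, ha⟩ := hK.isCompact.bddBelow_image (f := fun x => ⟪v, x⟫_ℝ) (by fun_prop)
  set S : Set ℝ := {t | IsAdmissibleHeight K v t} with hS
  have hne : S.Nonempty := by
    refine ⟨b, fun x hx hxb σ hσ => ?_⟩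
    have h1 : ⟪v, x⟫_ℝ ≤ b := hb ⟨x, hx, rfl⟩
    have h2 : σ = 0 := le_antisymm (by linarith [hσ.2]) hσ.1
    simpa [h2] using hx
  have hbdd : BddBelow S := by
    refine ⟨a, fun t ht => ?_⟩
    by_contra! hlt
    obtain ⟨x, hx⟩ := hK.nonempty
    obtain ⟨y, hy, hmin⟩ := hK.isCompact.exists_isMinOn hK.nonempty
      (f := fun x => ⟪v, x⟫_ℝ) (by fun_prop)
    have h1 : a ≤ ⟪v, y⟫_ℝ := ha ⟨y, hy, rfl⟩
    have h2 : ⟪v, y⟫_ℝ ≤ 2 * t - ⟪v, y⟫_ℝ := by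
      rw [← inner_hyperplaneReflection hv]
      exact hmin (IsAdmissibleHeight.hyperplaneReflection_mem ht hy (by linarith))
    linarith
  have hmem : IsAdmissibleHeight K v (sInf S) := by
    intro x hx hxt σ hσ
    have hgt : ∀ t, sInf S < t → IsAdmissibleHeight K v t := fun t ht => by
      obtain ⟨t', ht', hlt⟩ := exists_lt_of_csInf_lt hne ht
      exact IsAdmissibleHeight.mono ht' hlt.le
    rcases hσ.1.eq_or_lt with h0 | h0
    · simpa [← h0] using hx
    · have hcl : IsClosed {σ : ℝ | x - σ • v ∈ K} := hK.isClosed.preimage (by fun_prop)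
      have hsub : Ioo 0 σ ⊆ {σ : ℝ | x - σ • v ∈ K} := fun τ hτ =>
        hgt (sInf S + (σ - τ) / 2) (by linarith [hτ.2]) x hx (by linarith [hσ.2, hτ.1])
          τ ⟨hτ.1.le, by linarith [hσ.2]⟩
      have := closure_minimal hsub hcl
      rw [closure_Ioo h0.ne] at this
      exact this (right_mem_Icc.2 h0.le)
  refine ⟨sInf S, hmem, ?_⟩
  by_contra hns
  obtain ⟨t', hlt, ht'⟩ := hK.exists_lt_isAdmissibleHeight hmem hns
  exact absurd (csInf_le hbdd ht') (not_le.2 hlt)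

end IsMovingPlaneDomain

/-- The conclusion of the moving plane argument for the domain `K` in the direction `v`: the plane
at height `c` is a plane of symmetry, the outer normal points away from it, and all planes above it
are strictly admissible. -/
structure IsSymmetryHeight (K : Set E) (N : E → E) (v : E) (c : ℝ) : Prop where
  isAdmissibleHeight : IsAdmissibleHeight K v c
  mem_iff : ∀ x, x ∈ K ↔ hyperplaneReflection v c x ∈ K
  normal_pos : ∀ x ∈ frontier K, c < ⟪v, x⟫_ℝ → 0 < ⟪v, N x⟫_ℝ
  normal_eq_zero : ∀ x ∈ frontier K, ⟪v, x⟫_ℝ = c → ⟪v, N x⟫_ℝ = 0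
  normal_neg : ∀ x ∈ frontier K, ⟪v, x⟫_ℝ < c → ⟪v, N x⟫_ℝ < 0
  mem_interior : ∀ x ∈ K, ∀ t, c < t → t < ⟪v, x⟫_ℝ → hyperplaneReflection v t x ∈ interior K

/-- The normal at points above the plane of symmetry is controlled by the planes through these
points; at the other points the symmetry determines its sign. -/
theorem IsMovingPlaneDomain.exists_isSymmetryHeight (hK : IsMovingPlaneDomain k h K N v) :
    ∃ c : ℝ, IsSymmetryHeight K N v c := by
  obtain ⟨c, hc, hsym⟩ := hK.exists_isAdmissibleHeight_symmetric
  have hv := hK.norm_eq_one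
  have hpre : hyperplaneReflection v c ⁻¹' K = K := by
    ext x; exact (hsym x).symm
  have hF : ∀ x ∈ frontier K, hyperplaneReflection v c x ∈ frontier K := fun x hx => by
    rw [← mem_frontier_preimage_hyperplaneReflection hv, hpre]; exact hx
  -- the outer normal is equivariant under the symmetry
  have hN : ∀ x ∈ frontier K, ⟪v, N (hyperplaneReflection v c x)⟫_ℝ = -⟪v, N x⟫_ℝ := by
    intro x hx
    obtain ⟨r₁, s₁, h₁⟩ := hK.exists_reflected (hF x hx)
    obtain ⟨r₂, s₂, h₂⟩ := hK.exists_isLocalDefining x hx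
    have h3 := h₁.normal_eq h₂ hK.one_le (Eventually.of_forall fun z hz => by rwa [hpre] at hz)
    rw [← h3, reflection_orthogonal_singleton_apply hv, inner_sub_right, inner_smul_right,
      real_inner_self_eq_norm_sq, hv]
    ring
  have hpos : ∀ x ∈ frontier K, c < ⟪v, x⟫_ℝ → 0 < ⟪v, N x⟫_ℝ := fun x hx hlt =>
    hK.inner_normal_pos (hc.mono hlt.le) (hK.not_symmetric_of_lt hc hlt) hx rfl
  refine ⟨c, hc, hsym, hpos, fun x hx heq => ?_, fun x hx hlt => ?_, fun x hx t hct htx =>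
    hK.hyperplaneReflection_mem_interior (hc.mono hct.le) (hK.not_symmetric_of_lt hc hct) hx htx⟩
  · have := hN x hx
    rw [hyperplaneReflection_eq_self heq] at this
    linarith
  · have h1 := hpos _ (hF x hx) (by rw [inner_hyperplaneReflection hv]; linarith)
    rw [hN x hx] at h1
    linarith

end MovingPlanes

/-! ### Smoothness of implicitly defined functions -/

section ImplicitFunction

/-- A function that solves an equation `F (x, θ x) = const` uniquely near a point, where `F` has a
nonzero derivative in the second variable, is as smooth as `F`. -/
lemma contDiffAt_of_implicit {X : Type*} [NormedAddCommGroup X] [NormedSpace ℝ X] [CompleteSpace X]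
    {k : WithTop ℕ∞} (hk : 1 ≤ k) {F : X × ℝ → ℝ} {x₀ : X} {t₀ a : ℝ}
    (hF : ContDiffAt ℝ k F (x₀, t₀)) (hd : HasDerivAt (fun t => F (x₀, t)) a t₀) (ha : a ≠ 0)
    {θ : X → ℝ} (hθ : ∀ᶠ q in 𝓝 (x₀, t₀), F q = F (x₀, t₀) → θ q.1 = q.2) :
    ContDiffAt ℝ k θ x₀ := by
  have hk0 : k ≠ 0 := (zero_lt_one.trans_le hk).ne'
  have hder : fderiv ℝ F (x₀, t₀) (0, 1) = a := by
    have h1 := (hF.differentiableAt hk0).hasFDerivAt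
    have h2 := h1.comp_hasDerivAt t₀ ((hasDerivAt_const t₀ x₀).prodMk (hasDerivAt_id t₀))
    exact h2.unique hd
  have hinv : (fderiv ℝ F (x₀, t₀) ∘L ContinuousLinearMap.inr ℝ X ℝ).IsInvertible := by
    refine ⟨ContinuousLinearEquiv.unitsEquivAut ℝ (Units.mk0 a ha), ?_⟩
    ext
    simp [hder]
  have himp := hF.contDiffAt_implicitFunction hk0 hinv
  refine himp.congr_of_eventuallyEq ?_
  have hself := hF.implicitFunction_apply_self hk0 hinv
  have hc : ContinuousAt (fun y => (y, hF.implicitFunction hk0 hinv y)) x₀ :=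
    continuousAt_id.prodMk himp.continuousAt
  rw [ContinuousAt, hself] at hc
  filter_upwards [hF.eventually_apply_implicitFunction hk0 hinv, hc.eventually hθ] with y h1 h2
    using h2 h1

end ImplicitFunction

/-! ### The bi-graph over a plane of symmetry -/

section Bigraph

variable {E : Type*} [NormedAddCommGroup E] [InnerProductSpace ℝ E] [FiniteDimensional ℝ E]
  [CompleteSpace E]

/-- The component of `x` orthogonal to the unit vector `v`. -/
def orthogonalPart {v : E} (hv : ‖v‖ = 1) (x : E) : (ℝ ∙ v)ᗮ :=
  ⟨x - ⟪v, x⟫_ℝ • v, by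
    rw [Submodule.mem_orthogonal_singleton_iff_inner_right, inner_sub_right, inner_smul_right,
      real_inner_self_eq_norm_sq, hv]
    ring⟩

/-- The point of the hyperplane `{x | ⟪v, x⟫ = c}` with orthogonal part `w`, moved by `σ` in
the direction `v`. -/
def verticalPoint {v : E} (c : ℝ) (w : (ℝ ∙ v)ᗮ) (σ : ℝ) : E := c • v + (w : E) + σ • v

/-- The largest `σ` for which the point over `w` at height `σ` above the hyperplane
`{x | ⟪v, x⟫ = c}` lies in `K`. -/
noncomputable def topHeight (K : Set E) {v : E} (c : ℝ) (w : (ℝ ∙ v)ᗮ) : ℝ :=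
  sSup {σ | verticalPoint c w σ ∈ K}

section VerticalPoint

variable {v : E} (hv : ‖v‖ = 1) (c : ℝ) (w : (ℝ ∙ v)ᗮ) (σ : ℝ)

lemma continuous_orthogonalPart : Continuous (orthogonalPart hv) := by
  unfold orthogonalPart
  fun_prop

lemma continuous_verticalPoint :
    Continuous fun q : (ℝ ∙ v)ᗮ × ℝ => verticalPoint c q.1 q.2 := by
  unfold verticalPoint
  fun_prop

lemma contDiff_verticalPoint {k : WithTop ℕ∞} :
    ContDiff ℝ k fun q : (ℝ ∙ v)ᗮ × ℝ => verticalPoint c q.1 q.2 :=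
  (contDiff_const.add ((ℝ ∙ v)ᗮ.subtypeL.contDiff.comp contDiff_fst)).add
    (contDiff_snd.smul contDiff_const)

lemma inner_coe_eq_zero : ⟪v, (w : E)⟫_ℝ = 0 :=
  Submodule.mem_orthogonal_singleton_iff_inner_right.1 w.2

include hv in
lemma inner_verticalPoint : ⟪v, verticalPoint c w σ⟫_ℝ = c + σ := by
  rw [verticalPoint, inner_add_right, inner_add_right, inner_smul_right, inner_smul_right,
    real_inner_self_eq_norm_sq, hv, inner_coe_eq_zero]
  ring

lemma orthogonalPart_verticalPoint : orthogonalPart hv (verticalPoint c w σ) = w := by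
  ext
  change verticalPoint c w σ - ⟪v, verticalPoint c w σ⟫_ℝ • v = w
  rw [inner_verticalPoint hv, verticalPoint]
  module

lemma verticalPoint_orthogonalPart (x : E) :
    verticalPoint c (orthogonalPart hv x) (⟪v, x⟫_ℝ - c) = x := by
  change c • v + (x - ⟪v, x⟫_ℝ • v) + (⟪v, x⟫_ℝ - c) • v = x
  module

lemma verticalPoint_sub_smul (τ : ℝ) :
    verticalPoint c w σ - τ • v = verticalPoint c w (σ - τ) := by
  rw [verticalPoint, verticalPoint]; module

include hv in
lemma hyperplaneReflection_verticalPoint (t : ℝ) :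
    hyperplaneReflection v t (verticalPoint c w σ) =
      verticalPoint c w (2 * (t - c) - σ) := by
  rw [hyperplaneReflection, inner_verticalPoint hv, verticalPoint, verticalPoint]
  module

end VerticalPoint

namespace IsSymmetryHeight

variable {k : WithTop ℕ∞} {h : E → ℝ} {K : Set E} {N : E → E} {v : E} {c : ℝ}
  (hS : IsSymmetryHeight K N v c) (hK : IsPrescribedDomain k h K N) (hv : ‖v‖ = 1)
include hS hv

lemma verticalPoint_mem {w : (ℝ ∙ v)ᗮ} {σ τ : ℝ} (hσ : verticalPoint c w σ ∈ K) (hτ : |τ| ≤ σ) :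
    verticalPoint c w τ ∈ K := by
  rw [abs_le] at hτ
  have := hS.isAdmissibleHeight _ hσ (by rw [inner_verticalPoint hv]; linarith) (σ - τ)
    ⟨by linarith, by rw [inner_verticalPoint hv]; linarith⟩
  rwa [verticalPoint_sub_smul, sub_sub_cancel] at this

lemma verticalPoint_zero_mem {x : E} (hx : x ∈ K) :
    verticalPoint c (orthogonalPart hv x) 0 ∈ K := by
  rcases le_total c ⟪v, x⟫_ℝ with hle | hle
  · refine hS.verticalPoint_mem hv (σ := ⟪v, x⟫_ℝ - c) ?_ (by simpa using hle)
    rwa [verticalPoint_orthogonalPart]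
  · refine hS.verticalPoint_mem hv (σ := c - ⟪v, x⟫_ℝ) ?_ (by simpa using hle)
    rw [← verticalPoint_orthogonalPart hv c x, hS.mem_iff,
      hyperplaneReflection_verticalPoint hv] at hx
    convert hx using 1
    ring_nf

/-- Nothing of `K` lies above a boundary point of the plane of symmetry. -/
lemma le_zero_of_mem_frontier {w : (ℝ ∙ v)ᗮ} {σ : ℝ} (hw : verticalPoint c w 0 ∈ frontier K)
    (hσ : verticalPoint c w σ ∈ K) : σ ≤ 0 := by
  by_contra! hpos
  have := hS.mem_interior _ hσ (c + σ / 2) (by linarith) (by rw [inner_verticalPoint hv]; linarith)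
  rw [hyperplaneReflection_verticalPoint hv] at this
  refine hw.2 ?_
  convert this using 2
  ring

lemma frontier_symm {x : E} (hx : x ∈ frontier K) : hyperplaneReflection v c x ∈ frontier K := by
  have hpre : hyperplaneReflection v c ⁻¹' K = K := by
    ext y; exact (hS.mem_iff y).symm
  rw [← mem_frontier_preimage_hyperplaneReflection hv, hpre]; exact hx

include hK

lemma isCompact_setOf_verticalPoint_mem (w : (ℝ ∙ v)ᗮ) :
    IsCompact {σ | verticalPoint c w σ ∈ K} := by
  have hcont : Continuous fun σ : ℝ => verticalPoint c w σ :=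
    (continuous_verticalPoint c).comp (by fun_prop : Continuous fun σ : ℝ => (w, σ))
  have himage : {σ | verticalPoint c w σ ∈ K} ⊆ (fun x => ⟪v, x⟫_ℝ - c) '' K := fun σ hσ =>
    ⟨_, hσ, by simp only [inner_verticalPoint hv]; ring⟩
  exact (hK.isCompact.image (by fun_prop)).of_isClosed_subset
    (hK.isCompact.isClosed.preimage hcont) himage

lemma le_topHeight {w : (ℝ ∙ v)ᗮ} {σ : ℝ} (hσ : verticalPoint c w σ ∈ K) :
    σ ≤ topHeight K c w :=
  le_csSup (hS.isCompact_setOf_verticalPoint_mem hK hv w).bddAbove hσ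

lemma verticalPoint_topHeight_mem {w : (ℝ ∙ v)ᗮ} (hw : verticalPoint c w 0 ∈ K) :
    verticalPoint c w (topHeight K c w) ∈ K :=
  (hS.isCompact_setOf_verticalPoint_mem hK hv w).sSup_mem ⟨0, hw⟩

lemma verticalPoint_topHeight_mem_frontier {w : (ℝ ∙ v)ᗮ} (hw : verticalPoint c w 0 ∈ K) :
    verticalPoint c w (topHeight K c w) ∈ frontier K := by
  refine ⟨subset_closure (hS.verticalPoint_topHeight_mem hK hv hw), fun hi => ?_⟩
  have hcont : Continuous fun σ : ℝ => verticalPoint c w σ :=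
    (continuous_verticalPoint c).comp (by fun_prop : Continuous fun σ : ℝ => (w, σ))
  have h1 : ∀ᶠ σ in 𝓝 (topHeight K c w), verticalPoint c w σ ∈ K :=
    hcont.continuousAt.eventually (mem_interior_iff_mem_nhds.1 hi)
  obtain ⟨σ, h2, h3⟩ := ((h1.filter_mono nhdsWithin_le_nhds).and
    (self_mem_nhdsWithin : Ioi (topHeight K c w) ∈ 𝓝[>] _)).exists
  exact absurd (hS.le_topHeight hK hv h2) (not_le.2 h3)

lemma topHeight_nonneg {w : (ℝ ∙ v)ᗮ} (hw : verticalPoint c w 0 ∈ K) : 0 ≤ topHeight K c w :=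
  hS.le_topHeight hK hv hw

lemma topHeight_eq_zero {w : (ℝ ∙ v)ᗮ} (hw : verticalPoint c w 0 ∈ frontier K) :
    topHeight K c w = 0 := by
  have hwK : verticalPoint c w 0 ∈ K := hK.isCompact.isClosed.frontier_subset hw
  exact le_antisymm (hS.le_zero_of_mem_frontier hv hw (hS.verticalPoint_topHeight_mem hK hv hwK))
    (hS.topHeight_nonneg hK hv hwK)

lemma topHeight_pos {w : (ℝ ∙ v)ᗮ} (hw : verticalPoint c w 0 ∈ interior K) :
    0 < topHeight K c w := by
  refine lt_of_le_of_ne (hS.topHeight_nonneg hK hv (interior_subset hw)) fun h0 => ?_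
  have := hS.verticalPoint_topHeight_mem_frontier hK hv (interior_subset hw)
  rw [← h0] at this
  exact this.2 hw

/-- The upper half of the boundary is the graph of `topHeight`. -/
lemma topHeight_eq (hk : 1 ≤ k) {w : (ℝ ∙ v)ᗮ} {σ : ℝ} (hσ : 0 ≤ σ)
    (hw : verticalPoint c w σ ∈ frontier K) : topHeight K c w = σ := by
  have hwK := hK.isCompact.isClosed.frontier_subset hw
  have hw0 : verticalPoint c w 0 ∈ K := hS.verticalPoint_mem hv hwK (by simpa using hσ)
  refine le_antisymm ?_ (hS.le_topHeight hK hv hwK)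
  rcases hσ.eq_or_lt with rfl | hσ
  · exact (hS.topHeight_eq_zero hK hv hw).le
  by_contra! hlt
  obtain ⟨r, s, hs⟩ := hK.exists_isLocalDefining _ hw
  have hpos := hS.normal_pos _ hw (by rw [inner_verticalPoint hv]; linarith)
  rw [real_inner_comm] at hpos
  obtain ⟨ε, h1, h2⟩ := ((hs.eventually_notMem hk hpos).and
    (Ioo_mem_nhdsGT (sub_pos.2 hlt))).exists
  refine h1 ?_
  have := hS.verticalPoint_mem hv (τ := σ + ε) (hS.verticalPoint_topHeight_mem hK hv hw0)
    (by rw [abs_of_pos (by linarith [h2.1])]; linarith [h2.2])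
  convert this using 1
  rw [verticalPoint, verticalPoint]; module

/-- By the implicit function theorem, `topHeight` is as smooth as the boundary. -/
lemma contDiffAt_topHeight (hk : 1 ≤ k) {w : (ℝ ∙ v)ᗮ} (hw : verticalPoint c w 0 ∈ interior K) :
    ContDiffAt ℝ k (topHeight K c) w := by
  set σ := topHeight K c w with hσdef
  have hσ : 0 < σ := hS.topHeight_pos hK hv hw
  have hF := hS.verticalPoint_topHeight_mem_frontier hK hv (interior_subset hw)
  rw [← hσdef] at hF
  obtain ⟨r, s, hs⟩ := hK.exists_isLocalDefining _ hF
  have hpos := hS.normal_pos _ hF (by rw [inner_verticalPoint hv]; linarith)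
  rw [real_inner_comm] at hpos
  have hk0 : k ≠ 0 := (zero_lt_one.trans_le hk).ne'
  let F : (ℝ ∙ v)ᗮ × ℝ → ℝ := fun q => s (verticalPoint c q.1 q.2)
  have hFc : ContDiffAt ℝ k F (w, σ) :=
    ContDiffAt.comp (w, σ) (hs.contDiffAt hs.mem_self) (contDiff_verticalPoint c).contDiffAt
  have hd : HasDerivAt (fun τ => F (w, τ)) ⟪N (verticalPoint c w σ), v⟫_ℝ σ := by
    have h1 : HasDerivAt (fun τ : ℝ => s (verticalPoint c w σ + τ • v))
        ⟪N (verticalPoint c w σ), v⟫_ℝ (σ - σ) := by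
      rw [sub_self]
      exact hs.hasDerivAt_line hk v
    have h2 := h1.comp_sub_const σ σ
    refine h2.congr_of_eventuallyEq (Eventually.of_forall fun τ => ?_)
    change s (verticalPoint c w τ) = s (verticalPoint c w σ + (τ - σ) • v)
    rw [verticalPoint, verticalPoint, sub_smul]
    congr 1
    abel
  refine contDiffAt_of_implicit hk hFc hd hpos.ne' ?_
  have h1 : ∀ᶠ q : (ℝ ∙ v)ᗮ × ℝ in 𝓝 (w, σ), 0 < q.2 :=
    continuousAt_snd.eventually (Ioi_mem_nhds hσ)
  have h2 : ∀ᶠ q : (ℝ ∙ v)ᗮ × ℝ in 𝓝 (w, σ),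
      verticalPoint c q.1 q.2 ∈ ball (verticalPoint c w σ) r :=
    (continuous_verticalPoint c).continuousAt.eventually (isOpen_ball.mem_nhds hs.mem_self)
  filter_upwards [h1, h2] with q h3 h4 h5
  refine hS.topHeight_eq hK hv hk h3.le ?_
  rw [hs.mem_frontier_iff hK.isCompact.isClosed h4]
  exact h5.trans hs.zero

/-- On the plane of symmetry the normal is tangent to the plane, so that boundary points in this
plane are limits of interior points in it. -/
lemma closure_setOf_mem_interior (hk : 1 ≤ k) :
    closure {w : (ℝ ∙ v)ᗮ | verticalPoint c w 0 ∈ interior K} =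
      {w | verticalPoint c w 0 ∈ K} := by
  have hcont : Continuous fun w : (ℝ ∙ v)ᗮ => verticalPoint c w 0 :=
    (continuous_verticalPoint c).comp (by fun_prop : Continuous fun w : (ℝ ∙ v)ᗮ => (w, (0 : ℝ)))
  refine subset_antisymm (closure_minimal (fun w hw => interior_subset (s := K) hw)
    (hK.isCompact.isClosed.preimage hcont)) fun w hw => ?_
  by_cases hi : verticalPoint c w 0 ∈ interior K
  · exact subset_closure hi
  have hF : verticalPoint c w 0 ∈ frontier K := ⟨subset_closure hw, hi⟩
  obtain ⟨r, s, hs⟩ := hK.exists_isLocalDefining _ hF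
  set x := verticalPoint c w 0 with hx
  have hN := hS.normal_eq_zero _ hF (by rw [inner_verticalPoint hv]; ring)
  let N' : (ℝ ∙ v)ᗮ := ⟨N x, Submodule.mem_orthogonal_singleton_iff_inner_right.2 hN⟩
  have h1 := hs.eventually_mem_interior hk (w := -N x) (by
    rw [inner_neg_right, real_inner_self_eq_norm_sq, hs.norm_eq_one]; norm_num)
  have h2 : Tendsto (fun ε : ℝ => w + ε • (-N')) (𝓝[>] 0) (𝓝 w) := by
    have : ContinuousAt (fun ε : ℝ => w + ε • (-N')) 0 := by fun_prop
    simpa using this.tendsto.mono_left (nhdsWithin_le_nhds (s := Ioi 0))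
  refine mem_closure_of_tendsto h2 ?_
  filter_upwards [h1] with ε hε
  convert hε using 1
  simp [verticalPoint, hx, N']
  abel

/-- The shadow of the domain on the plane of symmetry is connected: its closure is the
projection of the boundary, and near each of its boundary points it is a connected subgraph. -/
lemma isPreconnected_setOf_mem_interior (hk : 1 ≤ k) (hc : IsPreconnected (frontier K)) :
    IsPreconnected {w : (ℝ ∙ v)ᗮ | verticalPoint c w 0 ∈ interior K} := by
  set Ω : Set (ℝ ∙ v)ᗮ := {w | verticalPoint c w 0 ∈ interior K} with hΩ
  have hcont : Continuous fun w : (ℝ ∙ v)ᗮ => verticalPoint c w 0 :=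
    (continuous_verticalPoint c).comp (by fun_prop : Continuous fun w : (ℝ ∙ v)ᗮ => (w, (0 : ℝ)))
  have hΩo : IsOpen Ω := isOpen_interior.preimage hcont
  have hcl : closure Ω = orthogonalPart hv '' frontier K := by
    rw [hS.closure_setOf_mem_interior hK hv hk]
    refine subset_antisymm (fun w hw => ?_) ?_
    · exact ⟨_, hS.verticalPoint_topHeight_mem_frontier hK hv hw,
        orthogonalPart_verticalPoint hv c w _⟩
    · rintro _ ⟨x, hx, rfl⟩
      exact hS.verticalPoint_zero_mem hv (hK.isCompact.isClosed.frontier_subset hx)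
  have hclp : IsPreconnected (closure Ω) := by
    rw [hcl]; exact hc.image _ (continuous_orthogonalPart hv).continuousOn
  intro A B hA hB hcov hAne hBne
  obtain ⟨w, -, hwA, hwB⟩ := isPreconnected_closed_iff.1 hclp (closure (Ω ∩ A)) (closure (Ω ∩ B))
    isClosed_closure isClosed_closure (by
      rw [← closure_union]
      exact closure_mono fun z hz => (hcov hz).imp (fun h => ⟨hz, h⟩) (fun h => ⟨hz, h⟩))
    (hAne.mono fun z hz => ⟨subset_closure hz.1, subset_closure hz⟩)
    (hBne.mono fun z hz => ⟨subset_closure hz.1, subset_closure hz⟩)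
  by_cases hw : w ∈ Ω
  · rcases hcov hw with hw' | hw'
    · obtain ⟨z, hz1, hz2⟩ := mem_closure_iff.1 hwB A hA hw'
      exact ⟨z, hz2.1, hz1, hz2.2⟩
    · obtain ⟨z, hz1, hz2⟩ := mem_closure_iff.1 hwA B hB hw'
      exact ⟨z, hz2.1, hz2.2, hz1⟩
  have hwK : verticalPoint c w 0 ∈ K := by
    have : w ∈ closure Ω := closure_mono inter_subset_left hwA
    rwa [hS.closure_setOf_mem_interior hK hv hk] at this
  have hF : verticalPoint c w 0 ∈ frontier K := ⟨subset_closure hwK, hw⟩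
  obtain ⟨r, s, hs⟩ := hK.exists_isLocalDefining _ hF
  have hN := hS.normal_eq_zero _ hF (by rw [inner_verticalPoint hv]; ring)
  let N' : (ℝ ∙ v)ᗮ := ⟨N (verticalPoint c w 0),
    Submodule.mem_orthogonal_singleton_iff_inner_right.2 hN⟩
  have hN1 : ‖N (verticalPoint c w 0)‖ = 1 := hs.norm_eq_one
  have hr := hs.pos
  obtain ⟨δ, hδ, hball⟩ := Metric.eventually_nhds_iff_ball.1
    ((hs.contDiffAt hs.mem_self).continuousAt.eventually
      (Iio_mem_nhds (show s (verticalPoint c w 0) < r / 2 by rw [hs.zero]; positivity)))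
  have hdist : ∀ y z : (ℝ ∙ v)ᗮ, dist (verticalPoint c y 0) (verticalPoint c z 0) = dist y z := by
    intro y z
    simp [verticalPoint, Subtype.dist_eq]
  have hsub : ∀ z : (ℝ ∙ v)ᗮ, ∀ τ : ℝ, verticalPoint c (z - τ • N') 0 =
      verticalPoint c z 0 + (-τ) • N (verticalPoint c w 0) := by
    intro z τ
    simp [verticalPoint, N']
    abel
  -- points over a small ball stay in `Ω` when they are moved along the inner normal
  set ρ := min δ (r / 2) with hρ
  have hρ0 : 0 < ρ := lt_min hδ (by positivity)
  have key : ∀ z ∈ ball w ρ, ∀ τ ∈ Icc (0 : ℝ) (r / 2), s (verticalPoint c z 0) < τ →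
      z - τ • N' ∈ Ω := by
    intro z hz τ hτ hlt
    have hz1 : dist (verticalPoint c z 0) (verticalPoint c w 0) < ρ := by rw [hdist]; exact hz
    have hzr : verticalPoint c z 0 ∈ ball (verticalPoint c w 0) r := by
      rw [mem_ball]; exact hz1.trans_le ((min_le_right _ _).trans (by linarith))
    have hzr' : verticalPoint c z 0 + (-τ) • N (verticalPoint c w 0) ∈
        ball (verticalPoint c w 0) r := by
      rw [mem_ball]
      have h1 : dist (verticalPoint c z 0 + (-τ) • N (verticalPoint c w 0))
          (verticalPoint c z 0) = τ := by
        rw [dist_self_add_left, norm_smul, hN1, mul_one, norm_neg, Real.norm_of_nonneg hτ.1]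
      have h2 := dist_triangle (verticalPoint c z 0 + (-τ) • N (verticalPoint c w 0))
        (verticalPoint c z 0) (verticalPoint c w 0)
      have h3 : ρ ≤ r / 2 := min_le_right _ _
      linarith [hτ.2]
    rw [hΩ, mem_ofPred_eq, hsub, hs.mem_interior_iff hzr', hs.translate _ hzr _ hzr']
    linarith
  obtain ⟨a, ha, haw⟩ := Metric.mem_closure_iff.1 hwA ρ hρ0
  obtain ⟨b, hb, hbw⟩ := Metric.mem_closure_iff.1 hwB ρ hρ0
  rw [dist_comm] at haw hbw
  -- connect `a` to `b` in `Ω` by moving inwards, across, and back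
  have hvert : ∀ y ∈ ball w ρ, y ∈ Ω → segment ℝ y (y - (r / 2) • N') ⊆ Ω := by
    intro y hy hyΩ z hz
    rw [segment_eq_image'] at hz
    obtain ⟨θ, hθ, rfl⟩ := hz
    have e : y + θ • (y - (r / 2) • N' - y) = y - (θ * (r / 2)) • N' := by
      module
    have hyr : verticalPoint c y 0 ∈ ball (verticalPoint c w 0) r := by
      rw [mem_ball, hdist]; exact (mem_ball.1 hy).trans_le ((min_le_right _ _).trans (by linarith))
    have hneg := (hs.mem_interior_iff hyr).1 hyΩ
    simp only [e]
    have h0 : 0 ≤ θ * (r / 2) := mul_nonneg hθ.1 (by positivity)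
    exact key y hy _ ⟨h0, by nlinarith [hθ.2]⟩ (by linarith)
  have hhor : segment ℝ (a - (r / 2) • N') (b - (r / 2) • N') ⊆ Ω := by
    intro z hz
    rw [segment_eq_image'] at hz
    obtain ⟨θ, hθ, rfl⟩ := hz
    have e : a - (r / 2) • N' + θ • (b - (r / 2) • N' - (a - (r / 2) • N')) =
        (a + θ • (b - a)) - (r / 2) • N' := by
      module
    simp only [e]
    have hm : a + θ • (b - a) ∈ ball w ρ := by
      refine (convex_ball w ρ).segment_subset (x := a) (y := b) haw hbw ?_
      rw [segment_eq_image']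
      exact ⟨θ, hθ, rfl⟩
    refine key _ hm _ ⟨by positivity, le_rfl⟩ (hball _ ?_)
    rw [mem_ball, hdist]
    exact (mem_ball.1 hm).trans_le (min_le_left _ _)
  have hpre : ∀ y z : (ℝ ∙ v)ᗮ, IsPreconnected (segment ℝ y z) := fun y z =>
    (convex_segment y z).isPreconnected
  have hpc := ((hpre a (a - (r / 2) • N')).union _ (right_mem_segment ℝ _ _)
    (left_mem_segment ℝ _ _) (hpre _ (b - (r / 2) • N'))).union _
    (mem_union_right _ (right_mem_segment ℝ _ _)) (right_mem_segment ℝ b _)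
    (hpre b (b - (r / 2) • N'))
  have hsubset : (segment ℝ a (a - (r / 2) • N') ∪
      segment ℝ (a - (r / 2) • N') (b - (r / 2) • N')) ∪ segment ℝ b (b - (r / 2) • N') ⊆ Ω :=
    union_subset (union_subset (hvert a haw ha.1) hhor) (hvert b hbw hb.1)
  obtain ⟨z, hz, hzAB⟩ := hpc A B hA hB (hsubset.trans hcov)
    ⟨a, Or.inl (Or.inl (left_mem_segment ℝ _ _)), ha.2⟩ ⟨b, Or.inr (left_mem_segment ℝ _ _), hb.2⟩
  exact ⟨z, hsubset hz, hzAB⟩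

omit hK in
/-- The profile function of the bi-graph is `topHeight`, defined over the slice of the interior of
`K` by the plane of symmetry. -/
theorem isSymmetricBigraph {k : ℕ∞} (hK : IsPrescribedDomain k h K N) (hk : 1 ≤ k)
    (hc : IsPreconnected (frontier K)) : IsSymmetricBigraph k (frontier K) v c := by
  have hk' : (1 : WithTop ℕ∞) ≤ k := by exact_mod_cast hk
  set Ω : Set (ℝ ∙ v)ᗮ := {w | verticalPoint c w 0 ∈ interior K} with hΩ
  have hcont : Continuous fun w : (ℝ ∙ v)ᗮ => verticalPoint c w 0 :=
    (continuous_verticalPoint c).comp (by fun_prop : Continuous fun w : (ℝ ∙ v)ᗮ => (w, (0 : ℝ)))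
  have hΩo : IsOpen Ω := isOpen_interior.preimage hcont
  have hcl := hS.closure_setOf_mem_interior hK hv hk'
  have hfr : ∀ w ∈ frontier Ω, verticalPoint c w 0 ∈ frontier K := by
    intro w hw
    rw [hΩo.frontier_eq, hcl] at hw
    exact ⟨subset_closure hw.1, hw.2⟩
  refine ⟨fun x hx => hS.frontier_symm hv hx, Ω, topHeight K c, hΩo, ⟨?_, ?_⟩, fun w hw => ?_,
    fun w hw => ?_, fun w hw => hS.topHeight_pos hK hv hw,
    fun w hw => hS.topHeight_eq_zero hK hv (hfr w hw), ?_⟩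
  · obtain ⟨x, hx⟩ := hK.nonempty
    refine closure_nonempty_iff.1 ⟨orthogonalPart hv x, ?_⟩
    rw [hcl]; exact hS.verticalPoint_zero_mem hv hx
  · exact hS.isPreconnected_setOf_mem_interior hK hv hk' hc
  · exact (hS.contDiffAt_topHeight hK hv hk' hw).contDiffWithinAt
  · by_cases hwΩ : w ∈ Ω
    · exact (hS.contDiffAt_topHeight hK hv hk' hwΩ).continuousAt.continuousWithinAt
    · have hwF : verticalPoint c w 0 ∈ frontier K :=
        hfr w (by rw [hΩo.frontier_eq]; exact ⟨hw, hwΩ⟩)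
      rw [Metric.continuousWithinAt_iff']
      intro ε hε
      -- the point at height `ε / 2` over `w`, hence over all nearby points, lies outside `K`
      have h1 : verticalPoint c w (ε / 2) ∉ K := fun hmem => by
        have := hS.le_zero_of_mem_frontier hv hwF hmem
        linarith
      have h2 : Continuous fun w : (ℝ ∙ v)ᗮ => verticalPoint c w (ε / 2) :=
        (continuous_verticalPoint c).comp
          (by fun_prop : Continuous fun w : (ℝ ∙ v)ᗮ => (w, ε / 2))
      have h3 := h2.continuousAt.eventually (hK.isCompact.isClosed.isOpen_compl.mem_nhds h1)
      filter_upwards [h3.filter_mono nhdsWithin_le_nhds, self_mem_nhdsWithin] with y hy hyc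
      rw [hcl] at hyc
      have h4 := hS.topHeight_nonneg hK hv hyc
      rw [hS.topHeight_eq_zero hK hv hwF, Real.dist_eq, sub_zero, abs_of_nonneg h4]
      by_contra! hle
      refine hy (hS.verticalPoint_mem hv (hS.verticalPoint_topHeight_mem hK hv hyc) ?_)
      rw [abs_of_pos (by positivity)]; linarith
  · ext x
    simp only [mem_inter_iff, mem_ofPred_eq, mem_image]
    rw [hcl]
    constructor
    · rintro ⟨hx, hxc⟩
      refine ⟨orthogonalPart hv x,
        hS.verticalPoint_zero_mem hv (hK.isCompact.isClosed.frontier_subset hx), ?_⟩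
      rw [hS.topHeight_eq hK hv hk' (sub_nonneg.2 hxc) (by rwa [verticalPoint_orthogonalPart])]
      exact verticalPoint_orthogonalPart hv c x
    · rintro ⟨w, hw, rfl⟩
      refine ⟨hS.verticalPoint_topHeight_mem_frontier hK hv hw, ?_⟩
      change c ≤ ⟪v, verticalPoint c w (topHeight K c w)⟫_ℝ
      rw [inner_verticalPoint hv]
      linarith [hS.topHeight_nonneg hK hv hw]

end IsSymmetryHeight

end Bigraph

/-! ### The mean curvature equation -/

section TraceLemmas

variable {E : Type*} [NormedAddCommGroup E] [InnerProductSpace ℝ E] [FiniteDimensional ℝ E]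
  [CompleteSpace E]

/-- If `T` intertwines `A` with `B` and `B` takes values in the range of the injective map `T`,
then `A` and `B` have the same trace. -/
lemma trace_eq_of_intertwine {V : Type*} [AddCommGroup V] [Module ℝ V] [FiniteDimensional ℝ V]
    {T : V →ₗ[ℝ] E} (hT : Function.Injective T) {A : V →ₗ[ℝ] V} {B : E →ₗ[ℝ] E}
    (h : ∀ w, T (A w) = B (T w)) (hB : ∀ u, B u ∈ LinearMap.range T) :
    LinearMap.trace ℝ E B = LinearMap.trace ℝ V A := by
  obtain ⟨S, hS⟩ := LinearMap.exists_leftInverse_of_injective T (LinearMap.ker_eq_bot.2 hT)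
  have hS' : ∀ w, S (T w) = w := fun w => LinearMap.congr_fun hS w
  have h1 : B = T ∘ₗ (S ∘ₗ B) := by
    ext u
    obtain ⟨w, hw⟩ := hB u
    simp [← hw, hS']
  have h2 : A = (S ∘ₗ B) ∘ₗ T := by
    ext w
    simp [← h, hS']
  rw [h1, LinearMap.trace_comp_comm', ← h2]

/-- The derivative of the normalization of a vector field. -/
lemma hasFDerivAt_normalize {p : E → E} {X : E →L[ℝ] E} {z : E} (hp : HasFDerivAt p X z)
    (h0 : p z ≠ 0) : HasFDerivAt (fun y => ‖p y‖⁻¹ • p y)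
      (‖p z‖⁻¹ • X - (innerSL ℝ ((‖p z‖ ^ 3)⁻¹ • p z) ∘L X).smulRight (p z)) z := by
  have hn0 : ‖p z‖ ≠ 0 := norm_ne_zero_iff.2 h0
  have h1 : HasFDerivAt (fun y => ‖p y‖ ^ 2) (2 • (innerSL ℝ (p z) ∘L X)) z := by
    simpa using hp.norm_sq
  have h2 : HasFDerivAt (fun y => ‖p y‖) (‖p z‖⁻¹ • (innerSL ℝ (p z) ∘L X)) z := by
    have h3 := (h1.sqrt (by positivity))
    simp only [Real.sqrt_sq (norm_nonneg _)] at h3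
    refine h3.congr_fderiv ?_
    ext w
    simp
    field_simp
  have h3 := (hasDerivAt_inv hn0).comp_hasFDerivAt z h2
  refine (h3.smul hp).congr_fderiv ?_
  ext w
  simp [smul_smul]
  rw [sub_eq_add_neg, ← neg_smul]
  congr 2
  field_simp
  simp

lemma trace_fderiv_normalize {p : E → E} {X : E →L[ℝ] E} {z : E} (hp : HasFDerivAt p X z)
    (h0 : p z ≠ 0) : LinearMap.trace ℝ E (fderiv ℝ (fun y => ‖p y‖⁻¹ • p y) z).toLinearMap =
      ‖p z‖⁻¹ * tangentialTrace (p z) X := by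
  have hn0 : ‖p z‖ ≠ 0 := norm_ne_zero_iff.2 h0
  rw [(hasFDerivAt_normalize hp h0).fderiv]
  have : (‖p z‖⁻¹ • X - (innerSL ℝ ((‖p z‖ ^ 3)⁻¹ • p z) ∘L X).smulRight (p z)).toLinearMap =
      ‖p z‖⁻¹ • X.toLinearMap -
        (innerSL ℝ ((‖p z‖ ^ 3)⁻¹ • p z) ∘L X).toLinearMap.smulRight (p z) := by
    ext w; simp
  rw [this, map_sub, map_smul, LinearMap.trace_smulRight, tangentialTrace]
  simp
  field_simp

lemma inner_fderiv_normalize {p : E → E} {X : E →L[ℝ] E} {z : E} (hp : HasFDerivAt p X z)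
    (h0 : p z ≠ 0) (w : E) : ⟪p z, fderiv ℝ (fun y => ‖p y‖⁻¹ • p y) z w⟫_ℝ = 0 := by
  have hn0 : ‖p z‖ ≠ 0 := norm_ne_zero_iff.2 h0
  rw [(hasFDerivAt_normalize hp h0).fderiv]
  simp [inner_smul_right, inner_sub_right]
  field_simp
  simp

end TraceLemmas

section Prescription

variable {n : ℕ}

lemma ContMDiff.codRestrict_euclideanSphere {F H M : Type*} [NormedAddCommGroup F]
    [NormedSpace ℝ F] [TopologicalSpace H] {I : ModelWithCorners ℝ F H} [TopologicalSpace M]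
    [ChartedSpace H M] {m : WithTop ℕ∞} [IsManifold I m M]
    {f : M → EuclideanSpace ℝ (Fin (n + 1))}
    (hf : ContMDiff I 𝓘(ℝ, EuclideanSpace ℝ (Fin (n + 1))) m f)
    (hf' : ∀ x, f x ∈ sphere (0 : EuclideanSpace ℝ (Fin (n + 1))) 1) :
    ContMDiff I (𝓡 n) m (codRestrict f _ hf') :=
  have : Fact (Module.finrank ℝ (EuclideanSpace ℝ (Fin (n + 1))) = n + 1) :=
    ⟨finrank_euclideanSpace_fin⟩
  ContMDiff.codRestrict_sphere hf hf'

/-- The right-hand side of the mean curvature equation in terms of a (nonzero) gradient vector `p`,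
whose direction is the unit normal: `-n ‖p‖ ℋ(p / ‖p‖)`. The sign is that of the shape operator
`-dη`; the value at `p = 0` is irrelevant. -/
noncomputable def prescribedTrace (ℋ : sphere (0 : EuclideanSpace ℝ (Fin (n + 1))) 1 → ℝ)
    (p : EuclideanSpace ℝ (Fin (n + 1))) : ℝ :=
  if hp : p ≠ 0 then
    -(n * ‖p‖ * ℋ ⟨‖p‖⁻¹ • p, by simp [norm_smul, norm_ne_zero_iff.2 hp]⟩) else 0

variable {ℋ : sphere (0 : EuclideanSpace ℝ (Fin (n + 1))) 1 → ℝ}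

lemma prescribedTrace_eq {p : EuclideanSpace ℝ (Fin (n + 1))}
    {x : sphere (0 : EuclideanSpace ℝ (Fin (n + 1))) 1} (hp : p ≠ 0)
    (hx : (x : EuclideanSpace ℝ (Fin (n + 1))) = ‖p‖⁻¹ • p) :
    prescribedTrace ℋ p = -(n * ‖p‖ * ℋ x) := by
  rw [prescribedTrace, dif_pos hp]
  congr 3
  exact Subtype.ext hx.symm

lemma contDiffAt_prescribedTrace (hℋ : ContMDiff (𝓡 n) 𝓘(ℝ, ℝ) 1 ℋ)
    {p₀ : EuclideanSpace ℝ (Fin (n + 1))} (hp₀ : ‖p₀‖ = 1) :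
    ContDiffAt ℝ 1 (prescribedTrace ℋ) p₀ := by
  -- a smooth map without zeros that agrees with the identity near `p₀`
  let b : ContDiffBump p₀ := ⟨1 / 4, 1 / 2, by norm_num, by norm_num⟩
  let f : EuclideanSpace ℝ (Fin (n + 1)) → EuclideanSpace ℝ (Fin (n + 1)) :=
    fun p => p₀ + b p • (p - p₀)
  have hf0 : ∀ p, f p ≠ 0 := by
    intro p hp
    have h1 : ‖b p • (p - p₀)‖ < 1 := by
      rw [norm_smul, Real.norm_of_nonneg b.nonneg]
      by_cases hd : dist p p₀ < 1 / 2
      · have h2 := b.le_one (x := p)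
        have h3 := b.nonneg (x := p)
        rw [dist_eq_norm] at hd
        nlinarith [norm_nonneg (p - p₀)]
      · rw [b.zero_of_le_dist (not_lt.1 hd)]; simp
    have h2 : b p • (p - p₀) = -p₀ := by
      have : p₀ + b p • (p - p₀) = 0 := hp
      exact (neg_eq_of_add_eq_zero_right this).symm
    rw [h2, norm_neg, hp₀] at h1
    exact lt_irrefl _ h1
  have hfc : ContDiff ℝ 1 f := contDiff_const.add (b.contDiff.smul (contDiff_id.sub contDiff_const))
  have hg : ContDiff ℝ 1 fun p => ‖f p‖⁻¹ • f p :=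
    ((hfc.norm ℝ hf0).inv fun p => norm_ne_zero_iff.2 (hf0 p)).smul hfc
  have hmem : ∀ p, ‖f p‖⁻¹ • f p ∈ sphere (0 : EuclideanSpace ℝ (Fin (n + 1))) 1 := fun p => by
    simp [norm_smul, norm_ne_zero_iff.2 (hf0 p)]
  have h1 := hℋ.comp (hg.contMDiff.codRestrict_euclideanSphere hmem)
  rw [contMDiff_iff_contDiff] at h1
  have h2 : ContDiffAt ℝ 1 (fun p => -(n * ‖f p‖ *
      (ℋ ∘ codRestrict (fun p => ‖f p‖⁻¹ • f p) (sphere 0 1) hmem) p)) p₀ :=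
    ((contDiff_const.mul (hfc.norm ℝ hf0)).mul h1).neg.contDiffAt
  refine h2.congr_of_eventuallyEq ?_
  filter_upwards [ball_mem_nhds p₀ (show (0 : ℝ) < 1 / 4 by norm_num)] with p hp
  have hfp : f p = p := by
    have : b p = 1 := b.one_of_mem_closedBall (ball_subset_closedBall hp)
    simp [f, this]
  have hp0 : p ≠ 0 := hfp ▸ hf0 p
  rw [prescribedTrace_eq hp0 (x := codRestrict (fun p => ‖f p‖⁻¹ • f p) (sphere 0 1) hmem p)
    (by simp [hfp]), hfp]
  rfl

end Prescription

/-! ### Embedded hypersurfaces as zero sets -/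

section GraphCoordinates

variable {V E : Type*} [NormedAddCommGroup V] [NormedSpace ℝ V] [FiniteDimensional ℝ V]
  [NormedAddCommGroup E] [InnerProductSpace ℝ E] [FiniteDimensional ℝ E] [CompleteSpace E]

/-- The map `(a, τ) ↦ g a + τ N₀` is a local diffeomorphism; its inverse straightens the
hypersurface parametrized by `g`. -/
lemma exists_isGraph_of_immersion {k : WithTop ℕ∞} (hk : 1 ≤ k) {g : V → E} {a₀ : V} {T : Set V}
    (hT : IsOpen T) (ha₀ : a₀ ∈ T) (hg : ContDiffOn ℝ k g T)
    (hinj : Function.Injective (fderiv ℝ g a₀))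
    (hfin : Module.finrank ℝ E = Module.finrank ℝ V + 1) {N₀ : E} (hN : ‖N₀‖ = 1)
    (hperp : ∀ w, ⟪N₀, fderiv ℝ g a₀ w⟫_ℝ = 0) :
    ∃ (r : ℝ) (s : E → ℝ) (a : E → V), IsGraph k N₀ (g a₀) r s ∧
      (∀ z ∈ ball (g a₀) r, ContDiffAt ℝ k a z ∧ a z ∈ T ∧ g (a z) + s z • N₀ = z) ∧
      ∀ᶠ b in 𝓝 a₀, a (g b) = b ∧ s (g b) = 0 := by
  have hk0 : k ≠ 0 := (zero_lt_one.trans_le hk).ne'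
  have : CompleteSpace V := FiniteDimensional.complete ℝ V
  let D := fderiv ℝ g a₀
  let Θ : V × ℝ → E := fun q => g q.1 + q.2 • N₀
  have hΘ : ∀ q : V × ℝ, q.1 ∈ T → ContDiffAt ℝ k Θ q := fun q hq =>
    ((hg.contDiffAt (hT.mem_nhds hq)).comp q contDiffAt_fst).add
      (contDiffAt_snd.smul contDiffAt_const)
  let L : V × ℝ →L[ℝ] E :=
    D.comp (ContinuousLinearMap.fst ℝ V ℝ) + (ContinuousLinearMap.snd ℝ V ℝ).smulRight N₀
  have hLinj : Function.Injective L := by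
    rw [injective_iff_map_eq_zero]
    rintro ⟨w, τ⟩ h
    have h1 : D w + τ • N₀ = 0 := by simpa [L] using h
    have h2 : τ = 0 := by
      have := congrArg (fun x => ⟪N₀, x⟫_ℝ) h1
      have h3 : ⟪N₀, D w⟫_ℝ = 0 := hperp w
      simpa [inner_add_right, inner_smul_right, h3, real_inner_self_eq_norm_sq, hN] using this
    have h3 : w = 0 := by
      rw [h2, zero_smul, add_zero] at h1
      exact (injective_iff_map_eq_zero D).1 hinj w h1
    simp [h2, h3]
  let L' : (V × ℝ) ≃L[ℝ] E := (LinearMap.linearEquivOfInjective (L : V × ℝ →ₗ[ℝ] E) hLinj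
    (by rw [hfin]; simp)).toContinuousLinearEquiv
  have hL' : (L' : V × ℝ →L[ℝ] E) = L := by ext <;> simp [L']
  have hLd : HasFDerivAt Θ L (a₀, 0) := by
    have h1 : HasFDerivAt g D a₀ :=
      ((hg.contDiffAt (hT.mem_nhds ha₀)).differentiableAt hk0).hasFDerivAt
    have h2 : HasFDerivAt (fun q : V × ℝ => g q.1) (D.comp (ContinuousLinearMap.fst ℝ V ℝ))
        (a₀, 0) :=
      HasFDerivAt.comp (g := g) (a₀, (0 : ℝ)) h1 hasFDerivAt_fst
    exact h2.add (hasFDerivAt_snd.smul_const N₀)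
  have hstrict : HasStrictFDerivAt Θ (L' : V × ℝ →L[ℝ] E) (a₀, 0) := by
    rw [hL']
    exact (hΘ (a₀, 0) ha₀).hasStrictFDerivAt' hLd hk0
  let H : OpenPartialHomeomorph (V × ℝ) E := hstrict.toOpenPartialHomeomorph Θ
  have hHc : (H : V × ℝ → E) = Θ := hstrict.toOpenPartialHomeomorph_coe
  have hsrc : ((a₀, 0) : V × ℝ) ∈ H.source := hstrict.mem_toOpenPartialHomeomorph_source
  have hH0 : H (a₀, 0) = g a₀ := by simp [hHc, Θ]
  have htgt : g a₀ ∈ H.target := hH0 ▸ H.map_source hsrc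
  have hsymm0 : H.symm (g a₀) = (a₀, 0) := by rw [← hH0, H.left_inv hsrc]
  -- near `(a₀, 0)` the derivative of `Θ` stays invertible
  have hgood : ∀ᶠ q in 𝓝 ((a₀, 0) : V × ℝ), q ∈ H.source ∧ q.1 ∈ T ∧
      ∃ e : (V × ℝ) ≃L[ℝ] E, (e : V × ℝ →L[ℝ] E) = fderiv ℝ Θ q := by
    have h1 : ContinuousAt (fderiv ℝ Θ) ((a₀, 0) : V × ℝ) :=
      ((hΘ (a₀, 0) ha₀).fderiv_right (m := 0) (by simpa using hk)).continuousAt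
    have h2 : range ((↑) : ((V × ℝ) ≃L[ℝ] E) → (V × ℝ →L[ℝ] E)) ∈ 𝓝 (fderiv ℝ Θ (a₀, 0)) := by
      rw [hLd.fderiv, ← hL']
      exact ContinuousLinearEquiv.nhds L'
    filter_upwards [H.open_source.mem_nhds hsrc, continuousAt_fst.eventually (hT.mem_nhds ha₀),
      h1.eventually h2] with q h3 h4 h5
    exact ⟨h3, h4, h5⟩
  obtain ⟨ρ, hρ, hball⟩ := Metric.eventually_nhds_iff_ball.1 hgood
  have hcont : ContinuousAt H.symm (g a₀) := H.continuousAt_symm htgt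
  have hnear : ∀ᶠ z in 𝓝 (g a₀), z ∈ H.target ∧ H.symm z ∈ ball ((a₀, 0) : V × ℝ) (ρ / 2) :=
    Filter.Eventually.and (H.open_target.mem_nhds htgt)
      (hcont.eventually (hsymm0 ▸ ball_mem_nhds _ (half_pos hρ)))
  obtain ⟨r₀, hr₀, hr₀b⟩ := Metric.eventually_nhds_iff_ball.1 hnear
  let r := min r₀ (ρ / 4)
  have hr : 0 < r := lt_min hr₀ (by positivity)
  have hz : ∀ z ∈ ball (g a₀) r, z ∈ H.target ∧ H.symm z ∈ ball ((a₀, 0) : V × ℝ) (ρ / 2) :=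
    fun z hz => hr₀b z (ball_subset_ball (min_le_left _ _) hz)
  have hsm : ∀ z ∈ ball (g a₀) r, ContDiffAt ℝ k H.symm z := by
    intro z hzb
    obtain ⟨h1, h2⟩ := hz z hzb
    obtain ⟨-, h4, e, he⟩ := hball _ (ball_subset_ball (half_le_self hρ.le) h2)
    refine H.contDiffAt_symm (f₀' := e) h1 ?_ (by rw [hHc]; exact hΘ _ h4)
    rw [hHc, he]
    exact ((hΘ _ h4).differentiableAt hk0).hasFDerivAt
  have hinv : ∀ z ∈ ball (g a₀) r, g (H.symm z).1 + (H.symm z).2 • N₀ = z := by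
    intro z hzb
    have := H.right_inv (hz z hzb).1
    rwa [hHc] at this
  refine ⟨r, fun z => (H.symm z).2, fun z => (H.symm z).1, ⟨hN, hr, ?_, ?_, ?_, ?_⟩, ?_, ?_⟩
  · exact fun z hz => (hsm z hz).snd.contDiffWithinAt
  · simp [hsymm0]
  · intro z hzb τ hτ
    have h1 := (hz z hzb).2
    have hτs : |τ| < ρ / 2 := by
      have h2 : ‖τ • N₀‖ < r + r := by
        calc ‖τ • N₀‖ = dist (z + τ • N₀) z := by simp [dist_eq_norm]
          _ ≤ dist (z + τ • N₀) (g a₀) + dist (g a₀) z := dist_triangle _ _ _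
          _ < r + r := by
            rw [dist_comm (g a₀)]
            exact add_lt_add hτ hzb
      rw [norm_smul, hN, mul_one, Real.norm_eq_abs] at h2
      have : r ≤ ρ / 4 := min_le_right _ _
      linarith
    have h3 : ((H.symm z).1, (H.symm z).2 + τ) ∈ ball ((a₀, 0) : V × ℝ) ρ := by
      rw [mem_ball, Prod.dist_eq, max_lt_iff] at h1 ⊢
      refine ⟨h1.1.trans (half_lt_self hρ), ?_⟩
      have h4 := h1.2
      simp only [Real.dist_eq, sub_zero] at h4 ⊢
      exact (abs_add_le _ _).trans_lt (by linarith)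
    have h4 := H.left_inv (hball _ h3).1
    have h5 : H ((H.symm z).1, (H.symm z).2 + τ) = z + τ • N₀ := by
      rw [hHc]
      simp only [Θ, add_smul, ← add_assoc, hinv z hzb]
    rw [h5] at h4
    simp [h4]
  · have h1 : HasFDerivAt H.symm (L'.symm : E →L[ℝ] V × ℝ) (g a₀) := by
      refine H.hasFDerivAt_symm htgt ?_
      rw [hsymm0, hHc, hL']
      exact hLd
    have h2 : HasGradientAt (fun z => (H.symm z).2) N₀ (g a₀) := by
      rw [hasGradientAt_iff_hasFDerivAt]
      refine h1.snd.congr_fderiv ?_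
      ext z
      obtain ⟨⟨w, τ⟩, rfl⟩ := L'.surjective z
      have h3 : L' (w, τ) = D w + τ • N₀ := by
        have := congrArg (fun l : V × ℝ →L[ℝ] E => l (w, τ)) hL'
        simpa [L] using this
      have h4 : ⟪N₀, D w⟫_ℝ = 0 := hperp w
      have h5 : ⟪N₀, L' (w, τ)⟫_ℝ = τ := by
        rw [h3]; simp [inner_add_right, inner_smul_right, h4, hN]
      simp [h5]
    exact h2.gradient
  · intro z hzb
    exact ⟨(hsm z hzb).fst, (hball _ (ball_subset_ball (half_le_self hρ.le) (hz z hzb).2)).2.1,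
      hinv z hzb⟩
  · have h1 : ContinuousAt (fun b : V => (b, (0 : ℝ))) a₀ := by fun_prop
    filter_upwards [h1.eventually (H.open_source.mem_nhds hsrc)] with b hb
    have h2 := H.left_inv hb
    have h3 : H (b, 0) = g b := by simp [hHc, Θ]
    rw [h3] at h2
    simp [h2]

end GraphCoordinates

section Embedding

variable {n : ℕ} {M : Type*} [TopologicalSpace M] [ChartedSpace (EuclideanSpace ℝ (Fin n)) M]

lemma mvfderiv_comp_eq {E F : Type*} [NormedAddCommGroup E] [NormedSpace ℝ E]
    [NormedAddCommGroup F] [NormedSpace ℝ F] {f : E → F} {φ : M → E} {q : M}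
    (hf : DifferentiableAt ℝ f (φ q)) (hφ : MDifferentiableAt (𝓡 n) 𝓘(ℝ, E) φ q)
    (w : TangentSpace (𝓡 n) q) :
    mvfderiv (𝓡 n) (fun q => f (φ q)) q w = fderiv ℝ f (φ q) (mvfderiv (𝓡 n) φ q w) := by
  have h := mfderiv_comp_apply q hf.mdifferentiableAt hφ w
  rw [mfderiv_eq_fderiv] at h
  exact h

lemma mvfderiv_eq_fderiv {E : Type*} [NormedAddCommGroup E] [NormedSpace ℝ E] {φ : M → E} {q : M}
    (hφ : MDifferentiableAt (𝓡 n) 𝓘(ℝ, E) φ q) (w : EuclideanSpace ℝ (Fin n)) :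
    mvfderiv (𝓡 n) φ q w =
      fderiv ℝ (φ ∘ (extChartAt (𝓡 n) q).symm) (extChartAt (𝓡 n) q q) w := by
  have h := hφ.mvfderiv
  rw [ModelWithCorners.range_eq_univ, fderivWithin_univ] at h
  exact congrArg (fun l : EuclideanSpace ℝ (Fin n) →L[ℝ] E => l w) h

variable {k : ℕ∞} {ψ : M → EuclideanSpace ℝ (Fin (n + 1))}

/-- Near each of its points, an embedded hypersurface is the zero set of a function `s` as in
`IsGraph`, and the parametrization `ψ` has a local left inverse `χ` of class `C^k` that is defined
on a neighbourhood in the ambient space. -/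
lemma IsEmbeddedHypersurface.exists_isGraph [IsManifold (𝓡 n) k M]
    (hψ : IsEmbeddedHypersurface k ψ) (hk : 1 ≤ k) (p : M)
    {N₀ : EuclideanSpace ℝ (Fin (n + 1))} (hN : ‖N₀‖ = 1)
    (hperp : ∀ w : TangentSpace (𝓡 n) p, ⟪N₀, mvfderiv (𝓡 n) ψ p w⟫_ℝ = 0) :
    ∃ (r : ℝ) (s : EuclideanSpace ℝ (Fin (n + 1)) → ℝ) (χ : EuclideanSpace ℝ (Fin (n + 1)) → M),
      IsGraph k N₀ (ψ p) r s ∧ (∀ z ∈ ball (ψ p) r, z ∈ range ψ ↔ s z = 0) ∧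
      (∀ z ∈ ball (ψ p) r, ContMDiffAt 𝓘(ℝ, EuclideanSpace ℝ (Fin (n + 1))) (𝓡 n) k χ z) ∧
      ∀ q, ψ q ∈ ball (ψ p) r → χ (ψ q) = q := by
  have hk' : (1 : WithTop ℕ∞) ≤ k := by exact_mod_cast hk
  have hk0 : (k : WithTop ℕ∞) ≠ 0 := (zero_lt_one.trans_le hk').ne'
  let φ := extChartAt (𝓡 n) p
  have hd : ∀ w : EuclideanSpace ℝ (Fin n), mvfderiv (𝓡 n) ψ p w =
      fderiv ℝ (ψ ∘ φ.symm) (φ p) w :=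
    fun w => mvfderiv_eq_fderiv (hψ.contMDiff.contMDiffAt.mdifferentiableAt hk0) w
  have hg : ContDiffOn ℝ k (ψ ∘ φ.symm) φ.target := by
    rw [← contMDiffOn_iff_contDiffOn]
    exact hψ.contMDiff.comp_contMDiffOn (contMDiffOn_extChartAt_symm (I := 𝓡 n) p)
  have hφp : φ.symm (φ p) = p := extChartAt_to_inv (I := 𝓡 n) p
  obtain ⟨r, s, a, hs, ha, hev⟩ := exists_isGraph_of_immersion (k := k) hk'
    (isOpen_extChartAt_target (I := 𝓡 n) p) (mem_extChartAt_target p) hg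
    (fun w w' h => hψ.injective_mvfderiv p (by rw [hd, hd]; exact h))
    (by simp) hN (fun w => by rw [← hd]; exact hperp w)
  have hx₀ : (ψ ∘ φ.symm) (φ p) = ψ p := by simp [hφp]
  change IsGraph k N₀ ((ψ ∘ φ.symm) (φ p)) r s at hs
  change ∀ z ∈ ball ((ψ ∘ φ.symm) (φ p)) r, _ at ha
  rw [hx₀] at hs ha
  -- points of the image near `ψ p` come from points of `M` near `p`
  have hev' : ∀ᶠ q in 𝓝 p, φ.symm (a (ψ q)) = q ∧ s (ψ q) = 0 := by
    filter_upwards [(continuousAt_extChartAt (I := 𝓡 n) p).eventually hev,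
      extChartAt_source_mem_nhds (I := 𝓡 n) p]
      with q h1 h2
    have h3 : φ.symm (φ q) = q := φ.left_inv h2
    change a (ψ (φ.symm (φ q))) = φ q ∧ s (ψ (φ.symm (φ q))) = 0 at h1
    rw [h3] at h1
    exact ⟨by rw [h1.1, h3], h1.2⟩
  rw [hψ.isEmbedding.nhds_eq_comap] at hev'
  obtain ⟨U, hU, hUsub⟩ := mem_comap.1 hev'
  obtain ⟨r₁, hr₁, hr₁U⟩ := Metric.mem_nhds_iff.1 hU
  have hle : min r r₁ ≤ r := min_le_left _ _
  have hnear : ∀ q, ψ q ∈ ball (ψ p) (min r r₁) → φ.symm (a (ψ q)) = q ∧ s (ψ q) = 0 :=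
    fun q hq => hUsub (hr₁U (ball_subset_ball (min_le_right _ _) hq))
  refine ⟨min r r₁, s, fun z => φ.symm (a z), hs.mono (lt_min hs.pos hr₁) hle, ?_, ?_,
    fun q hq => (hnear q hq).1⟩
  · refine fun z hz => ⟨?_, fun h0 => ?_⟩
    · rintro ⟨q, rfl⟩
      exact (hnear q hz).2
    · have h1 := (ha z (ball_subset_ball hle hz)).2.2
      rw [h0, zero_smul, add_zero] at h1
      exact ⟨_, h1⟩
  · intro z hz
    obtain ⟨h1, h2, -⟩ := ha z (ball_subset_ball hle hz)
    have h3 : ContMDiffAt 𝓘(ℝ, EuclideanSpace ℝ (Fin n)) (𝓡 n) k φ.symm (a z) :=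
      (contMDiffOn_extChartAt_symm (I := 𝓡 n) p).contMDiffAt
        ((isOpen_extChartAt_target (I := 𝓡 n) p).mem_nhds h2)
    exact h3.comp z h1.contMDiffAt

lemma mvfderiv_congr {E : Type*} [NormedAddCommGroup E] [NormedSpace ℝ E] {f g : M → E} {q : M}
    (h : f =ᶠ[𝓝 q] g) (w : TangentSpace (𝓡 n) q) :
    mvfderiv (𝓡 n) f q w = mvfderiv (𝓡 n) g q w := by
  have h1 := h.mfderiv_eq (I := 𝓡 n) (I' := 𝓘(ℝ, E))
  exact congrArg (fun l : EuclideanSpace ℝ (Fin n) →L[ℝ] E => l w) h1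

/-- The normal space of an immersed hypersurface is a line. -/
lemma exists_eq_smul_of_orthogonal {q : M}
    (hinj : Function.Injective (mvfderiv (𝓡 n) ψ q)) {N P : EuclideanSpace ℝ (Fin (n + 1))}
    (hN0 : N ≠ 0) (hN : ∀ w : TangentSpace (𝓡 n) q, ⟪N, mvfderiv (𝓡 n) ψ q w⟫_ℝ = 0)
    (hP : ∀ w : TangentSpace (𝓡 n) q, ⟪P, mvfderiv (𝓡 n) ψ q w⟫_ℝ = 0) :
    ∃ c : ℝ, P = c • N := by
  let T : EuclideanSpace ℝ (Fin n) →ₗ[ℝ] EuclideanSpace ℝ (Fin (n + 1)) :=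
    (mvfderiv (𝓡 n) ψ q).toLinearMap
  have h1 : Module.finrank ℝ T.range = n := by
    rw [LinearMap.finrank_range_of_inj (f := T) hinj]; simp
  have h2 : Module.finrank ℝ T.rangeᗮ = 1 := by
    have := T.range.finrank_add_finrank_orthogonal
    rw [h1] at this
    simp at this
    omega
  have hmem : ∀ Q : EuclideanSpace ℝ (Fin (n + 1)),
      (∀ w : TangentSpace (𝓡 n) q, ⟪Q, mvfderiv (𝓡 n) ψ q w⟫_ℝ = 0) → Q ∈ T.rangeᗮ := by
    intro Q hQ
    rw [Submodule.mem_orthogonal']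
    rintro _ ⟨w, rfl⟩
    exact hQ w
  obtain ⟨c, hc⟩ := (finrank_eq_one_iff_of_nonzero' (⟨N, hmem N hN⟩ : T.rangeᗮ)
    (by simpa using hN0)).1 h2 ⟨P, hmem P hP⟩
  exact ⟨c, (congrArg Subtype.val hc).symm⟩

/-- The tangent space of an immersed hypersurface is the whole orthogonal complement of the
normal. -/
lemma mem_range_mvfderiv {q : M}
    (hinj : Function.Injective (mvfderiv (𝓡 n) ψ q)) {N y : EuclideanSpace ℝ (Fin (n + 1))}
    (hN0 : N ≠ 0) (hN : ∀ w : TangentSpace (𝓡 n) q, ⟪N, mvfderiv (𝓡 n) ψ q w⟫_ℝ = 0)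
    (hy : ⟪N, y⟫_ℝ = 0) : ∃ w : TangentSpace (𝓡 n) q, mvfderiv (𝓡 n) ψ q w = y := by
  let T : EuclideanSpace ℝ (Fin n) →ₗ[ℝ] EuclideanSpace ℝ (Fin (n + 1)) :=
    (mvfderiv (𝓡 n) ψ q).toLinearMap
  have h1 : y ∈ T.rangeᗮᗮ := by
    rw [Submodule.mem_orthogonal]
    intro P hP
    obtain ⟨c, rfl⟩ := exists_eq_smul_of_orthogonal hinj hN0 hN (P := P)
      (fun w => (Submodule.mem_orthogonal' _ _).1 hP _ ⟨w, rfl⟩)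
    simp [inner_smul_left, hy]
  rw [Submodule.orthogonal_orthogonal] at h1
  exact h1

variable {ℋ : sphere (0 : EuclideanSpace ℝ (Fin (n + 1))) 1 → ℝ}
  {η : M → sphere (0 : EuclideanSpace ℝ (Fin (n + 1))) 1}

/-- In terms of a defining function `s` whose normalized gradient is the Gauss map, prescribed mean
curvature is the equation satisfied by an `IsGraphFunction`. -/
lemma tangentialTrace_eq_prescribedTrace {q : M} {s : EuclideanSpace ℝ (Fin (n + 1)) → ℝ}
    (hinj : Function.Injective (mvfderiv (𝓡 n) ψ q))
    (hψ : MDifferentiableAt (𝓡 n) 𝓘(ℝ, EuclideanSpace ℝ (Fin (n + 1))) ψ q)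
    (hη : ∀ w : TangentSpace (𝓡 n) q,
      ⟪(η q : EuclideanSpace ℝ (Fin (n + 1))), mvfderiv (𝓡 n) ψ q w⟫_ℝ = 0)
    (hs : ContDiffAt ℝ 2 s (ψ q)) (h0 : gradient s (ψ q) ≠ 0)
    (hν : (fun q => (η q : EuclideanSpace ℝ (Fin (n + 1)))) =ᶠ[𝓝 q]
      fun q => ‖gradient s (ψ q)‖⁻¹ • gradient s (ψ q))
    (hH : HasMeanCurvatureAt ψ η q (ℋ (η q))) :
    tangentialTrace (gradient s (ψ q)) (hessian s (ψ q)) =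
      prescribedTrace ℋ (gradient s (ψ q)) := by
  obtain ⟨A, hA, htr⟩ := hH
  have hp : HasFDerivAt (gradient s) (hessian s (ψ q)) (ψ q) := hs.hasFDerivAt_gradient_hessian
  have hP0 : ‖gradient s (ψ q)‖ ≠ 0 := norm_ne_zero_iff.2 h0
  let ν := fun y => ‖gradient s y‖⁻¹ • gradient s y
  have hνd : DifferentiableAt ℝ ν (ψ q) := (hasFDerivAt_normalize hp h0).differentiableAt
  let B : EuclideanSpace ℝ (Fin (n + 1)) →ₗ[ℝ] EuclideanSpace ℝ (Fin (n + 1)) :=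
    -(fderiv ℝ ν (ψ q)).toLinearMap
  let T : EuclideanSpace ℝ (Fin n) →ₗ[ℝ] EuclideanSpace ℝ (Fin (n + 1)) :=
    (mvfderiv (𝓡 n) ψ q).toLinearMap
  let A' : EuclideanSpace ℝ (Fin n) →ₗ[ℝ] EuclideanSpace ℝ (Fin n) := A
  have hTA : ∀ w, T (A' w) = B (T w) := by
    intro w
    have h1 : T (A' w) = -mvfderiv (𝓡 n) (fun q => (η q : EuclideanSpace ℝ (Fin (n + 1)))) q w :=
      hA w
    have h2 := (mvfderiv_congr hν w).trans (mvfderiv_comp_eq (f := ν) hνd hψ w)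
    rw [h1, h2]
    rfl
  have hηq : (η q : EuclideanSpace ℝ (Fin (n + 1))) = ‖gradient s (ψ q)‖⁻¹ • gradient s (ψ q) :=
    hν.self_of_nhds
  have hη0 : (η q : EuclideanSpace ℝ (Fin (n + 1))) ≠ 0 := by
    rw [hηq]; simpa using h0
  have hran : ∀ y, B y ∈ T.range := by
    intro y
    refine mem_range_mvfderiv hinj hη0 hη ?_
    have := inner_fderiv_normalize hp h0 y
    have h3 : B y = -fderiv ℝ ν (ψ q) y := rfl
    rw [h3, hηq, inner_neg_right, inner_smul_left, this]
    simp
  have h4 := trace_eq_of_intertwine (T := T) (A := A') (B := B) hinj hTA hran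
  have h5 : LinearMap.trace ℝ _ B = -(‖gradient s (ψ q)‖⁻¹ *
      tangentialTrace (gradient s (ψ q)) (hessian s (ψ q))) := by
    rw [← trace_fderiv_normalize hp h0, ← map_neg]
  have h6 : LinearMap.trace ℝ _ A' = n * ℋ (η q) := htr
  rw [h5, h6] at h4
  rw [prescribedTrace_eq h0 hηq]
  field_simp at h4
  linarith

/-- The local description of an embedded hypersurface of prescribed mean curvature. -/
lemma IsEmbeddedHHypersurface.exists_isGraphFunction [IsManifold (𝓡 n) k M]
    (hψ : IsEmbeddedHHypersurface k ℋ ψ η) (hk : 2 ≤ k) (p : M) :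
    ∃ (r : ℝ) (s : EuclideanSpace ℝ (Fin (n + 1)) → ℝ) (χ : EuclideanSpace ℝ (Fin (n + 1)) → M),
      IsGraphFunction k (prescribedTrace ℋ) (η p) (ψ p) r s ∧
      (∀ z ∈ ball (ψ p) r, z ∈ range ψ ↔ s z = 0) ∧
      (∀ z ∈ ball (ψ p) r, ContMDiffAt 𝓘(ℝ, EuclideanSpace ℝ (Fin (n + 1))) (𝓡 n) k χ z) ∧
      ∀ q, ψ q ∈ ball (ψ p) r → χ (ψ q) = q := by
  have hk' : (2 : WithTop ℕ∞) ≤ k := WithTop.coe_le_coe.2 hk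
  have hk1 : (1 : WithTop ℕ∞) ≤ k := one_le_two.trans hk'
  have hk0 : (k : WithTop ℕ∞) ≠ 0 := (zero_lt_one.trans_le hk1).ne'
  have hψ1 := hψ.isEmbeddedHypersurface
  obtain ⟨r, s, χ, hs, hzero, hχ, hχψ⟩ :=
    hψ1.exists_isGraph (one_le_two.trans hk) p (N₀ := η p) (by simp) (hψ.isGaussMap.orthogonal p)
  have hψc : Continuous ψ := hψ1.contMDiff.continuous
  have hηc : Continuous fun q => (η q : EuclideanSpace ℝ (Fin (n + 1))) :=
    hψ.isGaussMap.contMDiff.continuous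
  have hmd : ∀ q, MDifferentiableAt (𝓡 n) 𝓘(ℝ, EuclideanSpace ℝ (Fin (n + 1))) ψ q :=
    fun q => hψ1.contMDiff.contMDiffAt.mdifferentiableAt hk0
  let W : Set M := ψ ⁻¹' ball (ψ p) r ∩
    {q | 0 < ⟪(η q : EuclideanSpace ℝ (Fin (n + 1))), η p⟫_ℝ}
  have hW : IsOpen W := (isOpen_ball.preimage hψc).inter
    (isOpen_lt continuous_const (hηc.inner continuous_const))
  have hpW : p ∈ W := ⟨mem_ball_self hs.pos, by simp⟩
  have hνW : ∀ q ∈ W, (η q : EuclideanSpace ℝ (Fin (n + 1))) =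
      ‖gradient s (ψ q)‖⁻¹ • gradient s (ψ q) := by
    rintro q ⟨hq, hpos⟩
    have hη0 : (η q : EuclideanSpace ℝ (Fin (n + 1))) ≠ 0 := by
      intro h0
      have := norm_eq_of_mem_sphere (η q)
      simp [h0] at this
    have hP : ∀ w : TangentSpace (𝓡 n) q,
        ⟪gradient s (ψ q), mvfderiv (𝓡 n) ψ q w⟫_ℝ = 0 := by
      intro w
      have hsd : DifferentiableAt ℝ s (ψ q) := (hs.contDiffAt hq).differentiableAt hk0
      have h1 : (fun q => s (ψ q)) =ᶠ[𝓝 q] fun _ => 0 := by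
        filter_upwards [(isOpen_ball.preimage hψc).mem_nhds hq] with q' hq'
        exact (hzero _ hq').1 ⟨q', rfl⟩
      have h2 := mvfderiv_comp_eq (f := s) hsd (hmd q) w
      rw [mvfderiv_congr h1 w, mvfderiv_const] at h2
      rw [gradient, InnerProductSpace.toDual_symm_apply, ← h2]
      rfl
    obtain ⟨c, hc⟩ := exists_eq_smul_of_orthogonal (hψ1.injective_mvfderiv q) hη0
      (hψ.isGaussMap.orthogonal q) hP
    have h3 := hs.inner_gradient hk1 hq
    rw [hc, inner_smul_left] at h3
    have hcpos : 0 < c := by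
      by_contra hc0
      have : c * ⟪(η q : EuclideanSpace ℝ (Fin (n + 1))), η p⟫_ℝ ≤ 0 :=
        mul_nonpos_of_nonpos_of_nonneg (not_lt.1 hc0) hpos.le
      simp at h3
      linarith
    rw [hc, norm_smul, norm_eq_of_mem_sphere, mul_one, Real.norm_of_nonneg hcpos.le, smul_smul,
      inv_mul_cancel₀ hcpos.ne', one_smul]
  have hpdeW : ∀ q ∈ W, tangentialTrace (gradient s (ψ q)) (hessian s (ψ q)) =
      prescribedTrace ℋ (gradient s (ψ q)) := by
    intro q hq
    refine tangentialTrace_eq_prescribedTrace (hψ1.injective_mvfderiv q) (hmd q)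
      (hψ.isGaussMap.orthogonal q) ((hs.contDiffAt hq.1).of_le hk') (hs.gradient_ne_zero hk1 hq.1)
      ?_ (hψ.hasMeanCurvatureAt q)
    filter_upwards [hW.mem_nhds hq] with q' hq' using hνW q' hq'
  -- the equation extends off the zero set by translation in the direction `η p`
  have hWn : W ∈ 𝓝 p := hW.mem_nhds hpW
  rw [hψ1.isEmbedding.nhds_eq_comap] at hWn
  obtain ⟨U, hU, hUW⟩ := mem_comap.1 hWn
  have hproj : Tendsto (fun z => z + (-s z) • (η p : EuclideanSpace ℝ (Fin (n + 1)))) (𝓝 (ψ p))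
      (𝓝 (ψ p)) := by
    have h1 : ContinuousAt (fun z => z + (-s z) • (η p : EuclideanSpace ℝ (Fin (n + 1)))) (ψ p) :=
      continuousAt_id.add ((hs.contDiffAt hs.mem_self).continuousAt.neg.smul continuousAt_const)
    have h2 := h1.tendsto
    simpa [hs.zero] using h2
  have hev := (hproj.eventually hU).and (hproj.eventually (ball_mem_nhds _ hs.pos))
  obtain ⟨r₁, hr₁, hr₁b⟩ := Metric.eventually_nhds_iff_ball.1 hev
  have hle : min r r₁ ≤ r := min_le_left _ _
  refine ⟨min r r₁, s, χ, ⟨hs.mono (lt_min hs.pos hr₁) hle, ?_⟩,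
    fun z hz => hzero z (ball_subset_ball hle hz), fun z hz => hχ z (ball_subset_ball hle hz),
    fun q hq => hχψ q (ball_subset_ball hle hq)⟩
  intro z hz
  obtain ⟨h1, h2⟩ := hr₁b z (ball_subset_ball (min_le_right _ _) hz)
  have hz' := ball_subset_ball hle hz
  have h3 : s (z + (-s z) • (η p : EuclideanSpace ℝ (Fin (n + 1)))) = 0 := by
    rw [hs.translate z hz' _ h2]; ring
  obtain ⟨q, hq⟩ := (hzero _ h2).2 h3
  have hqW : q ∈ W := hUW (by rw [mem_preimage, hq]; exact h1)
  obtain ⟨h4, h5⟩ := hs.gradient_hessian_translate hz' h2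
  have h6 := hpdeW q hqW
  rwa [hq, h4, h5] at h6

end Embedding

/-! ### The Jordan–Brouwer separation theorem -/

section Separation

variable {E : Type*} [NormedAddCommGroup E] [InnerProductSpace ℝ E] [FiniteDimensional ℝ E]
  [CompleteSpace E]

/-- `S` is a compact connected hypersurface without boundary, oriented by the unit normal field
`N`. -/
structure IsClosedHypersurface (k : WithTop ℕ∞) (S : Set E) (N : E → E) : Prop where
  isCompact : IsCompact S
  nonempty : S.Nonempty
  isPreconnected : IsPreconnected S
  continuousOn : ContinuousOn N S
  exists_isGraph : ∀ x ∈ S, ∃ (r : ℝ) (s : E → ℝ), IsGraph k (N x) x r s ∧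
    ∀ z ∈ ball x r, z ∈ S ↔ s z = 0

/-- The points that lie on the side of `S` given by the sign `σ` of the direction `N`, as seen from
a nearest point of `S`. -/
def sideSet (S : Set E) (N : E → E) (σ : ℝ) : Set E :=
  {z | ∃ x ∈ S, z = x + (σ * infDist z S) • N x}

namespace IsClosedHypersurface

variable {k : WithTop ℕ∞} {S : Set E} {N : E → E}

lemma isClosed_sideSet (hS : IsClosedHypersurface k S N) (σ : ℝ) : IsClosed (sideSet S N σ) := by
  have : CompactSpace S := isCompact_iff_compactSpace.1 hS.isCompact
  have h1 : IsClosed {p : E × S | p.1 = p.2 + (σ * infDist p.1 S) • N p.2} := by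
    have h2 : Continuous fun p : E × S => N p.2 :=
      hS.continuousOn.domRestrict.comp continuous_snd
    have h3 : Continuous fun p : E × S => infDist p.1 S :=
      (continuous_infDist_pt S).comp continuous_fst
    exact isClosed_eq continuous_fst
      ((continuous_subtype_val.comp continuous_snd).add ((continuous_const.mul h3).smul h2))
  have h2 := isClosedMap_fst_of_compactSpace _ h1
  convert h2 using 1
  ext z
  constructor
  · rintro ⟨x, hx, h⟩
    exact ⟨(z, ⟨x, hx⟩), h, rfl⟩
  · rintro ⟨⟨z', x⟩, h, rfl⟩
    exact ⟨x, x.2, h⟩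

/-- The segment from a point to a nearest point of a hypersurface is normal to it. -/
lemma mem_sideSet_or (hS : IsClosedHypersurface k S N) (hk : 1 ≤ k) (z : E) :
    z ∈ sideSet S N 1 ∨ z ∈ sideSet S N (-1) := by
  have hk0 : k ≠ 0 := (zero_lt_one.trans_le hk).ne'
  obtain ⟨x, hx, hd⟩ := hS.isCompact.exists_infDist_eq_dist hS.nonempty z
  obtain ⟨r, s, hs, hzero⟩ := hS.exists_isGraph x hx
  have hN1 := hs.norm_eq_one
  have hmin : IsLocalExtrOn (fun y => ‖y - z‖ ^ 2) {y | s y = s x} x := by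
    left
    filter_upwards [self_mem_nhdsWithin, mem_nhdsWithin_of_mem_nhds (ball_mem_nhds x hs.pos)]
      with y hy hyb
    have hyS : y ∈ S := (hzero y hyb).2 (hy.trans hs.zero)
    have h1 := infDist_le_dist_of_mem (x := z) hyS
    rw [hd, dist_comm, dist_eq_norm, dist_comm, dist_eq_norm] at h1
    gcongr
  have hs' : HasStrictFDerivAt s (innerSL ℝ (N x)) x := by
    refine (hs.contDiffAt hs.mem_self).hasStrictFDerivAt' ?_ hk0
    have h1 := ((hs.contDiffAt hs.mem_self).differentiableAt hk0).hasGradientAt.hasFDerivAt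
    rw [hs.gradient_eq] at h1
    exact h1
  have hφ : HasStrictFDerivAt (fun y => ‖y - z‖ ^ 2) (2 • innerSL ℝ (x - z)) x := by
    have h1 : HasStrictFDerivAt (fun y => y - z) (ContinuousLinearMap.id ℝ E) x :=
      (hasStrictFDerivAt_id x).sub_const z
    have h2 := (hasStrictFDerivAt_norm_sq (x - z)).comp x h1
    exact h2
  obtain ⟨a, b, hab, h0⟩ := hmin.exists_multipliers_of_hasStrictFDerivAt_1d hs' hφ
  have h1 : a • N x + (2 * b) • (x - z) = 0 := by
    refine ext_inner_right ℝ fun w => ?_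
    have := congrArg (fun l : StrongDual ℝ E => l w) h0
    simp at this
    rw [inner_add_left, inner_smul_left, inner_smul_left, inner_sub_left, inner_zero_left]
    simp
    linarith
  have hb : b ≠ 0 := by
    rintro rfl
    have ha : a = 0 := by
      have hN0 : N x ≠ 0 := fun h => by simp [h] at hN1
      simpa [hN0] using h1
    exact hab (by simp [ha])
  obtain ⟨c, hc⟩ : ∃ c : ℝ, z - x = c • N x := by
    refine ⟨a / (2 * b), ?_⟩
    have h2 : (2 * b) • (z - x) = a • N x := by
      rw [← neg_sub x z, smul_neg]
      exact (neg_eq_of_add_eq_zero_left h1)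
    rw [div_eq_inv_mul, mul_smul, ← h2, smul_smul, inv_mul_cancel₀ (by positivity), one_smul]
  have hdc : infDist z S = |c| := by
    rw [hd, dist_eq_norm, hc, norm_smul, hN1, mul_one, Real.norm_eq_abs]
  rcases le_total 0 c with h | h
  · refine Or.inl ⟨x, hx, ?_⟩
    rw [hdc, abs_of_nonneg h, one_mul, ← hc]; abel
  · refine Or.inr ⟨x, hx, ?_⟩
    rw [hdc, abs_of_nonpos h, neg_one_mul, neg_neg, ← hc]; abel

/-- The sign of a local defining function along the normals of nearby points. -/
lemma exists_sign (hS : IsClosedHypersurface k S N) (hk : 1 ≤ k) {x₀ : E} (hx₀ : x₀ ∈ S) {r : ℝ}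
    {s : E → ℝ} (hs : IsGraph k (N x₀) x₀ r s) (hzero : ∀ z ∈ ball x₀ r, z ∈ S ↔ s z = 0) :
    ∃ ε > 0, ∀ x ∈ S, dist x x₀ < ε → ∀ d, 0 < d → d < ε →
      0 < s (x + d • N x) ∧ s (x - d • N x) < 0 := by
  have hk0 : k ≠ 0 := (zero_lt_one.trans_le hk).ne'
  have hs' : HasStrictFDerivAt s (innerSL ℝ (N x₀)) x₀ := by
    refine (hs.contDiffAt hs.mem_self).hasStrictFDerivAt' ?_ hk0
    have h1 := ((hs.contDiffAt hs.mem_self).differentiableAt hk0).hasGradientAt.hasFDerivAt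
    rw [hs.gradient_eq] at h1
    exact h1
  have h1 := hs'.isLittleO.def (show (0 : ℝ) < 1 / 4 by norm_num)
  rw [nhds_prod_eq] at h1
  obtain ⟨ε₁, hε₁, h1⟩ := (nhds_basis_ball.prod_self.eventually_iff).1 h1
  have h2 : ∀ᶠ x in 𝓝[S] x₀, 1 / 2 < ⟪N x₀, N x⟫_ℝ ∧ ‖N x‖ < 2 := by
    have h3 := hS.continuousOn x₀ hx₀
    have h4 : Tendsto (fun x => ⟪N x₀, N x⟫_ℝ) (𝓝[S] x₀) (𝓝 ⟪N x₀, N x₀⟫_ℝ) :=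
      (tendsto_const_nhds (x := N x₀)).inner h3
    have h5 : Tendsto (fun x => ‖N x‖) (𝓝[S] x₀) (𝓝 ‖N x₀‖) := h3.norm
    rw [real_inner_self_eq_norm_sq, hs.norm_eq_one] at h4
    rw [hs.norm_eq_one] at h5
    exact (h4.eventually_const_lt (by norm_num)).and (h5.eventually_lt_const (by norm_num))
  obtain ⟨ε₂, hε₂, h2⟩ := Metric.eventually_nhds_iff.1 (eventually_nhdsWithin_iff.1 h2)
  refine ⟨min (min (ε₁ / 4) ε₂) r, lt_min (lt_min (by positivity) hε₂) hs.pos,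
    fun x hx hxd d hd hdε => ?_⟩
  have hx1 : dist x x₀ < ε₁ / 4 := hxd.trans_le ((min_le_left _ _).trans (min_le_left _ _))
  have hd1 : d < ε₁ / 4 := hdε.trans_le ((min_le_left _ _).trans (min_le_left _ _))
  obtain ⟨h3, h4⟩ := h2 (hxd.trans_le ((min_le_left _ _).trans (min_le_right _ _))) hx
  have hsx : s x = 0 := (hzero x (hxd.trans_le (min_le_right _ _))).1 hx
  have h5 : ∀ c : ℝ, |c| = d → 
      |s (x + c • N x) - c * ⟪N x₀, N x⟫_ℝ| ≤ d * ‖N x‖ / 4 := by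
    intro c hc
    have hxc : x + c • N x ∈ ball x₀ ε₁ := by
      rw [mem_ball, dist_eq_norm]
      calc ‖x + c • N x - x₀‖ = ‖(x - x₀) + c • N x‖ := by congr 1; abel
        _ ≤ ‖x - x₀‖ + ‖c • N x‖ := norm_add_le _ _
        _ < ε₁ := by
          rw [norm_smul, Real.norm_eq_abs, hc, ← dist_eq_norm]
          nlinarith [norm_nonneg (N x)]
    have hx : x ∈ ball x₀ ε₁ := by rw [mem_ball]; linarith
    have h6 := h1 (x := (x + c • N x, x)) ⟨hxc, hx⟩
    simp only [hsx, add_sub_cancel_left, norm_smul, Real.norm_eq_abs, hc, sub_zero,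
      innerSL_apply_apply, inner_smul_right] at h6
    linarith
  have h7 := abs_le.1 (h5 d (abs_of_pos hd))
  have h8 := abs_le.1 (h5 (-d) (by rw [abs_neg, abs_of_pos hd]))
  rw [neg_smul, ← sub_eq_add_neg] at h8
  constructor
  · nlinarith
  · nlinarith

/-- Near `S`, the two sides only meet along `S`. -/
lemma exists_infDist_eq_zero (hS : IsClosedHypersurface k S N) (hk : 1 ≤ k) :
    ∃ δ > 0, ∀ z ∈ sideSet S N 1, z ∈ sideSet S N (-1) → infDist z S < δ → infDist z S = 0 := by
  have h1 : ∀ x₀ : S, ∃ ε > 0, ∀ x ∈ S, dist x x₀ < ε → ∀ y ∈ S, dist y x₀ < ε → ∀ d, 0 < d →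
      d < ε → x + d • N x ≠ y - d • N y := by
    rintro ⟨x₀, hx₀⟩
    obtain ⟨r, s, hs, hzero⟩ := hS.exists_isGraph x₀ hx₀
    obtain ⟨ε, hε, h⟩ := hS.exists_sign hk hx₀ hs hzero
    refine ⟨ε, hε, fun x hx hxd y hy hyd d hd hdε heq => ?_⟩
    have h2 := (h x hx hxd d hd hdε).1
    have h3 := (h y hy hyd d hd hdε).2
    rw [heq] at h2
    linarith
  choose ε hε h using h1
  obtain ⟨δ, hδ, hcov⟩ := lebesgue_number_lemma_of_metric (c := fun x₀ : S => ball (x₀ : E) (ε x₀))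
    hS.isCompact (fun _ => isOpen_ball) fun x hx => mem_iUnion.2 ⟨⟨x, hx⟩, mem_ball_self (hε _)⟩
  refine ⟨δ / 3, by positivity, ?_⟩
  rintro z ⟨x, hx, hzx⟩ ⟨y, hy, hzy⟩ hz
  by_contra h0
  have hd : 0 < infDist z S := infDist_nonneg.lt_of_ne' h0
  obtain ⟨x₀, hx₀⟩ := hcov x hx
  rw [one_mul] at hzx
  rw [neg_one_mul, neg_smul, ← sub_eq_add_neg] at hzy
  have hN : ∀ x ∈ S, ‖N x‖ = 1 := fun x hx => by
    obtain ⟨r, s, hs, -⟩ := hS.exists_isGraph x hx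
    exact hs.norm_eq_one
  have hxy : dist y x < δ := by
    have h3 : y - x = infDist z S • N x + infDist z S • N y := by
      have := hzx.symm.trans hzy
      rw [sub_eq_iff_eq_add, add_comm _ x, ← add_assoc, this]; abel
    rw [dist_eq_norm, h3]
    refine (norm_add_le _ _).trans_lt ?_
    rw [norm_smul, norm_smul, hN x hx, hN y hy, Real.norm_of_nonneg hd.le]
    linarith
  -- the Lebesgue number also bounds `d`, as a ball of radius `δ` fits into one of radius `ε`
  have hδε : infDist z S < ε x₀ := by
    have h4 : x + infDist z S • N x ∈ ball (x₀ : E) (ε x₀) := hx₀ (by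
      rw [mem_ball, dist_eq_norm, add_sub_cancel_left, norm_smul, hN x hx,
        Real.norm_of_nonneg hd.le]
      linarith)
    have h5 : x - infDist z S • N x ∈ ball (x₀ : E) (ε x₀) := hx₀ (by
      rw [mem_ball, dist_eq_norm, sub_sub_cancel_left, norm_neg, norm_smul, hN x hx,
        Real.norm_of_nonneg hd.le]
      linarith)
    rw [mem_ball, dist_eq_norm] at h4 h5
    have h6 : (2 * infDist z S) • N x =
        (x + infDist z S • N x - x₀) - (x - infDist z S • N x - x₀) := by
      rw [two_mul, add_smul]; abel
    have h7 := norm_sub_le (x + infDist z S • N x - x₀) (x - infDist z S • N x - x₀)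
    rw [← h6, norm_smul, hN x hx, Real.norm_of_nonneg (by positivity)] at h7
    linarith
  exact h x₀ x hx (mem_ball.1 (hx₀ (mem_ball_self hδ))) y hy (mem_ball.1 (hx₀ hxy)) _ hd hδε
    (hzx.symm.trans hzy)

/-- A continuous function on the whole space that vanishes exactly on `S` and changes sign across
`S` in the direction of `N`. It is a lift through `Circle.exp` of a map that winds once around the
circle across a tubular neighbourhood of `S`. -/
lemma exists_global_defining (hS : IsClosedHypersurface k S N) (hk : 1 ≤ k) :
    ∃ g : E → ℝ, Continuous g ∧ (∀ z, g z = 0 ↔ z ∈ S) ∧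
      ∀ x₀ ∈ S, ∀ r s, IsGraph k (N x₀) x₀ r s → (∀ z ∈ ball x₀ r, z ∈ S ↔ s z = 0) →
        ∀ᶠ z in 𝓝 x₀, (0 < g z ↔ 0 < s z) ∧ (g z < 0 ↔ s z < 0) := by
  classical
  obtain ⟨δ, hδ, hdisj⟩ := hS.exists_infDist_eq_zero hk
  have hmemS : ∀ z, infDist z S = 0 ↔ z ∈ S := fun z =>
    (hS.isCompact.isClosed.mem_iff_infDist_zero hS.nonempty).symm
  let κ : E → ℝ := fun z => min (infDist z S / δ) 1
  have hκc : Continuous κ := ((continuous_infDist_pt S).div_const δ).min continuous_const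
  have hκ0 : ∀ z, 0 ≤ κ z := fun z => le_min (div_nonneg infDist_nonneg hδ.le) zero_le_one
  have hκ1 : ∀ z, κ z ≤ 1 := fun z => min_le_right _ _
  have hκz : ∀ z, κ z = 0 ↔ z ∈ S := by
    intro z
    rw [← hmemS]
    constructor
    · intro h
      rcases min_choice (infDist z S / δ) 1 with h1 | h1
      · have h2 : infDist z S / δ = 0 := h1.symm.trans h
        simpa [hδ.ne'] using h2
      · exact absurd (h1.symm.trans h) one_ne_zero
    · intro h
      simp [κ, h]
  let f₁ : E → Circle := fun z => Circle.exp (Real.pi * κ z)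
  let f₂ : E → Circle := fun z => Circle.exp (-(Real.pi * κ z))
  have hf₁ : Continuous f₁ := Circle.exp.continuous.comp (continuous_const.mul hκc)
  have hf₂ : Continuous f₂ := Circle.exp.continuous.comp (continuous_const.mul hκc).neg
  have hagree : ∀ z ∈ sideSet S N 1, z ∈ sideSet S N (-1) → f₁ z = f₂ z := by
    intro z h1 h2
    rcases lt_or_ge (infDist z S) δ with h | h
    · have h3 : κ z = 0 := (hκz z).2 ((hmemS z).1 (hdisj z h1 h2 h))
      simp [f₁, f₂, h3]
    · have h3 : κ z = 1 := min_eq_right ((one_le_div hδ).2 h)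
      refine Circle.exp_eq_exp.2 ⟨1, ?_⟩
      rw [h3]; push_cast; ring
  let f : E → Circle := (sideSet S N 1).piecewise f₁ f₂
  have hf : Continuous f := by
    refine Continuous.piecewise (fun z hz => ?_) hf₁ hf₂
    refine hagree z ((hS.isClosed_sideSet 1).frontier_subset hz) ?_
    rw [← frontier_compl] at hz
    have h1 : z ∈ closure (sideSet S N 1)ᶜ := frontier_subset_closure hz
    exact closure_minimal (fun y hy => (hS.mem_sideSet_or hk y).resolve_left hy)
      (hS.isClosed_sideSet (-1)) h1
  have hf1 : ∀ z ∈ sideSet S N 1, f z = f₁ z := fun z hz => piecewise_eq_of_mem _ _ _ hz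
  have hf2 : ∀ z ∈ sideSet S N (-1), f z = f₂ z := fun z hz => by
    by_cases h : z ∈ sideSet S N 1
    · rw [hf1 z h, hagree z h hz]
    · exact piecewise_eq_of_notMem _ _ _ h
  obtain ⟨p, hp⟩ := hS.nonempty
  have hfS : ∀ z ∈ S, f z = 1 := by
    intro z hz
    have h0 := (hκz z).2 hz
    rcases hS.mem_sideSet_or hk z with h | h
    · simp [hf1 z h, f₁, h0]
    · simp [hf2 z h, f₂, h0]
  obtain ⟨F, ⟨hF0, hFf⟩, -⟩ := Circle.isCoveringMap_exp.existsUnique_continuousMap_lifts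
    ⟨f, hf⟩ p (0 : ℝ) (by simp [hfS p hp])
  have hFf' : ∀ z, Circle.exp (F z) = f z := fun z => congrFun hFf z
  -- near a point of `S`, the lift is determined by the side
  have hloc : ∀ x₀ ∈ S, ∀ᶠ z in 𝓝 x₀,
      (z ∈ sideSet S N 1 → F z - F x₀ = Real.pi * κ z) ∧
      (z ∈ sideSet S N (-1) → F z - F x₀ = -(Real.pi * κ z)) := by
    intro x₀ hx₀
    have h1 : Tendsto (fun z => |F z - F x₀|) (𝓝 x₀) (𝓝 0) := by
      have h2 : Continuous fun z => |F z - F x₀| := (F.continuous.sub continuous_const).abs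
      simpa using h2.tendsto x₀
    have h3 : Tendsto κ (𝓝 x₀) (𝓝 0) := by
      simpa [(hκz x₀).2 hx₀] using hκc.tendsto x₀
    filter_upwards [h1.eventually_lt_const Real.pi_pos, h3.eventually_lt_const one_pos]
      with z hz1 hz2
    have hz3 : Real.pi * κ z < Real.pi := by nlinarith [Real.pi_pos]
    have hz4 : 0 ≤ Real.pi * κ z := mul_nonneg Real.pi_pos.le (hκ0 z)
    rw [abs_lt] at hz1
    have h4 : Circle.exp (F z - F x₀) = f z := by
      rw [Circle.exp_sub, hFf', hFf', hfS x₀ hx₀, div_one]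
    have key : ∀ t : ℝ, -Real.pi < t → t ≤ Real.pi → f z = Circle.exp t → F z - F x₀ = t := by
      intro t ht1 ht2 ht
      rw [ht] at h4
      have h5 := congrArg (fun c : Circle => Complex.arg c) h4
      simpa only [Circle.arg_exp hz1.1 hz1.2.le, Circle.arg_exp ht1 ht2] using h5
    exact ⟨fun h => key _ (by linarith [Real.pi_pos]) hz3.le (hf1 z h),
      fun h => key _ (by linarith) (by linarith [Real.pi_pos]) (hf2 z h)⟩
  have hconst : ∀ x ∈ S, F x = 0 := by
    have : PreconnectedSpace S := isPreconnected_iff_preconnectedSpace.1 hS.isPreconnected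
    have h1 : IsLocallyConstant fun x : S => F x := by
      rw [IsLocallyConstant.iff_eventually_eq]
      rintro ⟨x, hx⟩
      filter_upwards [(continuous_subtype_val.tendsto (⟨x, hx⟩ : S)).eventually (hloc x hx)]
        with y hy
      have h0 := (hκz y).2 y.2
      rw [h0] at hy
      simp only [mul_zero, neg_zero] at hy
      have : F y - F x = 0 := (hS.mem_sideSet_or hk (y : E)).elim hy.1 hy.2
      exact sub_eq_zero.1 this
    intro x hx
    have h2 := h1.apply_eq_of_preconnectedSpace ⟨x, hx⟩ ⟨p, hp⟩
    exact h2.trans hF0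
  refine ⟨F, F.continuous, fun z => ⟨fun h => ?_, hconst z⟩, ?_⟩
  · rw [← hκz]
    have h1 := hFf' z
    rw [h, Circle.exp_zero] at h1
    have h2 : Circle.exp (Real.pi * κ z) = Circle.exp 0 := by
      rw [Circle.exp_zero]
      rcases hS.mem_sideSet_or hk z with h3 | h3
      · rw [hf1 z h3] at h1
        exact h1.symm
      · rw [hf2 z h3] at h1
        have h4 : Circle.exp (-(Real.pi * κ z)) = 1 := h1.symm
        rw [Circle.exp_neg, inv_eq_one] at h4
        exact h4
    have h5 := congrArg (fun c : Circle => Complex.arg c) h2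
    rw [Circle.arg_exp (by nlinarith [Real.pi_pos, hκ0 z]) (by nlinarith [Real.pi_pos, hκ1 z]),
      Circle.arg_exp (by linarith [Real.pi_pos]) Real.pi_pos.le] at h5
    simpa [Real.pi_ne_zero] using h5
  · intro x₀ hx₀ r s hs hzero
    obtain ⟨ε, hε, hsign⟩ := hS.exists_sign hk hx₀ hs hzero
    filter_upwards [hloc x₀ hx₀, ball_mem_nhds x₀ (half_pos hε), ball_mem_nhds x₀ hs.pos]
      with z hz hzε hzr
    rw [hconst x₀ hx₀, sub_zero] at hz
    by_cases hzS : z ∈ S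
    · simp [hconst z hzS, (hzero z hzr).1 hzS]
    have hd : 0 < infDist z S := infDist_nonneg.lt_of_ne' fun h => hzS ((hmemS z).1 h)
    have hκp : 0 < Real.pi * κ z :=
      mul_pos Real.pi_pos ((hκ0 z).lt_of_ne' fun h => hzS ((hκz z).1 h))
    have hdε : infDist z S < ε / 2 := (infDist_le_dist_of_mem hx₀).trans_lt hzε
    have hnear : ∀ x ∈ S, ∀ c : ℝ, |c| = infDist z S → z = x + c • N x → dist x x₀ < ε := by
      intro x hx c hc hzx
      obtain ⟨r', s', hs', -⟩ := hS.exists_isGraph x hx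
      have h1 : dist x z = infDist z S := by
        rw [hzx, dist_self_add_right, norm_smul, hs'.norm_eq_one, mul_one, Real.norm_eq_abs, hc,
          ← hzx]
      have := dist_triangle x z x₀
      rw [mem_ball] at hzε
      linarith
    rcases hS.mem_sideSet_or hk z with h | h
    · have h1 := hz.1 h
      obtain ⟨x, hx, hzx⟩ := h
      rw [one_mul] at hzx
      have h2 := (hsign x hx (hnear x hx _ (abs_of_pos hd) hzx) _ hd (by linarith)).1
      rw [← hzx] at h2
      constructor <;> constructor <;> intro h3 <;> linarith
    · have h1 := hz.2 h
      obtain ⟨x, hx, hzx⟩ := h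
      rw [neg_one_mul] at hzx
      have h2 := (hsign x hx (hnear x hx _ (by rw [abs_neg, abs_of_pos hd]) hzx) _ hd
        (by linarith)).2
      rw [sub_eq_add_neg, ← neg_smul, ← hzx] at h2
      constructor <;> constructor <;> intro h3 <;> linarith

/-- The Jordan–Brouwer theorem: a closed connected hypersurface bounds a compact set. The sign `ε`
records whether `N` is the outer or the inner normal. -/
lemma exists_bounded_side (hS : IsClosedHypersurface k S N) (hk : 1 ≤ k)
    (hE : 1 < Module.rank ℝ E) :
    ∃ (K : Set E) (ε : ℝ), (ε = 1 ∨ ε = -1) ∧ IsCompact K ∧ frontier K = S ∧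
      ∀ x₀ ∈ S, ∀ r s, IsGraph k (N x₀) x₀ r s → (∀ z ∈ ball x₀ r, z ∈ S ↔ s z = 0) →
        ∀ᶠ z in 𝓝 x₀, z ∈ K ↔ ε * s z ≤ 0 := by
  obtain ⟨g, hg, hg0, hgs⟩ := hS.exists_global_defining hk
  obtain ⟨R, hR, hSR⟩ := hS.isCompact.isBounded.subset_closedBall_lt 0 0
  let C : Set E := (fun p : ℝ × E => p.1 • p.2) '' (Ioi R ×ˢ sphere 0 1)
  have hC : ∀ z, R < ‖z‖ → z ∈ C := fun z hz => by
    have hz0 : ‖z‖ ≠ 0 := (hR.trans hz).ne'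
    refine ⟨(‖z‖, ‖z‖⁻¹ • z), ⟨hz, ?_⟩, ?_⟩
    · simp [norm_smul, hz0]
    · simp [smul_smul, hz0]
  have hCg : ∀ z ∈ C, g z ≠ 0 := by
    rintro _ ⟨⟨t, y⟩, ⟨ht, hy⟩, rfl⟩ h0
    have h1 := hSR ((hg0 _).1 h0)
    have ht' : R < t := ht
    rw [mem_sphere_zero_iff_norm] at hy
    simp only [mem_closedBall_zero_iff, norm_smul, hy, mul_one, Real.norm_eq_abs,
      abs_of_pos (hR.trans ht')] at h1
    linarith
  have hCc : IsPreconnected C :=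
    (isPreconnected_Ioi.prod (isPreconnected_sphere hE 0 1)).image _ continuous_smul.continuousOn
  have hsgn : ∃ ε : ℝ, (ε = 1 ∨ ε = -1) ∧ ∀ z ∈ C, 0 < ε * g z := by
    by_cases h : ∀ z ∈ C, 0 < g z
    · exact ⟨1, Or.inl rfl, by simpa using h⟩
    · push Not at h
      obtain ⟨z₀, hz₀, hle⟩ := h
      refine ⟨-1, Or.inr rfl, fun z hz => ?_⟩
      by_contra hcon
      obtain ⟨y, hy, hy0⟩ := hCc.intermediate_value hz₀ hz hg.continuousOn
        (show (0 : ℝ) ∈ Icc (g z₀) (g z) from ⟨hle, by linarith⟩)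
      exact hCg y hy hy0
  obtain ⟨ε, hε, hCε⟩ := hsgn
  have hε0 : ε ≠ 0 := by rcases hε with rfl | rfl <;> norm_num
  have hgε : Continuous fun z => ε * g z := continuous_const.mul hg
  have hloc : ∀ x₀ ∈ S, ∀ r s, IsGraph k (N x₀) x₀ r s → (∀ z ∈ ball x₀ r, z ∈ S ↔ s z = 0) →
      ∀ᶠ z in 𝓝 x₀, ε * g z ≤ 0 ↔ ε * s z ≤ 0 := by
    intro x₀ hx₀ r s hs hzero
    filter_upwards [hgs x₀ hx₀ r s hs hzero] with z hz
    rcases hε with rfl | rfl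
    · rw [one_mul, one_mul, ← not_lt, ← not_lt, hz.1]
    · rw [neg_one_mul, neg_one_mul, neg_nonpos, neg_nonpos, ← not_lt, ← not_lt, hz.2]
  refine ⟨{z | ε * g z ≤ 0}, ε, hε, ?_, ?_, hloc⟩
  · refine isCompact_of_isClosed_isBounded (isClosed_le hgε continuous_const) ?_
    refine isBounded_closedBall.subset (fun z (hz : ε * g z ≤ 0) => ?_ : _ ⊆ closedBall (0 : E) R)
    rw [mem_closedBall_zero_iff]
    by_contra! h
    exact absurd (hCε z (hC z h)) (not_lt.2 hz)
  · refine Subset.antisymm (fun z hz => ?_) fun x₀ hx₀ => ?_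
    · have h1 : ε * g z = 0 := frontier_le_subset_eq hgε continuous_const hz
      exact (hg0 z).1 ((mul_eq_zero.1 h1).resolve_left hε0)
    · refine ⟨subset_closure ?_, fun hint => ?_⟩
      · have : g x₀ = 0 := (hg0 x₀).2 hx₀
        simp [this]
      · -- moving along the normal leaves the set
        obtain ⟨r, s, hs, hzero⟩ := hS.exists_isGraph x₀ hx₀
        have h1 : ∀ᶠ z in 𝓝 x₀, ε * s z ≤ 0 ∧ z ∈ ball x₀ r := by
          filter_upwards [hloc x₀ hx₀ r s hs hzero, mem_interior_iff_mem_nhds.1 hint,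
            ball_mem_nhds x₀ hs.pos] with z h2 h3 h4 using ⟨h2.1 h3, h4⟩
        have h2 : Tendsto (fun τ : ℝ => x₀ + (ε * τ) • N x₀) (𝓝[>] 0) (𝓝 x₀) := by
          have h3 : Continuous fun τ : ℝ => x₀ + (ε * τ) • N x₀ := by fun_prop
          have h4 := h3.tendsto 0
          simp only [mul_zero, zero_smul, add_zero] at h4
          exact h4.mono_left nhdsWithin_le_nhds
        obtain ⟨τ, ⟨h3, h4⟩, h5⟩ := ((h2.eventually h1).and self_mem_nhdsWithin).exists
        have h5 : 0 < τ := h5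
        rw [hs.translate x₀ hs.mem_self _ h4, hs.zero, zero_add, ← mul_assoc] at h3
        have h6 : ε * ε = 1 := by rcases hε with rfl | rfl <;> norm_num
        rw [h6, one_mul] at h3
        linarith

end IsClosedHypersurface

end Separation

/-! ### The domain enclosed by the hypersurface -/

section EnclosedDomain

variable {E : Type*} [NormedAddCommGroup E] [InnerProductSpace ℝ E] [FiniteDimensional ℝ E]
  [CompleteSpace E]

/-- The change of orientation, for `ε = -1`, also changes the prescribed mean curvature. -/
lemma IsGraphFunction.const_mul {k : WithTop ℕ∞} {h : E → ℝ} {N₀ x₀ : E} {r : ℝ} {s : E → ℝ}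
    (hs : IsGraphFunction k h N₀ x₀ r s) {ε : ℝ} (hε : ε = 1 ∨ ε = -1) :
    IsGraphFunction k (fun p => ε * h (ε • p)) (ε • N₀) x₀ r (fun z => ε * s z) := by
  have hεε : ε * ε = 1 := by rcases hε with rfl | rfl <;> norm_num
  have hgrad : gradient (fun z => ε * s z) = fun z => ε • gradient s z := by
    ext1 z
    have : fderiv ℝ (fun z => ε * s z) z = ε • fderiv ℝ s z :=
      congrFun (fderiv_const_smul_field (𝕜 := ℝ) (f := s) ε) z
    rw [gradient, this, map_smul]
    rfl
  have hhess : ∀ z, hessian (fun z => ε * s z) z = ε • hessian s z := by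
    intro z
    rw [hessian, hgrad]
    exact congrFun (fderiv_const_smul_field (𝕜 := ℝ) (f := gradient s) ε) z
  refine ⟨⟨?_, hs.pos, contDiffOn_const.mul hs.contDiffOn, by simp [hs.zero], ?_, ?_⟩, ?_⟩
  · rw [norm_smul, hs.norm_eq_one]
    rcases hε with rfl | rfl <;> simp
  · intro z hz τ hτ
    rw [smul_smul] at hτ ⊢
    rw [hs.translate z hz _ hτ]
    linear_combination τ * hεε
  · simp only [hgrad, hs.gradient_eq]
  · intro z hz
    have h1 := hs.pde z hz
    rw [hhess, hgrad, smul_smul, hεε, one_smul, ← h1]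
    simp only [tangentialTrace]
    rcases hε with rfl | rfl
    · simp
    · simp
      ring

end EnclosedDomain

section Reflection

variable {n : ℕ}

lemma reflection_prescribedTrace {ℋ : sphere (0 : EuclideanSpace ℝ (Fin (n + 1))) 1 → ℝ}
    {v : EuclideanSpace ℝ (Fin (n + 1))}
    (hinv : ∀ x, ℋ (geodesicReflection v x) = ℋ x) (p : EuclideanSpace ℝ (Fin (n + 1))) :
    prescribedTrace ℋ ((ℝ ∙ v)ᗮ.reflection p) = prescribedTrace ℋ p := by
  by_cases hp : p = 0
  · simp [hp]
  have hp' : (ℝ ∙ v)ᗮ.reflection p ≠ 0 := by simpa using hp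
  let x : sphere (0 : EuclideanSpace ℝ (Fin (n + 1))) 1 :=
    ⟨‖p‖⁻¹ • p, by simp [norm_smul, norm_ne_zero_iff.2 hp]⟩
  rw [prescribedTrace_eq hp (x := x) rfl,
    prescribedTrace_eq hp' (x := geodesicReflection v x) (by simp [geodesicReflection, x]),
    hinv, LinearIsometryEquiv.norm_map]

end Reflection

section Enclosed

variable {n : ℕ} {M : Type*} [TopologicalSpace M] [ChartedSpace (EuclideanSpace ℝ (Fin n)) M]
  {k : ℕ∞} {ψ : M → EuclideanSpace ℝ (Fin (n + 1))}
  {ℋ : sphere (0 : EuclideanSpace ℝ (Fin (n + 1))) 1 → ℝ}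
  {η : M → sphere (0 : EuclideanSpace ℝ (Fin (n + 1))) 1}

/-- The hypersurface bounds a domain `K`. If the Gauss map is the inner normal of `K`, then
`ε = -1`, and `K` has outer normal `-η` and mean curvature prescribed by `p ↦ -ℋ (-p)`. -/
lemma IsEmbeddedHHypersurface.exists_isPrescribedDomain [IsManifold (𝓡 n) k M] [CompactSpace M]
    [ConnectedSpace M] (hψ : IsEmbeddedHHypersurface k ℋ ψ η) (hk : 2 ≤ k) (hn : 1 ≤ n) :
    ∃ (K : Set (EuclideanSpace ℝ (Fin (n + 1))))
      (N : EuclideanSpace ℝ (Fin (n + 1)) → EuclideanSpace ℝ (Fin (n + 1))) (ε : ℝ),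
      frontier K = range ψ ∧
      IsPrescribedDomain k (fun p => ε * prescribedTrace ℋ (ε • p)) K N ∧
      ContinuousOn N (range ψ) ∧ (ε = 1 ∨ ε = -1) := by
  have hk1 : (1 : WithTop ℕ∞) ≤ k := WithTop.coe_le_coe.2 (one_le_two.trans hk)
  have hψ1 := hψ.isEmbeddedHypersurface
  have hψc : Continuous ψ := hψ1.contMDiff.continuous
  have hηc : Continuous fun q => (η q : EuclideanSpace ℝ (Fin (n + 1))) :=
    hψ.isGaussMap.contMDiff.continuous
  let e := hψ1.isEmbedding.toHomeomorph
  let N₁ : EuclideanSpace ℝ (Fin (n + 1)) → EuclideanSpace ℝ (Fin (n + 1)) := fun x =>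
    η (Function.invFun ψ x)
  have hN₁ : ∀ p, N₁ (ψ p) = η p := fun p => by
    simp only [N₁, Function.leftInverse_invFun hψ1.isEmbedding.injective p]
  have hNc : ContinuousOn N₁ (range ψ) := by
    rw [continuousOn_iff_continuous_domRestrict]
    have h1 : (range ψ).domRestrict N₁ =
        (fun q => (η q : EuclideanSpace ℝ (Fin (n + 1)))) ∘ e.symm := by
      ext1 x
      obtain ⟨p, rfl⟩ := e.surjective x
      have : (e p : EuclideanSpace ℝ (Fin (n + 1))) = ψ p := rfl
      simp [domRestrict_apply, this, hN₁]
    rw [h1]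
    exact hηc.comp e.symm.continuous
  have hS : IsClosedHypersurface k (range ψ) N₁ := by
    refine ⟨isCompact_range hψc, range_nonempty ψ, isPreconnected_range hψc, hNc, ?_⟩
    rintro _ ⟨p, rfl⟩
    obtain ⟨r, s, χ, hs, hzero, -⟩ := hψ.exists_isGraphFunction hk p
    rw [hN₁]
    exact ⟨r, s, hs.toIsGraph, hzero⟩
  obtain ⟨K, ε, hε, hK, hfr, hloc⟩ := hS.exists_bounded_side hk1 (by
    rw [← Module.finrank_eq_rank, finrank_euclideanSpace_fin]
    exact_mod_cast Nat.lt_add_one_of_le hn)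
  refine ⟨K, fun x => ε • N₁ x, ε, hfr, ⟨hK, ?_, ?_⟩, hNc.const_smul ε, hε⟩
  · by_contra h
    rw [not_nonempty_iff_eq_empty] at h
    rw [h, frontier_empty] at hfr
    exact (range_nonempty ψ).ne_empty hfr.symm
  · intro x hx
    rw [hfr] at hx
    obtain ⟨p, rfl⟩ := hx
    obtain ⟨r, s, χ, hs, hzero, -⟩ := hψ.exists_isGraphFunction hk p
    obtain ⟨r', hr', hr'b⟩ := Metric.eventually_nhds_iff_ball.1
      (hloc _ ⟨p, rfl⟩ r s (by rw [hN₁]; exact hs.toIsGraph) hzero)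
    have h1 := (hs.const_mul hε).mono (lt_min hs.pos hr') (min_le_left r r')
    rw [← hN₁ p] at h1
    exact ⟨_, _, h1, fun z hz => hr'b z (ball_subset_ball (min_le_right _ _) hz)⟩

lemma IsPrescribedDomain.isMovingPlaneDomain
    {K : Set (EuclideanSpace ℝ (Fin (n + 1)))}
    {N : EuclideanSpace ℝ (Fin (n + 1)) → EuclideanSpace ℝ (Fin (n + 1))} {ε : ℝ}
    (hK : IsPrescribedDomain k (fun p => ε * prescribedTrace ℋ (ε • p)) K N)
    (hε : ε = 1 ∨ ε = -1) (hk : 2 ≤ k) (hℋ : ContMDiff (𝓡 n) 𝓘(ℝ, ℝ) 1 ℋ)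
    (hc : IsPreconnected (frontier K)) {v : EuclideanSpace ℝ (Fin (n + 1))} (hv : ‖v‖ = 1)
    (hinv : ∀ x, ℋ (geodesicReflection v x) = ℋ x) :
    IsMovingPlaneDomain k (fun p => ε * prescribedTrace ℋ (ε • p)) K N v where
  toIsPrescribedDomain := hK
  two_le := WithTop.coe_le_coe.2 hk
  contDiffAt p hp := by
    have h1 : ‖ε • p‖ = 1 := by
      rw [norm_smul, hp]
      rcases hε with rfl | rfl <;> simp
    exact contDiffAt_const.mul
      ((contDiffAt_prescribedTrace hℋ h1).comp p (contDiff_const_smul ε).contDiffAt)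
  isPreconnected := hc
  norm_eq_one := hv
  reflection p := by
    rw [← map_smul, reflection_prescribedTrace hinv]

end Enclosed

/-! ### A linear field transverse to the boundary -/

section TransverseField

variable {E : Type*} [NormedAddCommGroup E] [InnerProductSpace ℝ E] [FiniteDimensional ℝ E]
  [CompleteSpace E] {ι : Type*}

/-- If `K` is symmetric and vertically convex in the directions `v i`, then every slice of `K`
orthogonal to the axis `⋂ i, {x | ⟪v i, x⟫ = c i}` contains the point of the axis: a point
of the slice nearest to the axis lies on all the planes of symmetry. -/
lemma axis_mem_of_mem {K : Set E} (hK : IsCompact K) {N : E → E} {v : ι → E} {c : ι → ℝ}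
    (hv : ∀ i, ‖v i‖ = 1) (hS : ∀ i, IsSymmetryHeight K N (v i) (c i)) {e o : E}
    (hve : ∀ i, ⟪v i, e⟫_ℝ = 0) (hspan : ∀ x, (∀ i, ⟪v i, x⟫_ℝ = 0) → x = ⟪e, x⟫_ℝ • e)
    (he : ‖e‖ = 1) (ho : ∀ i, ⟪v i, o⟫_ℝ = c i) {x : E} (hx : x ∈ K) :
    o + ⟪e, x - o⟫_ℝ • e ∈ K := by
  have hee : ⟪e, e⟫_ℝ = 1 := by rw [real_inner_self_eq_norm_sq, he]; norm_num
  obtain ⟨a, ha⟩ : ∃ a, a = o + ⟪e, x - o⟫_ℝ • e := ⟨_, rfl⟩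
  have hva : ∀ i, ⟪v i, a⟫_ℝ = c i := fun i => by
    rw [ha, inner_add_right, inner_smul_right, hve, ho]; ring
  have hea : ⟪e, a⟫_ℝ = ⟪e, x⟫_ℝ := by
    rw [ha, inner_add_right, inner_smul_right, hee, inner_sub_right]; ring
  have hc : IsCompact (K ∩ {y | ⟪e, y⟫_ℝ = ⟪e, x⟫_ℝ}) :=
    hK.inter_right (isClosed_eq (by fun_prop) continuous_const)
  obtain ⟨y, ⟨hyK, hy⟩, hmin⟩ := hc.exists_isMinOn ⟨x, hx, rfl⟩
    (f := fun y => ‖y - a‖ ^ 2) (by fun_prop)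
  have hye : ⟪e, y⟫_ℝ = ⟪e, x⟫_ℝ := hy
  have h1 : ∀ i, ⟪v i, y - a⟫_ℝ = 0 := by
    intro i
    have h2 := (hS i).verticalPoint_zero_mem (hv i) hyK
    have h3 : verticalPoint (c i) (orthogonalPart (hv i) y) 0 = y - ⟪v i, y - a⟫_ℝ • v i := by
      have h4 := verticalPoint_sub_smul (v := v i) (c := c i) (w := orthogonalPart (hv i) y)
        (σ := ⟪v i, y⟫_ℝ - c i) (⟪v i, y⟫_ℝ - c i)
      rw [sub_self, verticalPoint_orthogonalPart] at h4
      rw [← h4, inner_sub_right, hva]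
    rw [h3] at h2
    have h5 : ‖y - a‖ ^ 2 ≤ ‖y - ⟪v i, y - a⟫_ℝ • v i - a‖ ^ 2 := by
      refine hmin ⟨h2, ?_⟩
      change ⟪e, y - ⟪v i, y - a⟫_ℝ • v i⟫_ℝ = _
      rw [inner_sub_right, inner_smul_right, real_inner_comm (v i) e, hve, mul_zero, sub_zero, hye]
    have h6 : y - ⟪v i, y - a⟫_ℝ • v i - a = (y - a) - ⟪v i, y - a⟫_ℝ • v i := by abel
    rw [h6, norm_sub_sq_real (y - a), inner_smul_right, real_inner_comm (v i), norm_smul, hv,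
      mul_one, Real.norm_eq_abs, sq_abs] at h5
    nlinarith [sq_nonneg ⟪v i, y - a⟫_ℝ]
  have h2 := hspan _ h1
  rw [inner_sub_right, hye, hea, sub_self, zero_smul, sub_eq_zero] at h2
  rw [← ha, ← h2]
  exact hyK

/-- On a compact set, a function that is positive on the zero set of a nonnegative function becomes
positive everywhere after adding a large multiple of the latter. -/
lemma IsCompact.exists_mul_add_pos {X : Type*} [TopologicalSpace X] [T2Space X] {S : Set X}
    (hS : IsCompact S)
    {f g : X → ℝ} (hf : ContinuousOn f S) (hg : ContinuousOn g S) (hf0 : ∀ x ∈ S, 0 ≤ f x)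
    (hfg : ∀ x ∈ S, f x = 0 → 0 < g x) : ∃ C > 0, ∀ x ∈ S, 0 < C * f x + g x := by
  have hS' : IsCompact (S ∩ g ⁻¹' Iic 0) :=
    hS.of_isClosed_subset (hg.preimage_isClosed_of_isClosed hS.isClosed isClosed_Iic)
      inter_subset_left
  rcases (S ∩ g ⁻¹' Iic 0).eq_empty_or_nonempty with hem | hne
  · refine ⟨1, one_pos, fun x hx => ?_⟩
    have h1 : 0 < g x := not_le.1 fun h => hem.subset ⟨hx, h⟩
    linarith [hf0 x hx]
  obtain ⟨x₁, hx₁, h₁⟩ := hS'.exists_isMinOn hne (hf.mono inter_subset_left)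
  obtain ⟨x₂, hx₂, h₂⟩ := hS.exists_isMinOn (hne.mono inter_subset_left) hg
  have hm : 0 < f x₁ := (hf0 x₁ hx₁.1).lt_of_ne' fun h => not_lt.2 hx₁.2 (hfg x₁ hx₁.1 h)
  refine ⟨(|g x₂| + 1) / f x₁, by positivity, fun x hx => ?_⟩
  rcases le_or_gt (g x) 0 with h | h
  · have h3 : f x₁ ≤ f x := h₁ ⟨hx, h⟩
    have h4 : g x₂ ≤ g x := h₂ hx
    have h5 : |g x₂| + 1 ≤ (|g x₂| + 1) / f x₁ * f x := by
      rw [div_mul_eq_mul_div, le_div_iff₀ hm]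
      gcongr
    linarith [neg_abs_le (g x₂)]
  · have := hf0 x hx
    positivity

lemma exists_add_smul_mem_of_mem_interior {K : Set E} {x : E} (hx : x ∈ interior K) (w : E) :
    ∃ τ : ℝ, 0 < τ ∧ x + τ • w ∈ K := by
  have h1 : Tendsto (fun τ : ℝ => x + τ • w) (𝓝[>] 0) (𝓝 x) := by
    have h3 : Continuous fun τ : ℝ => x + τ • w := by fun_prop
    have h4 := h3.tendsto 0
    simp only [zero_smul, add_zero] at h4
    exact h4.mono_left nhdsWithin_le_nhds
  obtain ⟨τ, h2, h3⟩ := ((h1.eventually (mem_interior_iff_mem_nhds.1 hx)).and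
    self_mem_nhdsWithin).exists
  exact ⟨τ, h3, h2⟩

/-- The field is `C • ∑ i, ⟪v i, ·⟫ v i + ⟪e, ·⟫ e` around the centre `p` of the segment in which
`K` meets its axis. By the sign of the normal on both sides of each plane of symmetry, the first part
does not point inwards, and is tangent to the boundary only on the axis; at the two boundary points
there, the second part points outwards. -/
theorem exists_transverse_field [Fintype ι] {k : WithTop ℕ∞} (hk : 1 ≤ k) {h : E → ℝ} {K : Set E}
    {N : E → E} (hK : IsPrescribedDomain k h K N) (hNc : ContinuousOn N (frontier K))
    (hc : IsPreconnected (frontier K)) {v : ι → E} {c : ι → ℝ}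
    (hv : ∀ i, ‖v i‖ = 1) (hS : ∀ i, IsSymmetryHeight K N (v i) (c i)) {e o : E}
    (hve : ∀ i, ⟪v i, e⟫_ℝ = 0) (hspan : ∀ x, (∀ i, ⟪v i, x⟫_ℝ = 0) → x = ⟪e, x⟫_ℝ • e)
    (he : ‖e‖ = 1) (ho : ∀ i, ⟪v i, o⟫_ℝ = c i) :
    ∃ (B : E →L[ℝ] E) (p : E), p ∈ interior K ∧ (∀ x, x ≠ 0 → 0 < ⟪x, B x⟫_ℝ) ∧
      ∀ x ∈ frontier K, 0 < ⟪N x, B (x - p)⟫_ℝ := by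
  have hee : ⟪e, e⟫_ℝ = 1 := by rw [real_inner_self_eq_norm_sq, he]; norm_num
  have haxis : ∀ x ∈ K, o + ⟪e, x - o⟫_ℝ • e ∈ K := fun x hx =>
    axis_mem_of_mem hK.isCompact hv hS hve hspan he ho hx
  have hcl : IsClosed K := hK.isCompact.isClosed
  have hfK : frontier K ⊆ K := hcl.frontier_subset
  -- the height along the axis
  let H : E → ℝ := fun x => ⟪e, x - o⟫_ℝ
  have hH : Continuous H := by fun_prop
  have hHadd : ∀ x (τ : ℝ), H (x + τ • e) = H x + τ := fun x τ => by
    simp only [H]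
    rw [add_sub_right_comm, inner_add_right, inner_smul_right, hee, mul_one]
  have hHo : H o = 0 := by simp [H]
  obtain ⟨b, hbK, hb⟩ := hK.isCompact.exists_isMinOn hK.nonempty hH.continuousOn
  obtain ⟨t, htK, ht⟩ := hK.isCompact.exists_isMaxOn hK.nonempty hH.continuousOn
  have hb' : ∀ x ∈ K, H b ≤ H x := fun x hx => hb hx
  have ht' : ∀ x ∈ K, H x ≤ H t := fun x hx => ht hx
  have htF : t ∈ frontier K := by
    refine ⟨subset_closure htK, fun hint => ?_⟩
    obtain ⟨τ, h1, h2⟩ := exists_add_smul_mem_of_mem_interior hint e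
    have h3 := ht' _ h2
    rw [hHadd] at h3
    linarith
  have hbF : b ∈ frontier K := by
    refine ⟨subset_closure hbK, fun hint => ?_⟩
    obtain ⟨τ, h1, h2⟩ := exists_add_smul_mem_of_mem_interior hint (-e)
    have h3 := hb' _ h2
    rw [smul_neg, ← neg_smul, hHadd] at h3
    linarith
  -- `K` meets the axis in a segment
  have hseg : ∀ τ ∈ Icc (H b) (H t), o + τ • e ∈ K := by
    intro τ hτ
    obtain ⟨x, hx, rfl⟩ := hc.intermediate_value hbF htF hH.continuousOn hτ
    exact haxis x (hfK hx)
  -- the boundary meets the axis only at the ends of the segment, where it is horizontal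
  have hends : ∀ x ∈ frontier K, (∀ i, ⟪v i, x⟫_ℝ = c i) →
      (N x = e ∧ H x = H t) ∨ (N x = -e ∧ H x = H b) := by
    intro x hx hxc
    obtain ⟨r, s, hs⟩ := hK.exists_isLocalDefining x hx
    have hxo : x = o + H x • e := by
      have := hspan (x - o) fun i => by rw [inner_sub_right, hxc, ho, sub_self]
      rw [← this]; abel
    have h1 := hspan (N x) fun i => (hS i).normal_eq_zero x hx (hxc i)
    have h2 : |⟪e, N x⟫_ℝ| = 1 := by
      have := hs.norm_eq_one
      rwa [h1, norm_smul, he, mul_one, Real.norm_eq_abs] at this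
    rcases (abs_eq zero_le_one).1 h2 with h3 | h3
    · rw [h3, one_smul] at h1
      refine Or.inl ⟨h1, (ht' x (hfK hx)).antisymm (not_lt.1 fun hlt => ?_)⟩
      have h4 := hs.eventually_notMem hk (w := e) (by rw [h1, hee]; exact one_pos)
      obtain ⟨τ, h5, h6, h7⟩ := (h4.and (Filter.Eventually.and self_mem_nhdsWithin
        (nhdsWithin_le_nhds (Iio_mem_nhds (sub_pos.2 hlt))))).exists
      have h6 : 0 < τ := h6
      have h7 : τ < H t - H x := h7
      refine h5 ?_
      rw [hxo, add_assoc, ← add_smul]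
      exact hseg _ ⟨by linarith [hb' x (hfK hx)], by linarith⟩
    · rw [h3, neg_one_smul] at h1
      refine Or.inr ⟨h1, (not_lt.1 fun hlt => ?_ : H x ≤ H b).antisymm (hb' x (hfK hx))⟩
      have h4 := hs.eventually_notMem hk (w := -e) (by rw [h1, inner_neg_neg, hee]; exact one_pos)
      obtain ⟨τ, h5, h6, h7⟩ := (h4.and (Filter.Eventually.and self_mem_nhdsWithin
        (nhdsWithin_le_nhds (Iio_mem_nhds (sub_pos.2 hlt))))).exists
      have h6 : 0 < τ := h6
      have h7 : τ < H x - H b := h7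
      refine h5 ?_
      rw [hxo, add_assoc, smul_neg, ← neg_smul, ← add_smul]
      exact hseg _ ⟨by linarith, by linarith [ht' x (hfK hx)]⟩
  have hbt : H b < H t := by
    refine lt_of_le_of_ne (hb' t htK) fun heq => ?_
    have hconst : ∀ x ∈ K, H x = H b := fun x hx => (heq ▸ ht' x hx).antisymm (hb' x hx)
    obtain ⟨r, s, hs⟩ := hK.exists_isLocalDefining t htF
    obtain ⟨τ, h1⟩ := (hs.eventually_mem_interior hk (w := -N t) (by
      rw [inner_neg_right, real_inner_self_eq_norm_sq, hs.norm_eq_one]; norm_num)).exists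
    obtain ⟨y, hy⟩ : ∃ y, y ∈ interior K := ⟨_, h1⟩
    obtain ⟨τ, h2, h3⟩ := exists_add_smul_mem_of_mem_interior hy e
    have h4 := hconst _ h3
    rw [hHadd, hconst y (interior_subset hy)] at h4
    linarith
  -- the centre of the segment
  let p : E := o + ((H b + H t) / 2) • e
  have hHp : H p = (H b + H t) / 2 := by rw [hHadd, hHo, zero_add]
  have hvp : ∀ i, ⟪v i, p⟫_ℝ = c i := fun i => by
    rw [inner_add_right, inner_smul_right, hve, ho]; ring
  have hpK : p ∈ interior K := by
    by_contra hp
    have h1 : p ∈ frontier K := ⟨subset_closure (hseg _ ⟨by linarith, by linarith⟩), hp⟩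
    rcases hends p h1 hvp with ⟨-, h2⟩ | ⟨-, h2⟩ <;> linarith
  let A : E →L[ℝ] E := ∑ i, (innerSL ℝ (v i)).smulRight (v i)
  let P : E →L[ℝ] E := (innerSL ℝ e).smulRight e
  have hA : ∀ x y, ⟪y, A x⟫_ℝ = ∑ i, ⟪v i, x⟫_ℝ * ⟪v i, y⟫_ℝ := fun x y => by
    simp only [A, sum_apply, ContinuousLinearMap.smulRight_apply,
      innerSL_apply_apply, inner_sum, inner_smul_right]
    exact Finset.sum_congr rfl fun i _ => by rw [real_inner_comm y]
  have hP : ∀ x y, ⟪y, P x⟫_ℝ = ⟪e, x⟫_ℝ * ⟪e, y⟫_ℝ := fun x y => by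
    simp only [P, ContinuousLinearMap.smulRight_apply, innerSL_apply_apply, inner_smul_right]
    rw [real_inner_comm y]
  have hterm : ∀ x ∈ frontier K, ∀ i, 0 ≤ ⟪v i, x - p⟫_ℝ * ⟪v i, N x⟫_ℝ ∧
      (⟪v i, x - p⟫_ℝ * ⟪v i, N x⟫_ℝ = 0 → ⟪v i, x⟫_ℝ = c i) := by
    intro x hx i
    rw [inner_sub_right, hvp]
    rcases lt_trichotomy ⟪v i, x⟫_ℝ (c i) with h1 | h1 | h1
    · have h2 := mul_pos_of_neg_of_neg (sub_neg.2 h1) ((hS i).normal_neg x hx h1)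
      exact ⟨h2.le, fun h3 => absurd h3 h2.ne'⟩
    · simp [h1]
    · have h2 := mul_pos (sub_pos.2 h1) ((hS i).normal_pos x hx h1)
      exact ⟨h2.le, fun h3 => absurd h3 h2.ne'⟩
  obtain ⟨C, hC, hpos⟩ := (hK.isCompact.of_isClosed_subset isClosed_frontier hfK).exists_mul_add_pos
    (f := fun x => ⟪N x, A (x - p)⟫_ℝ) (g := fun x => ⟪N x, P (x - p)⟫_ℝ)
    (hNc.inner (by fun_prop)) (hNc.inner (by fun_prop))
    (fun x hx => by rw [hA]; exact Finset.sum_nonneg fun i _ => (hterm x hx i).1)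
    (fun x hx h0 => by
      rw [hA, Finset.sum_eq_zero_iff_of_nonneg fun i _ => (hterm x hx i).1] at h0
      have hHx : ⟪e, x - p⟫_ℝ = H x - H p := by simp only [H, ← inner_sub_right]; congr 1; abel
      rw [hP, hHx, hHp]
      rcases hends x hx fun i => (hterm x hx i).2 (h0 i (Finset.mem_univ i)) with
        ⟨h1, h2⟩ | ⟨h1, h2⟩
      · rw [h1, h2, hee]; linarith
      · rw [h1, h2, inner_neg_right, hee]; linarith)
  refine ⟨C • A + P, p, hpK, fun x hx => ?_, fun x hx => ?_⟩
  · simp only [add_apply, smul_apply, inner_add_right,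
      inner_smul_right, hA, hP]
    have h1 : 0 ≤ ∑ i, ⟪v i, x⟫_ℝ * ⟪v i, x⟫_ℝ := Finset.sum_nonneg fun i _ => mul_self_nonneg _
    rcases h1.eq_or_lt with h2 | h2
    · have h3 := (Finset.sum_eq_zero_iff_of_nonneg fun i _ => mul_self_nonneg _).1 h2.symm
      have h4 := hspan x fun i => mul_self_eq_zero.1 (h3 i (Finset.mem_univ i))
      have h5 : ⟪e, x⟫_ℝ ≠ 0 := fun h0 => hx (by rw [h4, h0, zero_smul])
      rw [← h2, mul_zero, zero_add]
      exact mul_self_pos.2 h5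
    · exact add_pos_of_pos_of_nonneg (mul_pos hC h2) (mul_self_nonneg _)
  · have := hpos x hx
    simpa only [add_apply, smul_apply, inner_add_right,
      inner_smul_right] using this

end TransverseField

/-! ### Flows of expanding linear fields -/

section LinearFlow

variable {E : Type*} [NormedAddCommGroup E] [InnerProductSpace ℝ E] [FiniteDimensional ℝ E]
  [CompleteSpace E] (B : E →L[ℝ] E)

/-- The flow of the linear vector field `B`. -/
noncomputable def linearFlow (t : ℝ) (y : E) : E := NormedSpace.exp (t • B) y

@[simp] lemma linearFlow_zero (y : E) : linearFlow B 0 y = y := by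
  simp [linearFlow]

lemma linearFlow_add (s t : ℝ) (y : E) :
    linearFlow B (s + t) y = linearFlow B s (linearFlow B t y) := by
  have h1 : NormedSpace.exp (s • B + t • B) = NormedSpace.exp (s • B) * NormedSpace.exp (t • B) :=
    NormedSpace.exp_add_of_commute_of_mem_ball (𝕂 := ℝ)
      (((Commute.refl B).smul_left s).smul_right t)
      ((NormedSpace.expSeries_radius_eq_top ℝ (E →L[ℝ] E)).symm ▸ edist_lt_top _ _)
      ((NormedSpace.expSeries_radius_eq_top ℝ (E →L[ℝ] E)).symm ▸ edist_lt_top _ _)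
  rw [linearFlow, add_smul, h1]
  rfl

lemma linearFlow_neg_linearFlow (t : ℝ) (y : E) : linearFlow B (-t) (linearFlow B t y) = y := by
  rw [← linearFlow_add, neg_add_cancel, linearFlow_zero]

lemma linearFlow_ne_zero (t : ℝ) {y : E} (hy : y ≠ 0) : linearFlow B t y ≠ 0 := by
  intro h
  have h1 := linearFlow_neg_linearFlow B t y
  rw [h] at h1
  exact hy (by rw [← h1]; simp [linearFlow])

lemma hasDerivAt_linearFlow (t : ℝ) (y : E) :
    HasDerivAt (fun t => linearFlow B t y) (B (linearFlow B t y)) t := by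
  have h1 := hasDerivAt_exp_smul_const' B t
  exact (h1.clm_apply (hasDerivAt_const t y)).congr_deriv (by simp [linearFlow])

lemma contDiff_linearFlow {m : WithTop ℕ∞} :
    ContDiff ℝ m fun q : E × ℝ => linearFlow B q.2 q.1 := by
  have h1 : ContDiff ℝ m (NormedSpace.exp : (E →L[ℝ] E) → E →L[ℝ] E) :=
    contDiff_iff_contDiffAt.2 fun X => (NormedSpace.exp_analytic (𝕂 := ℝ) X).contDiffAt
  exact (h1.comp (contDiff_snd.smul contDiff_const)).clm_apply contDiff_fst

variable {B}

/-- The flow of a positive definite linear vector field is expanding. -/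
lemma exists_norm_linearFlow (hB : ∀ x, x ≠ 0 → 0 < ⟪x, B x⟫_ℝ) :
    ∃ l > 0, ∀ y, Monotone fun t => ‖linearFlow B t y‖ ^ 2 * Real.exp (-(l * t)) := by
  obtain ⟨l, hl, hlB⟩ : ∃ l > 0, ∀ x, l * ‖x‖ ^ 2 ≤ ⟪x, B x⟫_ℝ := by
    rcases (sphere (0 : E) 1).eq_empty_or_nonempty with hem | hne
    · refine ⟨1, one_pos, fun x => ?_⟩
      have hx : x = 0 := by
        by_contra hx
        exact hem.subset (show ‖x‖⁻¹ • x ∈ sphere (0 : E) 1 by simp [norm_smul, hx])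
      simp [hx]
    · obtain ⟨x₀, hx₀, hmin⟩ := (isCompact_sphere (0 : E) 1).exists_isMinOn hne
        (f := fun x => ⟪x, B x⟫_ℝ) (by fun_prop)
      refine ⟨⟪x₀, B x₀⟫_ℝ, hB x₀ (ne_zero_of_mem_unit_sphere ⟨x₀, hx₀⟩), fun x => ?_⟩
      by_cases hx : x = 0
      · simp [hx]
      have hx' : ‖x‖ ≠ 0 := norm_ne_zero_iff.2 hx
      have h1 : ⟪x₀, B x₀⟫_ℝ ≤ ⟪‖x‖⁻¹ • x, B (‖x‖⁻¹ • x)⟫_ℝ :=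
        hmin (show ‖x‖⁻¹ • x ∈ sphere (0 : E) 1 by simp [norm_smul, hx])
      rw [map_smul, inner_smul_left, inner_smul_right] at h1
      calc ⟪x₀, B x₀⟫_ℝ * ‖x‖ ^ 2 ≤ ‖x‖⁻¹ * (‖x‖⁻¹ * ⟪x, B x⟫_ℝ) * ‖x‖ ^ 2 := by
            gcongr
            simpa using h1
        _ = ⟪x, B x⟫_ℝ := by field_simp
  refine ⟨2 * l, by positivity, fun y => ?_⟩
  have hd : ∀ t, HasDerivAt (fun t => ‖linearFlow B t y‖ ^ 2 * Real.exp (-(2 * l * t)))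
      ((2 * ⟪linearFlow B t y, B (linearFlow B t y)⟫_ℝ) * Real.exp (-(2 * l * t)) +
        ‖linearFlow B t y‖ ^ 2 * (Real.exp (-(2 * l * t)) * -(2 * l))) t := by
    intro t
    have h2 : HasDerivAt (fun t : ℝ => -(2 * l * t)) (-(2 * l)) t := by
      exact ((hasDerivAt_id t).const_mul (2 * l)).fun_neg.congr_deriv (by simp)
    exact (hasDerivAt_linearFlow B t y).norm_sq.mul h2.exp
  refine monotone_of_deriv_nonneg (fun t => (hd t).differentiableAt) fun t => ?_
  rw [(hd t).deriv]
  have h3 := hlB (linearFlow B t y)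
  have h4 : 0 ≤ (⟪linearFlow B t y, B (linearFlow B t y)⟫_ℝ - l * ‖linearFlow B t y‖ ^ 2) *
      Real.exp (-(2 * l * t)) := mul_nonneg (sub_nonneg.2 h3) (Real.exp_pos _).le
  linarith

lemma tendsto_linearFlow_atBot (hB : ∀ x, x ≠ 0 → 0 < ⟪x, B x⟫_ℝ) (y : E) :
    Tendsto (fun t => linearFlow B t y) atBot (𝓝 0) := by
  obtain ⟨l, hl, hmono⟩ := exists_norm_linearFlow hB
  rw [tendsto_zero_iff_norm_tendsto_zero]
  have h1 : Tendsto (fun t : ℝ => ‖y‖ ^ 2 * Real.exp (l * t)) atBot (𝓝 0) := by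
    have h2 : Tendsto (fun t : ℝ => l * t) atBot atBot := tendsto_id.const_mul_atBot hl
    simpa using (Real.tendsto_exp_atBot.comp h2).const_mul (‖y‖ ^ 2)
  have h3 : Tendsto (fun t => ‖linearFlow B t y‖ ^ 2) atBot (𝓝 0) := by
    refine squeeze_zero' (Eventually.of_forall fun t => sq_nonneg _) ?_ h1
    filter_upwards [eventually_le_atBot 0] with t ht
    have h4 := hmono y ht
    simp only [linearFlow_zero, mul_zero, neg_zero, Real.exp_zero, mul_one, Real.exp_neg] at h4
    rwa [← div_eq_mul_inv, div_le_iff₀ (Real.exp_pos _)] at h4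
  have h5 := h3.sqrt
  simpa using h5

lemma tendsto_norm_linearFlow_atTop (hB : ∀ x, x ≠ 0 → 0 < ⟪x, B x⟫_ℝ) {y : E} (hy : y ≠ 0) :
    Tendsto (fun t => ‖linearFlow B t y‖) atTop atTop := by
  obtain ⟨l, hl, hmono⟩ := exists_norm_linearFlow hB
  have h1 : Tendsto (fun t : ℝ => ‖y‖ ^ 2 * Real.exp (l * t)) atTop atTop := by
    have h2 : Tendsto (fun t : ℝ => l * t) atTop atTop := tendsto_id.const_mul_atTop hl
    exact (Real.tendsto_exp_atTop.comp h2).const_mul_atTop (by positivity)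
  have h3 : Tendsto (fun t => ‖linearFlow B t y‖ ^ 2) atTop atTop := by
    refine tendsto_atTop_mono' _ ?_ h1
    filter_upwards [eventually_ge_atTop 0] with t ht
    have h4 := hmono y ht
    simp only [linearFlow_zero, mul_zero, neg_zero, Real.exp_zero, mul_one, Real.exp_neg] at h4
    rwa [← div_eq_mul_inv, le_div_iff₀ (Real.exp_pos _)] at h4
  have h5 := Real.tendsto_sqrt_atTop.comp h3
  refine h5.congr fun t => ?_
  simp

end LinearFlow

/-! ### The exit time of a domain -/

section ExitTime

variable {E : Type*} [NormedAddCommGroup E] [InnerProductSpace ℝ E] [FiniteDimensional ℝ E]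
  [CompleteSpace E]

/-- `K` is a compact neighbourhood of `o` whose boundary is of class `C^k` and is crossed outwards
by the expanding linear vector field `x ↦ B (x - o)`. -/
structure IsTransverseDomain (k : WithTop ℕ∞) (B : E →L[ℝ] E) (o : E) (K : Set E) : Prop where
  one_le : 1 ≤ k
  pos : ∀ x, x ≠ 0 → 0 < ⟪x, B x⟫_ℝ
  isCompact : IsCompact K
  mem_interior : o ∈ interior K
  exists_defining : ∀ x ∈ frontier K, ∃ s : E → ℝ, ContDiffAt ℝ k s x ∧ s x = 0 ∧
    (∀ᶠ z in 𝓝 x, (z ∈ K ↔ s z ≤ 0) ∧ (z ∈ frontier K ↔ s z = 0)) ∧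
    0 < fderiv ℝ s x (B (x - o))

/-- The time at which the flow of `B` started at `y` leaves `K - o`. -/
noncomputable def exitTime (B : E →L[ℝ] E) (o : E) (K : Set E) (y : E) : ℝ :=
  sSup {t | o + linearFlow B t y ∈ K}

namespace IsTransverseDomain

variable {k : WithTop ℕ∞} {B : E →L[ℝ] E} {o : E} {K : Set E}

lemma hasDerivAt_defining (hK : IsTransverseDomain k B o K) {t : ℝ} {y : E} {s : E → ℝ}
    (hs : ContDiffAt ℝ k s (o + linearFlow B t y)) :
    HasDerivAt (fun t => s (o + linearFlow B t y))
      (fderiv ℝ s (o + linearFlow B t y) (B (o + linearFlow B t y - o))) t := by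
  rw [add_sub_cancel_left]
  exact (hs.differentiableAt (zero_lt_one.trans_le hK.one_le).ne').hasFDerivAt.comp_hasDerivAt t
    ((hasDerivAt_linearFlow B t y).const_add o)

lemma eventually_mem_iff (hK : IsTransverseDomain k B o K) {t : ℝ} {y : E}
    (ht : o + linearFlow B t y ∈ frontier K) :
    ∀ᶠ τ in 𝓝 t, o + linearFlow B τ y ∈ K ↔ τ ≤ t := by
  obtain ⟨s, hs, h0, hmem, hpos⟩ := hK.exists_defining _ ht
  have h1 := hK.hasDerivAt_defining hs
  have h2 := eventually_nhdsWithin_sign_eq_of_deriv_pos (h1.deriv.symm ▸ hpos) h0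
  have hc : ContinuousAt (fun τ => o + linearFlow B τ y) t :=
    ((hasDerivAt_linearFlow B t y).const_add o).continuousAt
  filter_upwards [h2, hc.eventually hmem] with τ h3 h4
  rw [h4.1, ← not_lt, ← not_lt, ← sign_eq_one_iff, h3, sign_eq_one_iff, sub_pos]

lemma setOf_mem_eq (hK : IsTransverseDomain k B o K) {y : E} (hy : y ≠ 0) :
    {t | o + linearFlow B t y ∈ K} = Iic (exitTime B o K y) := by
  let T := {t | o + linearFlow B t y ∈ K}
  have hcont : Continuous fun τ => o + linearFlow B τ y := continuous_iff_continuousAt.2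
    fun t => ((hasDerivAt_linearFlow B t y).const_add o).continuousAt
  have hTc : IsClosed T := hK.isCompact.isClosed.preimage hcont
  have hleft : ∀ t ∈ T, ∀ᶠ τ in 𝓝[<] t, τ ∈ T := by
    intro t ht
    by_cases hf : o + linearFlow B t y ∈ frontier K
    · filter_upwards [nhdsWithin_le_nhds (hK.eventually_mem_iff hf), self_mem_nhdsWithin]
        with τ h1 h2 using h1.2 (le_of_lt h2)
    · have h1 : o + linearFlow B t y ∈ interior K := by
        by_contra h
        exact hf ⟨subset_closure ht, h⟩
      exact nhdsWithin_le_nhds (hcont.continuousAt.eventually (mem_interior_iff_mem_nhds.1 h1))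
  have hne : T.Nonempty := by
    have h1 : Tendsto (fun t => o + linearFlow B t y) atBot (𝓝 o) := by
      simpa using (tendsto_linearFlow_atBot hK.pos y).const_add o
    exact (h1.eventually (mem_interior_iff_mem_nhds.1 hK.mem_interior)).exists
  have hbdd : BddAbove T := by
    obtain ⟨R, hR⟩ := hK.isCompact.isBounded.subset_closedBall o
    obtain ⟨t₀, ht₀⟩ := eventually_atTop.1
      ((tendsto_norm_linearFlow_atTop hK.pos hy).eventually_gt_atTop R)
    refine ⟨t₀, fun t ht => not_lt.1 fun hlt => ?_⟩
    have h1 := hR ht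
    rw [mem_closedBall, dist_eq_norm, add_sub_cancel_left] at h1
    linarith [ht₀ t hlt.le]
  have hsup : sSup T ∈ T := hTc.csSup_mem hne hbdd
  refine Subset.antisymm (fun t ht => le_csSup hbdd ht) fun t ht => ?_
  have ht : t ≤ sSup T := ht
  -- the least element of `T ∩ [t, sup T]` is `t`, since `T` is open to the left
  have hcpt : IsCompact (T ∩ Icc t (sSup T)) := isCompact_Icc.inter_left hTc
  have hne' : (T ∩ Icc t (sSup T)).Nonempty := ⟨sSup T, hsup, ht, le_rfl⟩
  obtain ⟨hm, hm'⟩ := hcpt.sInf_mem hne'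
  rcases hm'.1.eq_or_lt with heq | hlt
  · rw [← heq] at hm; exact hm
  · obtain ⟨τ, h1, h2⟩ := ((hleft _ hm).and (Ioo_mem_nhdsLT hlt)).exists
    have h3 := csInf_le hcpt.bddBelow ⟨h1, h2.1.le, h2.2.le.trans hm'.2⟩
    exact absurd h2.2 (not_lt.2 h3)

lemma mem_iff_le_exitTime (hK : IsTransverseDomain k B o K) {y : E} (hy : y ≠ 0) {t : ℝ} :
    o + linearFlow B t y ∈ K ↔ t ≤ exitTime B o K y := by
  have := hK.setOf_mem_eq hy
  exact Set.ext_iff.1 this t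

lemma mem_frontier_iff (hK : IsTransverseDomain k B o K) {y : E} (hy : y ≠ 0) {t : ℝ} :
    o + linearFlow B t y ∈ frontier K ↔ exitTime B o K y = t := by
  constructor
  · intro ht
    have h1 := (hK.mem_iff_le_exitTime hy).1 (hK.isCompact.isClosed.frontier_subset ht)
    refine le_antisymm (not_lt.1 fun hlt => ?_) h1
    obtain ⟨τ, h2, h3⟩ := (Filter.Eventually.and
      (nhdsWithin_le_nhds (hK.eventually_mem_iff ht)) (Ioo_mem_nhdsGT hlt)).exists
    exact absurd (h2.1 ((hK.mem_iff_le_exitTime hy).2 h3.2.le)) (not_le.2 h3.1)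
  · rintro rfl
    refine ⟨subset_closure ((hK.mem_iff_le_exitTime hy).2 le_rfl), fun hint => ?_⟩
    have hc : ContinuousAt (fun τ => o + linearFlow B τ y) (exitTime B o K y) :=
      ((hasDerivAt_linearFlow B _ y).const_add o).continuousAt
    obtain ⟨τ, h1, h2⟩ := (Filter.Eventually.and (nhdsWithin_le_nhds (hc.eventually
      (mem_interior_iff_mem_nhds.1 hint)))
      (self_mem_nhdsWithin (s := Ioi (exitTime B o K y)))).exists
    exact absurd ((hK.mem_iff_le_exitTime hy).1 h1) (not_le.2 h2)

lemma contDiffAt_exitTime (hK : IsTransverseDomain k B o K) {y : E} (hy : y ≠ 0) :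
    ContDiffAt ℝ k (exitTime B o K) y := by
  have hf := (hK.mem_frontier_iff hy).2 rfl
  obtain ⟨s, hs, h0, hmem, hpos⟩ := hK.exists_defining _ hf
  have hflow : ContDiff ℝ k fun q : E × ℝ => o + linearFlow B q.2 q.1 :=
    contDiff_const.add (contDiff_linearFlow B)
  refine contDiffAt_of_implicit hK.one_le
    (F := fun q : E × ℝ => s (o + linearFlow B q.2 q.1)) (t₀ := exitTime B o K y)
    (ContDiffAt.comp (y, exitTime B o K y) hs hflow.contDiffAt)
    (hK.hasDerivAt_defining hs) hpos.ne' ?_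
  have h1 : ContinuousAt (fun q : E × ℝ => o + linearFlow B q.2 q.1) (y, exitTime B o K y) :=
    hflow.continuous.continuousAt
  have h2 : ∀ᶠ q : E × ℝ in 𝓝 (y, exitTime B o K y), q.1 ≠ 0 :=
    continuousAt_fst.eventually_ne hy
  filter_upwards [h1.eventually hmem, h2] with q h3 h4 h5
  rw [← hK.mem_frontier_iff h4, h3.2, h5]
  exact h0

end IsTransverseDomain

/-- The point at which the flow of `B` around `o` started at `o + y` leaves `K`. -/
noncomputable def exitPoint (B : E →L[ℝ] E) (o : E) (K : Set E) (y : E) : E :=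
  o + linearFlow B (exitTime B o K y) y

namespace IsTransverseDomain

variable {k : WithTop ℕ∞} {B : E →L[ℝ] E} {o : E} {K : Set E}

lemma exitPoint_mem (hK : IsTransverseDomain k B o K) {y : E} (hy : y ≠ 0) :
    exitPoint B o K y ∈ frontier K :=
  (hK.mem_frontier_iff hy).2 rfl

lemma contDiffAt_exitPoint (hK : IsTransverseDomain k B o K) {y : E} (hy : y ≠ 0) :
    ContDiffAt ℝ k (exitPoint B o K) y :=
  contDiffAt_const.add ((contDiff_linearFlow B).contDiffAt.comp y
    (contDiffAt_id.prodMk (hK.contDiffAt_exitTime hy)))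

lemma exitPoint_linearFlow (hK : IsTransverseDomain k B o K) {y : E} (hy : y ≠ 0) (t : ℝ) :
    exitPoint B o K (linearFlow B t y) = exitPoint B o K y := by
  have h1 : exitTime B o K (linearFlow B t y) = exitTime B o K y - t := by
    rw [← hK.mem_frontier_iff (linearFlow_ne_zero B t hy), ← linearFlow_add, sub_add_cancel]
    exact hK.exitPoint_mem hy
  rw [exitPoint, h1, ← linearFlow_add, sub_add_cancel, exitPoint]

lemma ne_of_mem_frontier (hK : IsTransverseDomain k B o K) {x : E} (hx : x ∈ frontier K) :
    x - o ≠ 0 :=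
  sub_ne_zero.2 fun h => hx.2 (h ▸ hK.mem_interior)

lemma exitPoint_sub (hK : IsTransverseDomain k B o K) {x : E} (hx : x ∈ frontier K) :
    exitPoint B o K (x - o) = x := by
  have h1 : exitTime B o K (x - o) = 0 := by
    rw [← hK.mem_frontier_iff (hK.ne_of_mem_frontier hx)]
    simpa using hx
  rw [exitPoint, h1, linearFlow_zero, add_sub_cancel]

/-- Following the flow lines identifies the boundaries of any two domains that are transverse to
the same linear vector field. -/
lemma exitPoint_exitPoint_sub {o' : E} {K' : Set E} (hK : IsTransverseDomain k B o K)
    {x : E} (hx : x ∈ frontier K) :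
    exitPoint B o K (exitPoint B o' K' (x - o) - o') = x := by
  rw [exitPoint, exitPoint, add_sub_cancel_left]
  exact (hK.exitPoint_linearFlow (hK.ne_of_mem_frontier hx) _).trans (hK.exitPoint_sub hx)

end IsTransverseDomain

lemma isTransverseDomain_closedBall [Nontrivial E] {k : WithTop ℕ∞} (hk : 1 ≤ k) {B : E →L[ℝ] E}
    (hB : ∀ x, x ≠ 0 → 0 < ⟪x, B x⟫_ℝ) : IsTransverseDomain k B 0 (closedBall (0 : E) 1) := by
  have hfr : frontier (closedBall (0 : E) 1) = sphere 0 1 := frontier_closedBall _ one_ne_zero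
  refine ⟨hk, hB, isCompact_closedBall _ _, ?_, fun x hx => ⟨fun z => ‖z‖ ^ 2 - 1, ?_, ?_, ?_, ?_⟩⟩
  · rw [interior_closedBall _ one_ne_zero]
    exact mem_ball_self one_pos
  · exact ((contDiff_norm_sq ℝ).sub contDiff_const).contDiffAt
  · rw [hfr, mem_sphere_zero_iff_norm] at hx
    simp [hx]
  · refine Eventually.of_forall fun z => ⟨?_, ?_⟩
    · rw [mem_closedBall_zero_iff, sub_nonpos, sq_le_one_iff₀ (norm_nonneg z)]
    · rw [hfr, mem_sphere_zero_iff_norm, sub_eq_zero,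
        pow_eq_one_iff_of_nonneg (norm_nonneg z) two_ne_zero]
  · rw [hfr, mem_sphere_zero_iff_norm] at hx
    have h1 : HasFDerivAt (fun z : E => ‖z‖ ^ 2 - 1) (2 • innerSL ℝ x) x :=
      (hasStrictFDerivAt_norm_sq x).hasFDerivAt.sub_const 1
    have h2 := hB x (norm_ne_zero_iff.1 (by rw [hx]; exact one_ne_zero))
    rw [h1.fderiv, sub_zero]
    simpa using h2

lemma IsPrescribedDomain.isTransverseDomain {k : WithTop ℕ∞} (hk : 1 ≤ k) {h : E → ℝ} {K : Set E}
    {N : E → E} (hK : IsPrescribedDomain k h K N) {B : E →L[ℝ] E} {o : E}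
    (ho : o ∈ interior K) (hB : ∀ x, x ≠ 0 → 0 < ⟪x, B x⟫_ℝ)
    (hN : ∀ x ∈ frontier K, 0 < ⟪N x, B (x - o)⟫_ℝ) : IsTransverseDomain k B o K := by
  refine ⟨hk, hB, hK.isCompact, ho, fun x hx => ?_⟩
  obtain ⟨r, s, hs⟩ := hK.exists_isLocalDefining x hx
  refine ⟨s, hs.contDiffAt hs.mem_self, hs.zero, ?_, ?_⟩
  · filter_upwards [ball_mem_nhds x hs.pos] with z hz
    exact ⟨hs.mem_iff z hz, hs.mem_frontier_iff hK.isCompact.isClosed hz⟩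
  · have h1 := hN x hx
    rw [← hs.gradient_eq, gradient, InnerProductSpace.toDual_symm_apply] at h1
    exact h1

end ExitTime

/-! ### The diffeomorphism with the sphere -/

section Diffeomorphism

variable {n : ℕ} {M : Type*} [TopologicalSpace M] [ChartedSpace (EuclideanSpace ℝ (Fin n)) M]
  {k : ℕ∞} {ψ : M → EuclideanSpace ℝ (Fin (n + 1))}

/-- The flow lines of `B` provide a diffeomorphism of the boundary of a transverse domain with the
unit sphere. -/
lemma IsEmbeddedHypersurface.nonempty_diffeomorph_sphere [IsManifold (𝓡 n) k M] [Nonempty M]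
    (hψ : IsEmbeddedHypersurface k ψ)
    (hχ : ∀ p, ∃ r > 0, ∃ χ : EuclideanSpace ℝ (Fin (n + 1)) → M,
      (∀ z ∈ ball (ψ p) r, ContMDiffAt 𝓘(ℝ, EuclideanSpace ℝ (Fin (n + 1))) (𝓡 n) k χ z) ∧
      ∀ q, ψ q ∈ ball (ψ p) r → χ (ψ q) = q)
    {K : Set (EuclideanSpace ℝ (Fin (n + 1)))}
    {B : EuclideanSpace ℝ (Fin (n + 1)) →L[ℝ] EuclideanSpace ℝ (Fin (n + 1))}
    {o : EuclideanSpace ℝ (Fin (n + 1))} (hK : IsTransverseDomain k B o K)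
    (hfr : frontier K = range ψ) :
    Nonempty (M ≃ₘ^k⟮𝓡 n, 𝓡 n⟯ sphere (0 : EuclideanSpace ℝ (Fin (n + 1))) 1) := by
  have : Fact (Module.finrank ℝ (EuclideanSpace ℝ (Fin (n + 1))) = n + 1) :=
    ⟨finrank_euclideanSpace_fin⟩
  let D : Set (EuclideanSpace ℝ (Fin (n + 1))) := closedBall 0 1
  have hD : IsTransverseDomain k B 0 D := isTransverseDomain_closedBall hK.one_le hK.pos
  have hDfr : frontier D = sphere 0 1 := frontier_closedBall _ one_ne_zero
  have hmem : ∀ q, ψ q ∈ frontier K := fun q => hfr ▸ mem_range_self q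
  have hF : ∀ q, exitPoint B 0 D (ψ q - o) ∈ sphere (0 : EuclideanSpace ℝ (Fin (n + 1))) 1 :=
    fun q => hDfr ▸ hD.exitPoint_mem (hK.ne_of_mem_frontier (hmem q))
  have hFs : ContMDiff (𝓡 n) 𝓘(ℝ, EuclideanSpace ℝ (Fin (n + 1))) k
      fun q => exitPoint B 0 D (ψ q - o) := by
    intro q
    have h1 : ContDiffAt ℝ k (fun x => exitPoint B 0 D (x - o)) (ψ q) :=
      ContDiffAt.comp (g := exitPoint B 0 D) (ψ q)
        (hD.contDiffAt_exitPoint (hK.ne_of_mem_frontier (hmem q)))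
        (contDiffAt_id.sub contDiffAt_const)
    exact h1.contMDiffAt.comp q hψ.contMDiff.contMDiffAt
  have hS0 : ∀ y : sphere (0 : EuclideanSpace ℝ (Fin (n + 1))) 1,
      (y : EuclideanSpace ℝ (Fin (n + 1))) ≠ 0 := fun y => ne_zero_of_mem_unit_sphere y
  let G : sphere (0 : EuclideanSpace ℝ (Fin (n + 1))) 1 → M :=
    fun y => Function.invFun ψ (exitPoint B o K y)
  have hG : ∀ y, ψ (G y) = exitPoint B o K y := fun y =>
    Function.invFun_eq (hfr ▸ hK.exitPoint_mem (hS0 y) : exitPoint B o K y ∈ range ψ)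
  refine ⟨⟨⟨codRestrict _ _ hF, G, fun q => ?_, fun y => ?_⟩,
    hFs.codRestrict_euclideanSphere hF, fun y => ?_⟩⟩
  · refine hψ.isEmbedding.injective ?_
    rw [hG, val_codRestrict_apply]
    have h1 := hK.exitPoint_exitPoint_sub (o' := 0) (K' := D) (hmem q)
    rwa [sub_zero] at h1
  · refine Subtype.ext ?_
    rw [val_codRestrict_apply, hG]
    have h1 := hD.exitPoint_exitPoint_sub (o' := o) (K' := K) (x := y) (by rw [hDfr]; exact y.2)
    rwa [sub_zero] at h1
  · obtain ⟨r, hr, χ, hχs, hχψ⟩ := hχ (G y)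
    have h1 : ContMDiffAt (𝓡 n) 𝓘(ℝ, EuclideanSpace ℝ (Fin (n + 1))) k
        (fun y : sphere (0 : EuclideanSpace ℝ (Fin (n + 1))) 1 => exitPoint B o K y) y :=
      (hK.contDiffAt_exitPoint (hS0 y)).contMDiffAt.comp y (contMDiff_coe_sphere y)
    have h2 : ContMDiffAt (𝓡 n) (𝓡 n) k
        (fun y : sphere (0 : EuclideanSpace ℝ (Fin (n + 1))) 1 => χ (exitPoint B o K y)) y :=
      ContMDiffAt.comp y (hχs _ (by rw [← hG]; exact mem_ball_self hr)) h1
    refine h2.congr_of_eventuallyEq ?_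
    have h3 : exitPoint B o K y ∈ ball (ψ (G y)) r := by rw [hG]; exact mem_ball_self hr
    filter_upwards [h1.continuousAt.eventually (isOpen_ball.mem_nhds h3)] with y' h4
    rw [← hG y'] at h4
    change G y' = χ (exitPoint B o K y')
    rw [← hG y', hχψ _ h4]

end Diffeomorphism

/-! ### The axis of symmetry -/

section Axis

variable {n : ℕ}

/-- The common axis of the planes of symmetry is a line. -/
lemma exists_axis {v : Fin n → EuclideanSpace ℝ (Fin (n + 1))} (hlin : LinearIndependent ℝ v)
    (c : Fin n → ℝ) :
    ∃ e o : EuclideanSpace ℝ (Fin (n + 1)), ‖e‖ = 1 ∧ (∀ i, ⟪v i, e⟫_ℝ = 0) ∧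
      (∀ x, (∀ i, ⟪v i, x⟫_ℝ = 0) → x = ⟪e, x⟫_ℝ • e) ∧ ∀ i, ⟪v i, o⟫_ℝ = c i := by
  let W := Submodule.span ℝ (range v)
  have h1 : Module.finrank ℝ W = n := by simpa using finrank_span_eq_card hlin
  have h2 : Module.finrank ℝ Wᗮ = 1 := by
    have := W.finrank_add_finrank_orthogonal
    rw [h1, finrank_euclideanSpace_fin] at this
    omega
  have hW : ∀ x, x ∈ Wᗮ ↔ ∀ i, ⟪v i, x⟫_ℝ = 0 := by
    intro x
    rw [Submodule.mem_orthogonal]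
    refine ⟨fun h i => h _ (Submodule.subset_span (mem_range_self i)), fun h u hu => ?_⟩
    induction hu using Submodule.span_induction with
    | mem y hy => obtain ⟨i, rfl⟩ := hy; exact h i
    | zero => simp
    | add y z _ _ hy hz => rw [inner_add_left, hy, hz, add_zero]
    | smul a y _ hy => rw [inner_smul_left, hy, mul_zero]
  obtain ⟨⟨u, hu⟩, hu0, hspan⟩ := finrank_eq_one_iff'.1 h2
  have hu0' : u ≠ 0 := fun h => hu0 (Subtype.ext h)
  have hun : ‖u‖ ≠ 0 := norm_ne_zero_iff.2 hu0'
  obtain ⟨f, hf⟩ := LinearMap.exists_extend ((Module.Basis.span hlin).constr ℝ c)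
  refine ⟨‖u‖⁻¹ • u, (InnerProductSpace.toDual ℝ _).symm f.toContinuousLinearMap, ?_, ?_, ?_, ?_⟩
  · simp [norm_smul, hun]
  · intro i
    rw [inner_smul_right, (hW u).1 hu i, mul_zero]
  · intro x hx
    obtain ⟨a, ha⟩ := hspan ⟨x, (hW x).2 hx⟩
    have ha' : a • u = x := congrArg Subtype.val ha
    rw [← ha', inner_smul_left, inner_smul_right, real_inner_self_eq_norm_sq, smul_smul]
    congr 1
    simp
    field_simp
  · intro i
    rw [real_inner_comm, InnerProductSpace.toDual_symm_apply]
    have h3 : f (v i) = (Module.Basis.span hlin).constr ℝ c (Module.Basis.span hlin i) := by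
      rw [← hf]
      simp [Module.Basis.span_apply]
    rw [Module.Basis.constr_basis] at h3
    exact h3

end Axis

theorem proposition2p7 {n : ℕ} (hn : 1 ≤ n) {k : ℕ∞} (hk : 2 ≤ k)
    (ℋ : sphere (0 : EuclideanSpace ℝ (Fin (n + 1))) 1 → ℝ)
    (hℋ : ContMDiff (𝓡 n) 𝓘(ℝ, ℝ) 1 ℋ)
    (v : Fin n → EuclideanSpace ℝ (Fin (n + 1)))
    (hv : ∀ i, ‖v i‖ = 1) (hlin : LinearIndependent ℝ v)
    (hinv : ∀ (i : Fin n) (x : sphere (0 : EuclideanSpace ℝ (Fin (n + 1))) 1),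
      ℋ (geodesicReflection (v i) x) = ℋ x)
    {M : Type*} [TopologicalSpace M] [ChartedSpace (EuclideanSpace ℝ (Fin n)) M]
    [IsManifold (𝓡 n) k M] [CompactSpace M] [ConnectedSpace M]
    (ψ : M → EuclideanSpace ℝ (Fin (n + 1)))
    (η : M → sphere (0 : EuclideanSpace ℝ (Fin (n + 1))) 1)
    (hψ : IsEmbeddedHHypersurface k ℋ ψ η) :
    Nonempty (M ≃ₘ^k⟮𝓡 n, 𝓡 n⟯ sphere (0 : EuclideanSpace ℝ (Fin (n + 1))) 1) ∧
      ∀ i : Fin n, ∃ c : ℝ, IsSymmetricBigraph k (range ψ) (v i) c := by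
  have hk1 : (1 : ℕ∞) ≤ k := one_le_two.trans hk
  have hk1' : (1 : WithTop ℕ∞) ≤ k := WithTop.coe_le_coe.2 hk1
  obtain ⟨K, N, ε, hfr, hK, hN, hε⟩ := hψ.exists_isPrescribedDomain hk hn
  have hc : IsPreconnected (frontier K) :=
    hfr ▸ isPreconnected_range hψ.isEmbeddedHypersurface.contMDiff.continuous
  choose c hS using fun i =>
    (hK.isMovingPlaneDomain hε hk hℋ hc (hv i) (hinv i)).exists_isSymmetryHeight
  refine ⟨?_, fun i => ⟨c i, hfr ▸ (hS i).isSymmetricBigraph (hv i) hK hk1 hc⟩⟩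
  obtain ⟨e, o, he, hve, hspan, ho⟩ := exists_axis hlin c
  obtain ⟨B, p, hp, hB, hBN⟩ :=
    exists_transverse_field hk1' hK (hfr ▸ hN) hc hv hS hve hspan he ho
  refine hψ.isEmbeddedHypersurface.nonempty_diffeomorph_sphere (fun q => ?_)
    (hK.isTransverseDomain hk1' hp hB hBN) hfr
  obtain ⟨r, s, χ, hs, -, hχ, hχψ⟩ := hψ.exists_isGraphFunction hk q
  exact ⟨r, hs.pos, χ, hχ, hχψ⟩
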